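/- **Setting.** Circuits are lists of Hadamard, phase, CNOT and $T$ gates on $n$ system qubits together with finitely many ancilla qubits; the T count is the number of $T$ gates. Let $a_p$, $0\le p<n$, be the fermionic annihilation operators on $(\mathbb{C}^2)^{\otimes n}$ in the occupation-number basis, $a_p|j\rangle=(-1)^{j_0+\dots+j_{p-1}}|j \text{ with } j_p:=0\rangle$ if $j_p=1$ and $0$ otherwise. A circuit with unitary $U$ is an $\epsilon$-accurate block encoding of $\mathcal H$ with subnormalization $\alpha>0$ if $\|\mathcal H-\alpha(\langle 0|\otimes I)U(|0\rangle\otimes I)\|\le\epsilon$ in spectral norm, $|0\rangle$ being the all-zero state of the ancillas; it is one in the $\eta$-particle sector if this holds for the restriction of both operators to the span of the basis states with $\eta$ particles. A data lookup for a table with words $b_i\in\{0,1\}^m$, $i\in\iota$, is a circuit acting as $|i\rangle|y\rangle|0\rangle\mapsto|i\rangle|y\oplus b_i\rangle|0\rangle$ on (injectively encoded) address, word and clean work registers of the ancillas, and leaving the other qubits unchanged. A *lookup scheme* with index set $\iota$ and word length $m$ consists of ancilla qubits and these registers, a rule assigning an $m$-bit word to each real number, and circuits `pre`, `mid`, `post`;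 given coefficients $(r_i)_{i\in\iota}$ and a data lookup circuit for the table whose $i$-th entry is the word of $r_i$, its full circuit is pre, lookup, mid, lookup, post. **Statement.** For every $B>0$ there is a constant $C>0$, depending only on $B$, such that the following hold for all integers $n\ge 1$, $\lambda\ge 1$ and all $0<\epsilon<1$. In each case the lookup scheme and $\alpha$ do not depend on the coefficients; only the lookup circuit does. 1. (Banded, full space.) Let $M\ge1$ and $\lambda\le nM$. There are $\alpha\in(0,C\,nM]$ and a lookup scheme indexed by the pairs $(p,q)$ with $|p-q|\le M$, with word length $m\le C(1+\log(nM/\epsilon))$, such that for all real $h_{pq}$ with $|h_{pq}|\le B$ for $|p-q|\le M$ there is a data lookup circuit for the $h_{pq}$ for which the full circuit is an $\epsilon$-accurate block encoding of $\sum_{|p-q|\le M}h_{pq}a_p^\dagger a_q$ (which is $\sum_{p,q}h_{pq}a_p^\dagger a_q$ if $h_{pq}$ vanishes for $|p-q|>M$) with subnormalization $\alpha$ and T count at most $$C\Big(n+\Big\lceil\frac{nM}{\lambda}\Big\rceil+\lambda\log\frac{nM}{\epsilon}\Big).$$ 2. (Banded, $\eta$-particle sector.) Let $M\ge1$, $\lambda\le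 nM$ and $1\le\eta\le n$. The same holds in the $\eta$-particle sector with $\alpha\in(0,C\,M\eta]$, $m\le C(1+\log(\eta M/\epsilon))$ and T count at most $$C\Big(n\log(\eta+1)+\Big\lceil\frac{nM}{\lambda}\Big\rceil+\lambda\log\frac{\eta M}{\epsilon}\Big).$$ 3. (Translation-invariant, full space.) Let $\lambda\le 2n-1$. There are $\alpha\in(0,C\,n^2]$ and a lookup scheme whose table has $L=2n-1$ entries, with $m\le C(1+\log(n/\epsilon))$, such that for every $T:\mathbb Z\to\mathbb R$ with $|T(d)|\le B$ for $|d|<n$ there is a data lookup circuit for $T(-(n-1)),\dots,T(n-1)$ for which the full circuit is an $\epsilon$-accurate block encoding of $\sum_{p,q=0}^{n-1}T(p-q)a_p^\dagger a_q$ with subnormalization $\alpha$ and T count at most $$C\Big(n+\Big\lceil\frac n\lambda\Big\rceil+\lambda\log\frac n\epsilon\Big).$$ 4. (Translation-invariant, $\eta$-particle sector.) Let $1\le\eta\le n$ and $\lambda\le n\eta$. The same holds in the $\eta$-particle sector, again with $L=2n-1$ table entries, with $\alpha\in(0,C\,n\eta]$, $m\le C(1+\log(n\eta/\epsilon))$ and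 T count at most $$C\Big(n\log(\eta+1)+\Big\lceil\frac n\lambda\Big\rceil+\lambda\log\frac{n\eta}{\epsilon}\Big).$$ -/

import Mathlib

open scoped Matrix Matrix.Norms.L2Operator

noncomputable section

namespace StructuredBE

/-! ### Clifford+T circuits -/

/-- The gates of the Clifford+T set, acting on qubits labelled by `W`:
the Clifford generators Hadamard, phase and CNOT, and the `T` gate. -/
inductive Gate (W : Type) : Type
  | H (i : W) : Gate W
  | S (i : W) : Gate W
  | CNOT (c t : W) (hne : c ≠ t) : Gate W
  | T (i : W) : Gate W

variable {W : Type} [Fintype W] [DecidableEq W]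

/-- The matrix of a gate in the computational basis, whose vectors are the bit strings `W → Bool`. -/
def Gate.mat : Gate W → Matrix (W → Bool) (W → Bool) ℂ
  | .H i => fun x y =>
      if ∀ k, k ≠ i → x k = y k then
        (if x i = true ∧ y i = true then -1 else 1) / (Real.sqrt 2 : ℂ)
      else 0
  | .S i => Matrix.diagonal fun x => if x i = true then Complex.I else 1
  | .CNOT c t _ => fun x y => if x = Function.update y t (xor (y t) (y c)) then 1 else 0
  | .T i => Matrix.diagonal fun x =>
      if x i = true then Complex.exp (Complex.I * (Real.pi / 4 : ℝ)) else 1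

/-- A circuit is a list of gates; the head of the list is applied first. -/
abbrev Circuit (W : Type) : Type := List (Gate W)

/-- The unitary matrix of a circuit. -/
def Circuit.mat : Circuit W → Matrix (W → Bool) (W → Bool) ℂ
  | [] => 1
  | g :: c => Circuit.mat c * g.mat

/-- The number of `T` gates of a circuit. -/
def tCount {W : Type} : Circuit W → ℕ
  | [] => 0
  | .T _ :: c => tCount c + 1
  | _ :: c => tCount c

/-! ### Second-quantized one-body Hamiltonians on `n` modes -/

/-- The annihilation operator `a_p` in the occupation-number basis:
`a_p |j⟩ = (-1)^(j_0 + ⋯ + j_{p-1}) |j with j_p := 0⟩` if `j_p = 1`, and `0` otherwise. -/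
def annih {n : ℕ} (p : Fin n) : Matrix (Fin n → Bool) (Fin n → Bool) ℂ := fun x y =>
  if y p = true ∧ x = Function.update y p false then
    (-1) ^ (Finset.univ.filter fun k : Fin n => k < p ∧ y k = true).card
  else 0

/-- The one-body Hamiltonian `∑_{p,q} h_{pq} a_p† a_q`. -/
def oneBody {n : ℕ} (h : Fin n → Fin n → ℝ) : Matrix (Fin n → Bool) (Fin n → Bool) ℂ :=
  ∑ p, ∑ q, (h p q : ℂ) • ((annih p)ᴴ * annih q)

/-- The coefficients truncated to the band `|p - q| ≤ M`. -/
def truncate {n : ℕ} (M : ℕ) (h : Fin n → Fin n → ℝ) : Fin n → Fin n → ℝ := fun p q =>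
  if |(p : ℤ) - (q : ℤ)| ≤ (M : ℤ) then h p q else 0

/-- The index pairs of the band; there are at most `n (2M + 1)` of them. -/
abbrev Band (n M : ℕ) : Type := {pq : Fin n × Fin n // |(pq.1 : ℤ) - (pq.2 : ℤ)| ≤ (M : ℤ)}

/-- The number of particles of a basis state. -/
def particles {n : ℕ} (x : Fin n → Bool) : ℕ := (Finset.univ.filter fun k => x k = true).card

/-! ### Block encodings -/

/-- The block `(⟨0| ⊗ I) U (|0⟩ ⊗ I)`, where `A` labels the ancilla qubits. -/
def ancBlock {n : ℕ} {A : Type} (U : Matrix (A ⊕ Fin n → Bool) (A ⊕ Fin n → Bool) ℂ) :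
    Matrix (Fin n → Bool) (Fin n → Bool) ℂ := fun x y =>
  U (Sum.elim (fun _ => false) x) (Sum.elim (fun _ => false) y)

/-- `c` is a block encoding of `Ham` with subnormalization factor `α` and precision `ε`
(in the spectral norm). -/
def IsBlockEncoding {n : ℕ} {A : Type} [Fintype A] [DecidableEq A] (c : Circuit (A ⊕ Fin n))
    (α ε : ℝ) (Ham : Matrix (Fin n → Bool) (Fin n → Bool) ℂ) : Prop :=
  ‖Ham - (α : ℂ) • ancBlock c.mat‖ ≤ ε

/-- The same, for inputs in the `η`-particle sector: the two operators are compared (in the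
spectral norm) on the span of the basis states with `η` particles. -/
def IsSectorBlockEncoding {n : ℕ} {A : Type} [Fintype A] [DecidableEq A]
    (c : Circuit (A ⊕ Fin n)) (η : ℕ) (α ε : ℝ)
    (Ham : Matrix (Fin n → Bool) (Fin n → Bool) ℂ) : Prop :=
  ‖(Ham - (α : ℂ) • ancBlock c.mat).submatrix id
    (Subtype.val : {y : Fin n → Bool // particles y = η} → (Fin n → Bool))‖ ≤ ε

/-! ### Circuits built around a data lookup of the coefficients -/

/-- The part of a block-encoding circuit that does not depend on the coefficients. The full
circuit is `pre, lookup, mid, lookup, post`, where `lookup` reads a table with one entry for each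
element of `ι`. The entry for a coefficient `r` is the `m`-bit word `round r`. -/
structure LookupScheme (n : ℕ) (ι : Type) where
  /-- labels of the ancilla qubits -/
  Anc : Type
  [fintypeAnc : Fintype Anc]
  [decEqAnc : DecidableEq Anc]
  /-- circuit before, between and after the two lookups -/
  pre : Circuit (Anc ⊕ Fin n)
  mid : Circuit (Anc ⊕ Fin n)
  post : Circuit (Anc ⊕ Fin n)
  /-- number of address qubits -/
  k : ℕ
  /-- word length -/
  m : ℕ
  /-- address register -/
  addr : Fin k ↪ Anc
  /-- word register -/
  word : Fin m ↪ Anc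
  /-- work qubits of the lookup -/
  work : Finset Anc
  addr_ne_word : ∀ i j, addr i ≠ word j
  addr_not_work : ∀ i, addr i ∉ work
  word_not_work : ∀ j, word j ∉ work
  /-- address of a table entry -/
  enc : ι → Fin k → Bool
  enc_injective : Function.Injective enc
  /-- the word stored in the table for a coefficient -/
  round : ℝ → Fin m → Bool

attribute [instance] LookupScheme.fintypeAnc LookupScheme.decEqAnc

namespace LookupScheme

variable {n : ℕ} {ι : Type} (s : LookupScheme n ι)

/-- The basis state `x` with the word `b` added bitwise to the word register. -/
def xorWord (b : Fin s.m → Bool) (x : s.Anc ⊕ Fin n → Bool) : s.Anc ⊕ Fin n → Bool := fun w =>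
  xor (x w) (decide (∃ j, Sum.inl (s.word j) = w ∧ b j = true))

/-- `look` is a data lookup for the coefficients `r`: for each entry `i`, it maps
`|enc i⟩ |y⟩ |0⟩` to `|enc i⟩ |y ⊕ round (r i)⟩ |0⟩` on the address, word and work registers, and
leaves all other qubits unchanged. -/
def IsLookup (look : Circuit (s.Anc ⊕ Fin n)) (r : ι → ℝ) : Prop :=
  ∀ (i : ι) (y : s.Anc ⊕ Fin n → Bool),
    (∀ a, y (Sum.inl (s.addr a)) = s.enc i a) →
    (∀ w ∈ s.work, y (Sum.inl w) = false) →
    ∀ x, look.mat x y = if x = s.xorWord (s.round (r i)) y then 1 else 0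

/-- The full circuit. -/
def circuit (look : Circuit (s.Anc ⊕ Fin n)) : Circuit (s.Anc ⊕ Fin n) :=
  s.pre ++ look ++ s.mid ++ look ++ s.post

end LookupScheme

end StructuredBE

end

/-!
A one-body Hamiltonian has the matrix elements `⟨x| ∑ h_{pq} a_p† a_q |y⟩ = ∑ h_{pq} ⟨a_p x, a_q y⟩`
(`oneBody_apply`), so a block encoding may annihilate a particle of `y`, move it by a displacement with
the right amplitude, and compare the result with what annihilating a particle of `x` gives.

The circuit puts a selection register `j`, a displacement register `d` and a comparison register `u`
into uniform superposition. A classical reversible circuit then replaces the pair of `y` and `j` by the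
state without the particle that `j` selects and the mode number `q` of this particle. The lookup loads
the word `b` of the hop from `q` by the displacement `d`; a sign that depends on whether `u < b` has
the mean value `1 - 2 b / 2 ^ m` over `u`, and the second lookup erases the word. The displacement is
added to `q`, and the annihilation step, this time with offset mode numbers, is undone. All signs,
those of the comparison and the fermionic ones, are produced by flipping a qubit between Hadamard
gates and phase flips. Between the Hadamard gates the whole circuit is a permutation of bit strings
with signs, so the block counts, with signs, the pairs of choices that lead to the same bit string
(`ancBlock_eq_sum`); the count is evaluated in `block_sum`. Selections that hit no particle are marked
by a flag on the side of `y` and by another flag on the side of `x`, and never contribute.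

On the full space `j` is the binary mode number, which needs `O(n)` Toffoli gates. In the sector with
`η` particles `j` is the rank of the particle among the occupied modes. It has only `1 + log₂ η` bits,
which gives the smaller subnormalization `O(M η)`, and it is found by a counter that runs over the modes
with `O(n log (η + 1))` Toffoli gates. Both are instances of `HasCode`.

The lookup splits the address in two: the one-hot encoding of the high part loads `2 ^ o` words by CNOT
gates alone, and the one-hot encoding of the low part, of `o` bits with `2 ^ o ≤ λ`, selects one of them
(`lookupStep_realizes`). In the translation-invariant case the address is the displacement alone.

The rounding of the coefficients, to within `2 B / 2 ^ m`, changes the Hamiltonian by a one-body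
Hamiltonian with small coefficients. By Schur's test its norm on states with at most `N` particles is at
most `N` times the row and column sums of the coefficients (`norm_oneBody_submatrix_le`), which is at most
`ε` for a word length `m` of order `1 + log (N M / ε)`.
-/

open scoped Matrix Matrix.Norms.L2Operator

noncomputable section

namespace StructuredBE

/-! ### Monomial matrices and the Toffoli gate -/

section Monomial

variable {W : Type} [Fintype W] [DecidableEq W]

theorem Circuit.mat_append (c c' : Circuit W) :
    Circuit.mat (c ++ c') = Circuit.mat c' * Circuit.mat c := by
  induction c with
  | nil => simp [Circuit.mat]
  | cons g c ih => simp [Circuit.mat, ih, mul_assoc]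

theorem tCount_append {W : Type} (c c' : Circuit W) : tCount (c ++ c') = tCount c + tCount c' := by
  induction c with
  | nil => simp [tCount]
  | cons g c ih => cases g <;> simp [tCount, ih, add_right_comm]

/-- The matrix that maps each basis vector `y` to `φ y` times the basis vector `f y`. -/
def monoMat (f : (W → Bool) → (W → Bool)) (φ : (W → Bool) → ℂ) :
    Matrix (W → Bool) (W → Bool) ℂ := fun x y => if x = f y then φ y else 0

theorem monoMat_mul (f g : (W → Bool) → (W → Bool)) (φ ψ : (W → Bool) → ℂ) :
    monoMat f φ * monoMat g ψ = monoMat (fun y => f (g y)) (fun y => φ (g y) * ψ y) := by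
  ext x y
  simp only [Matrix.mul_apply, monoMat]
  rw [Finset.sum_eq_single (g y)]
  · by_cases h : x = f (g y) <;> simp [h]
  · intro b _ hb; simp [hb]
  · simp

omit [DecidableEq W] in
theorem monoMat_id : monoMat (fun y => y) (fun _ => 1) = (1 : Matrix (W → Bool) (W → Bool) ℂ) := by
  ext x y; simp [monoMat, Matrix.one_apply]

theorem Gate.mat_cnot (c t : W) (h : c ≠ t) :
    (Gate.CNOT c t h).mat = monoMat (fun y => Function.update y t (xor (y t) (y c))) fun _ => 1 :=
  rfl

omit [DecidableEq W] in
theorem diagonal_eq_monoMat (φ : (W → Bool) → ℂ) :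
    Matrix.diagonal φ = monoMat (fun y => y) φ := by
  ext x y
  by_cases h : x = y
  · subst h; simp [monoMat]
  · simp [monoMat, h]

theorem Gate.mat_S (i : W) :
    (Gate.S i).mat = monoMat (fun y => y) fun y => if y i = true then Complex.I else 1 :=
  diagonal_eq_monoMat _

/-- The eighth root of unity `exp (iπ/4)`. -/
def omega8 : ℂ := Complex.exp (Complex.I * (Real.pi / 4 : ℝ))

theorem Gate.mat_T (i : W) :
    (Gate.T i).mat = monoMat (fun y => y) fun y => if y i = true then omega8 else 1 :=
  diagonal_eq_monoMat _

theorem omega8_sq : omega8 ^ 2 = Complex.I := by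
  rw [omega8, ← Complex.exp_nat_mul]
  have : ((2 : ℕ) : ℂ) * (Complex.I * ((Real.pi / 4 : ℝ) : ℂ)) = (Real.pi : ℂ) / 2 * Complex.I := by
    push_cast; ring
  rw [this, Complex.exp_pi_div_two_mul_I]

theorem omega8_mul_I_pow : omega8 * (Complex.I * (Complex.I * (Complex.I * omega8))) = 1 := by
  have h := omega8_sq
  calc omega8 * (Complex.I * (Complex.I * (Complex.I * omega8)))
      = omega8 ^ 2 * Complex.I * (Complex.I * Complex.I) := by ring
    _ = 1 := by rw [h]; simp

/-- The inverse `T` gate, at the cost of one `T` gate. -/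
def tDagger (i : W) : Circuit W := [.T i, .S i, .S i, .S i]

theorem mat_tDagger (i : W) :
    Circuit.mat (tDagger i) = monoMat (fun y => y) fun y => if y i = true then omega8⁻¹ else 1 := by
  have h0 : omega8 ≠ 0 := Complex.exp_ne_zero _
  have h1 : Complex.I * (Complex.I * (Complex.I * omega8)) = omega8⁻¹ := by
    exact eq_inv_of_mul_eq_one_right omega8_mul_I_pow
  simp only [tDagger, Circuit.mat, Gate.mat_S, Gate.mat_T, one_mul, monoMat_mul]
  congr 1
  ext y
  by_cases h : y i = true
  · simp only [h, if_true, mul_assoc, h1]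
  · simp [h]

/-- Conjugating a diagonal circuit by a CNOT gate. -/
def cnotConj (c t : W) (h : c ≠ t) (d : Circuit W) : Circuit W :=
  [.CNOT c t h] ++ d ++ [.CNOT c t h]

theorem mat_cnotConj (c t : W) (h : c ≠ t) (d : Circuit W) (φ : (W → Bool) → ℂ)
    (hd : Circuit.mat d = monoMat (fun y => y) φ) :
    Circuit.mat (cnotConj c t h d) =
      monoMat (fun y => y) fun y => φ (Function.update y t (xor (y t) (y c))) := by
  simp only [cnotConj, Circuit.mat_append, hd, Circuit.mat, Gate.mat_cnot, one_mul, monoMat_mul,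
    mul_one]
  congr 1
  funext y
  simp [h]

/-- The doubly controlled phase flip. The phase polynomial
`a + b + c - (a ⊕ b) - (b ⊕ c) - (a ⊕ c) + (a ⊕ b ⊕ c) = 4abc` gives one `T` or inverse `T` gate
for each of its seven terms. -/
def ccz (a b c : W) (hab : a ≠ b) (hac : a ≠ c) (hbc : b ≠ c) : Circuit W :=
  [.T a] ++ [.T b] ++ [.T c] ++ cnotConj a b hab (tDagger b) ++ cnotConj b c hbc (tDagger c) ++
    cnotConj a c hac (tDagger c) ++ cnotConj a c hac (cnotConj b c hbc [.T c])

theorem mat_ccz (a b c : W) (hab : a ≠ b) (hac : a ≠ c) (hbc : b ≠ c) :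
    Circuit.mat (ccz a b c hab hac hbc) = monoMat (fun y => y) fun y =>
      if (y a = true ∧ y b = true) ∧ y c = true then -1 else 1 := by
  have h0 : omega8 ≠ 0 := Complex.exp_ne_zero _
  have h4 : omega8 ^ 4 = -1 := by
    rw [show 4 = 2 * 2 from rfl, pow_mul, omega8_sq]; simp
  have hT : ∀ i : W, Circuit.mat [Gate.T i] =
      monoMat (fun y => y) fun y => if y i = true then omega8 else 1 := by
    intro i; simp [Circuit.mat, Gate.mat_T]
  simp only [ccz, Circuit.mat_append, hT, mat_cnotConj _ _ _ _ _ (mat_tDagger _),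
    mat_cnotConj _ _ _ _ _ (mat_cnotConj _ _ _ _ _ (hT _)), monoMat_mul]
  congr 1
  funext y
  simp only [Function.update_self, Function.update_of_ne hbc]
  cases y a <;> cases y b <;> cases y c <;> simp [h0]
  field_simp
  rw [h4]

omit [Fintype W] [DecidableEq W] in
theorem tCount_ccz (a b c : W) (hab : a ≠ b) (hac : a ≠ c) (hbc : b ≠ c) :
    tCount (ccz a b c hab hac hbc) = 7 := rfl

/-- Conjugating a diagonal matrix by a Hadamard gate. For the phase flip controlled by a condition on
the other wires this is the bit flip controlled by the same condition. -/
theorem hadamard_conj_apply (t : W) (φ : (W → Bool) → ℂ) (x y : W → Bool) :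
    ((Gate.H t).mat * (monoMat (fun y => y) φ * (Gate.H t).mat)) x y =
      if ∀ k, k ≠ t → x k = y k then
        ((φ (Function.update y t false) +
          (if xor (x t) (y t) then -1 else 1) * φ (Function.update y t true))) / 2
      else 0 := by
  have h2 : ((Real.sqrt 2 : ℝ) : ℂ) * (Real.sqrt 2 : ℝ) = 2 := by
    rw [← Complex.ofReal_mul, Real.mul_self_sqrt (by norm_num)]; norm_num
  have hne : ((Real.sqrt 2 : ℝ) : ℂ) ≠ 0 := by
    intro h; rw [h] at h2; norm_num at h2
  rw [← diagonal_eq_monoMat, Matrix.mul_apply]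
  simp only [Matrix.diagonal_mul]
  have hsub : ∀ z : W → Bool, z ∉ ({Function.update y t false, Function.update y t true} : Finset _) →
      (Gate.H t).mat x z * (φ z * (Gate.H t).mat z y) = 0 := by
    intro z hz
    simp only [Finset.mem_insert, Finset.mem_singleton, not_or] at hz
    have : ¬ ∀ k, k ≠ t → z k = y k := by
      intro h
      have hz' : z = Function.update y t (z t) := by
        funext k
        by_cases hk : k = t
        · subst hk; simp
        · simp [hk, h k hk]
      cases hzt : z t
      · rw [hzt] at hz'; exact hz.1 hz'
      · rw [hzt] at hz'; exact hz.2 hz'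
    simp [Gate.mat, this]
  rw [← Finset.sum_subset (Finset.subset_univ _) (fun z _ hz => hsub z hz), Finset.sum_pair]
  · have e : ∀ b, (∀ k, k ≠ t → x k = Function.update y t b k) ↔ ∀ k, k ≠ t → x k = y k := by
      intro b
      refine forall_congr' fun k => forall_congr' fun hk => ?_
      simp [hk]
    have e' : ∀ b, ∀ k, k ≠ t → Function.update y t b k = y k := by
      intro b k hk; simp [hk]
    have hr : ∀ b, (Gate.H t).mat (Function.update y t b) y =
        (if b = true ∧ y t = true then -1 else 1) / (Real.sqrt 2 : ℂ) := by
      intro b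
      simp only [Gate.mat]
      rw [if_pos (e' b), Function.update_self]
    by_cases h : ∀ k, k ≠ t → x k = y k
    · have hl : ∀ b, (Gate.H t).mat x (Function.update y t b) =
          (if x t = true ∧ b = true then -1 else 1) / (Real.sqrt 2 : ℂ) := by
        intro b
        simp only [Gate.mat]
        rw [if_pos ((e b).2 h), Function.update_self]
      rw [if_pos h, hl, hl, hr, hr]
      cases hx : x t <;> cases hy : y t <;> simp <;> field_simp <;> rw [pow_two, h2] <;> ring
    · have hl : ∀ b, (Gate.H t).mat x (Function.update y t b) = 0 := by
        intro b
        simp only [Gate.mat]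
        rw [if_neg (fun h' => h ((e b).1 h'))]
      rw [if_neg h, hl, hl]
      simp
  · intro h
    have := congrFun h t
    simp at this

end Monomial

/-! ### Classical reversible circuits -/

/-- A control condition of a classical gate: constantly true, a single wire, or the conjunction of
two wires. -/
inductive Ctl (W : Type) : Type
  | one
  | lit (a : W)
  | and (a b : W)

namespace Ctl

variable {W W' : Type}

/-- The truth value of a control condition. -/
def eval (y : W → Bool) : Ctl W → Bool
  | one => true
  | lit a => y a
  | and a b => y a && y b

/-- The wires read by a control condition. -/
def wires : Ctl W → List W
  | one => []
  | lit a => [a]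
  | and a b => [a, b]

/-- The number of Toffoli gates needed for a target with this control. -/
def cost : Ctl W → ℕ
  | one => 0
  | lit _ => 0
  | and _ _ => 1

/-- The condition on relabelled wires. -/
def map (e : W → W') : Ctl W → Ctl W'
  | one => one
  | lit a => lit (e a)
  | and a b => and (e a) (e b)

theorem eval_congr {y z : W → Bool} {c : Ctl W} (h : ∀ a ∈ c.wires, y a = z a) :
    c.eval y = c.eval z := by
  cases c <;> simp_all [eval, wires]

theorem eval_map (e : W → W') (y : W' → Bool) (c : Ctl W) :
    (c.map e).eval y = c.eval fun w => y (e w) := by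
  cases c <;> rfl

theorem wires_map (e : W → W') (c : Ctl W) : (c.map e).wires = c.wires.map e := by
  cases c <;> rfl

theorem cost_map (e : W → W') (c : Ctl W) : (c.map e).cost = c.cost := by
  cases c <;> rfl

end Ctl

/-- A classical gate: the target is flipped if the control condition holds. A gate whose target
occurs in its control is read as the identity. -/
structure CGate (W : Type) : Type where
  tgt : W
  ctl : Ctl W

namespace CGate

variable {W W' : Type} [DecidableEq W] [DecidableEq W']

/-- The action of a gate on bit strings. -/
def act (g : CGate W) (y : W → Bool) : W → Bool :=
  if g.tgt ∈ g.ctl.wires then y else Function.update y g.tgt (xor (y g.tgt) (g.ctl.eval y))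

/-- The Clifford+T circuit of a gate. -/
def toCircuit : CGate W → Circuit W
  | ⟨t, .one⟩ => [.H t, .S t, .S t, .H t]
  | ⟨t, .lit a⟩ => if h : a = t then [] else [.CNOT a t h]
  | ⟨t, .and a b⟩ =>
      if hat : a = t then [] else if hbt : b = t then [] else
      if hab : a = b then [.CNOT a t hat] else
        [.H t] ++ ccz a b t hab hat hbt ++ [.H t]

theorem tCount_toCircuit (g : CGate W) : tCount g.toCircuit ≤ 7 * g.ctl.cost := by
  obtain ⟨t, c⟩ := g
  cases c with
  | one => simp [toCircuit, tCount]
  | lit a => simp only [toCircuit]; split_ifs <;> simp [tCount]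
  | and a b =>
    simp only [toCircuit]
    split_ifs <;> simp [tCount, tCount_append, tCount_ccz, Ctl.cost]

theorem mat_toCircuit [Fintype W] (g : CGate W) :
    Circuit.mat g.toCircuit = monoMat g.act fun _ => 1 := by
  obtain ⟨t, c⟩ := g
  -- a Hadamard-conjugated phase flip is a bit flip
  have key : ∀ (p : (W → Bool) → Bool) (φ : (W → Bool) → ℂ),
      (∀ y b, p (Function.update y t b) = p y) →
      (∀ y, φ y = if p y = true ∧ y t = true then -1 else 1) →
      (Gate.H t).mat * (monoMat (fun y => y) φ * (Gate.H t).mat) =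
        monoMat (fun y => Function.update y t (xor (y t) (p y))) fun _ => 1 := by
    intro p φ hp hφ
    ext x y
    rw [hadamard_conj_apply]
    simp only [hφ, hp, monoMat, Function.update_self]
    by_cases h : ∀ k, k ≠ t → x k = y k
    · have hx : x = Function.update y t (x t) := by
        funext k
        by_cases hk : k = t
        · subst hk; simp
        · simp [hk, h k hk]
      have hx' : (x = Function.update y t (xor (y t) (p y))) ↔ x t = xor (y t) (p y) := by
        constructor
        · intro e; rw [e]; simp
        · intro e; rw [← e]; exact hx
      rw [if_pos h]
      simp only [hx']
      cases p y <;> cases x t <;> cases y t <;> simp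
    · have hx' : x ≠ Function.update y t (xor (y t) (p y)) := by
        rintro rfl
        exact h fun k hk => by simp [hk]
      rw [if_neg h, if_neg hx']
  cases c with
  | one =>
    have hss : Circuit.mat [Gate.H t, .S t, .S t, .H t] =
        (Gate.H t).mat * (((Gate.S t).mat * (Gate.S t).mat) * (Gate.H t).mat) := by
      simp [Circuit.mat, mul_assoc]
    rw [toCircuit, hss, Gate.mat_S, monoMat_mul, key (fun _ => true)]
    · congr 1
    · intros; rfl
    · intro y; cases y t <;> simp
  | lit a =>
    by_cases h : a = t
    · subst h
      simp [toCircuit, Circuit.mat, ← monoMat_id]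
      congr 1
      funext y
      simp [act, Ctl.wires]
    · simp only [toCircuit, h, dite_false, Circuit.mat, one_mul, Gate.mat_cnot]
      congr 1
      funext y
      simp [act, Ctl.wires, Ne.symm h, Ctl.eval]
  | and a b =>
    by_cases hat : a = t
    · simp only [toCircuit, hat, dite_true, Circuit.mat, ← monoMat_id]
      congr 1
      funext y
      simp [act, Ctl.wires]
    by_cases hbt : b = t
    · simp only [toCircuit, hat, hbt, dite_true, dite_false, Circuit.mat, ← monoMat_id]
      congr 1
      funext y
      simp [act, Ctl.wires]
    by_cases hab : a = b
    · subst hab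
      simp only [toCircuit, hat, dite_true, dite_false, Circuit.mat, one_mul, Gate.mat_cnot]
      congr 1
      funext y
      simp [act, Ctl.wires, Ne.symm hat, Ctl.eval]
    · simp only [toCircuit, hat, hbt, hab, dite_false, Circuit.mat_append, mat_ccz]
      simp only [Circuit.mat, one_mul]
      rw [key (fun y => y a && y b)]
      · congr 1
        funext y
        simp [act, Ctl.wires, Ne.symm hat, Ne.symm hbt, Ctl.eval]
      · intro y c; simp [hat, hbt]
      · intro y; simp

/-- The gate on relabelled wires. -/
def map (e : W → W') (g : CGate W) : CGate W' := ⟨e g.tgt, g.ctl.map e⟩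

theorem act_act (g : CGate W) (y : W → Bool) : g.act (g.act y) = y := by
  unfold act
  by_cases h : g.tgt ∈ g.ctl.wires
  · simp [h]
  · simp only [h, if_false]
    have : g.ctl.eval (Function.update y g.tgt (xor (y g.tgt) (g.ctl.eval y))) = g.ctl.eval y := by
      apply Ctl.eval_congr
      intro a ha
      rw [Function.update_of_ne]
      rintro rfl
      exact h ha
    rw [this]
    simp

end CGate

/-- The action of a list of classical gates; the head acts first. -/
def run {W : Type} [DecidableEq W] : List (CGate W) → (W → Bool) → (W → Bool)
  | [], y => y
  | g :: c, y => run c (g.act y)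

/-- The Clifford+T circuit of a list of classical gates. -/
def compile {W : Type} [DecidableEq W] : List (CGate W) → Circuit W
  | [] => []
  | g :: c => g.toCircuit ++ compile c

/-- The number of Toffoli gates in a list of classical gates. -/
def toffoliCount {W : Type} : List (CGate W) → ℕ
  | [] => 0
  | g :: c => g.ctl.cost + toffoliCount c

section Run

variable {W W' : Type} [DecidableEq W] [DecidableEq W']

theorem run_append (c c' : List (CGate W)) (y : W → Bool) : run (c ++ c') y = run c' (run c y) := by
  induction c generalizing y with
  | nil => rfl
  | cons g c ih => simp [run, ih]

theorem compile_append (c c' : List (CGate W)) : compile (c ++ c') = compile c ++ compile c' := by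
  induction c with
  | nil => rfl
  | cons g c ih => simp [compile, ih]

theorem toffoliCount_append {W : Type} (c c' : List (CGate W)) :
    toffoliCount (c ++ c') = toffoliCount c + toffoliCount c' := by
  induction c with
  | nil => simp [toffoliCount]
  | cons g c ih => simp [toffoliCount, ih, add_assoc]

theorem toffoliCount_reverse {W : Type} (c : List (CGate W)) :
    toffoliCount c.reverse = toffoliCount c := by
  induction c with
  | nil => rfl
  | cons g c ih => simp [toffoliCount, toffoliCount_append, ih, add_comm]

/-- Every classical gate is an involution, so the reversed list computes the inverse. -/
theorem run_reverse_run (c : List (CGate W)) (y : W → Bool) : run c.reverse (run c y) = y := by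
  induction c generalizing y with
  | nil => rfl
  | cons g c ih => simp [run, run_append, ih, CGate.act_act]

theorem run_run_reverse (c : List (CGate W)) (y : W → Bool) : run c (run c.reverse y) = y := by
  have := run_reverse_run c.reverse y
  rwa [List.reverse_reverse] at this

theorem tCount_compile (c : List (CGate W)) : tCount (compile c) ≤ 7 * toffoliCount c := by
  induction c with
  | nil => simp [compile, tCount]
  | cons g c ih =>
    have := g.tCount_toCircuit
    simp only [compile, tCount_append, toffoliCount]
    omega

theorem mat_compile [Fintype W] (c : List (CGate W)) :
    Circuit.mat (compile c) = monoMat (run c) fun _ => 1 := by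
  induction c with
  | nil => simp [compile, Circuit.mat, ← monoMat_id]; rfl
  | cons g c ih =>
    simp only [compile, Circuit.mat_append, ih, CGate.mat_toCircuit, monoMat_mul, mul_one]
    rfl

theorem toffoliCount_map {W W' : Type} (e : W → W') (c : List (CGate W)) :
    toffoliCount (c.map (CGate.map e)) = toffoliCount c := by
  induction c with
  | nil => rfl
  | cons g c ih => simp [toffoliCount, ih, CGate.map, Ctl.cost_map]

/-- Relabelling the wires: the wires in the range are acted upon as before, the others are left
unchanged. -/
theorem run_map {e : W → W'} (he : Function.Injective e) (c : List (CGate W)) (y : W' → Bool) :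
    (∀ w, run (c.map (CGate.map e)) y (e w) = run c (fun w => y (e w)) w) ∧
    ∀ w', w' ∉ Set.range e → run (c.map (CGate.map e)) y w' = y w' := by
  induction c generalizing y with
  | nil => exact ⟨fun _ => rfl, fun _ _ => rfl⟩
  | cons g c ih =>
    have h1 : (fun w => (g.map e).act y (e w)) = g.act fun w => y (e w) := by
      funext w
      have hm : (g.map e).tgt ∈ (g.map e).ctl.wires ↔ g.tgt ∈ g.ctl.wires := by
        rw [CGate.map, Ctl.wires_map, List.mem_map_of_injective he]
      simp only [CGate.act, hm]
      split_ifs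
      · rfl
      · simp only [CGate.map, Ctl.eval_map]
        by_cases hw : w = g.tgt
        · subst hw; simp
        · simp [hw, he.ne hw]
    refine ⟨fun w => ?_, fun w' hw' => ?_⟩
    · simp only [List.map_cons, run]
      rw [(ih _).1, h1]
    · simp only [List.map_cons, run]
      rw [(ih _).2 _ hw']
      simp only [CGate.act]
      split_ifs
      · rfl
      · rw [Function.update_of_ne]
        rintro rfl
        exact hw' ⟨_, rfl⟩

end Run

/-! ### Computing with clean work bits -/

section Layers

variable {W : Type}

/-- The sum modulo two of a list of bits. -/
def xorAll (l : List Bool) : Bool := l.foldr xor false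

@[simp] theorem xorAll_nil : xorAll [] = false := rfl

@[simp] theorem xorAll_cons (b : Bool) (l : List Bool) : xorAll (b :: l) = xor b (xorAll l) := rfl

/-- The sum modulo two of the values of a list of control conditions. -/
def ctlSum (G : List (Ctl W)) (y : W → Bool) : Bool := xorAll (G.map (Ctl.eval y))

@[simp] theorem ctlSum_nil (y : W → Bool) : ctlSum [] y = false := rfl

@[simp] theorem ctlSum_cons (c : Ctl W) (G : List (Ctl W)) (y : W → Bool) :
    ctlSum (c :: G) y = xor (c.eval y) (ctlSum G y) := rfl

theorem ctlSum_congr {G : List (Ctl W)} {y z : W → Bool}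
    (h : ∀ c ∈ G, ∀ a ∈ c.wires, y a = z a) : ctlSum G y = ctlSum G z := by
  unfold ctlSum
  congr 1
  exact List.map_congr_left fun c hc => Ctl.eval_congr (h c hc)

/-- The number of Toffoli gates needed for a list of control conditions. -/
def ctlCost (G : List (Ctl W)) : ℕ := (G.map Ctl.cost).sum

/-- The list of gates that adds, for each wire `t`, the conditions `G t` to `t`. -/
def layer [Fintype W] (G : W → List (Ctl W)) : List (CGate W) :=
  (Finset.univ : Finset W).toList.flatMap fun t => (G t).map (CGate.mk t)

theorem toffoliCount_mk (t : W) (G : List (Ctl W)) :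
    toffoliCount (G.map (CGate.mk t)) = ctlCost G := by
  induction G with
  | nil => rfl
  | cons c G ih => simp [toffoliCount, ih, ctlCost]

theorem toffoliCount_layer [Fintype W] (G : W → List (Ctl W)) :
    toffoliCount (layer G) = ∑ t, ctlCost (G t) := by
  have : ∀ l : List W, toffoliCount (l.flatMap fun t => (G t).map (CGate.mk t)) =
      (l.map fun t => ctlCost (G t)).sum := by
    intro l
    induction l with
    | nil => rfl
    | cons t l ih => simp [toffoliCount_append, toffoliCount_mk, ih]
  rw [layer, this, Finset.sum_map_toList]

theorem run_mk [DecidableEq W] (t : W) (G : List (Ctl W)) (h : ∀ c ∈ G, t ∉ c.wires) (y : W → Bool) :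
    run (G.map (CGate.mk t)) y = Function.update y t (xor (y t) (ctlSum G y)) := by
  induction G generalizing y with
  | nil => simp [run]
  | cons c G ih =>
    have hc : t ∉ c.wires := h c (by simp)
    simp only [List.map_cons, run]
    rw [ih fun c' hc' => h c' (by simp [hc'])]
    have : ctlSum G (Function.update y t (xor (y t) (c.eval y))) = ctlSum G y := by
      apply ctlSum_congr
      intro c' hc' a ha
      rw [Function.update_of_ne]
      rintro rfl
      exact h c' (by simp [hc']) ha
    simp [CGate.act, hc, this]

/-- If no wire that is read is changed, the gates of a layer do not disturb each other. -/
theorem run_layer [Fintype W] [DecidableEq W] (G : W → List (Ctl W))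
    (h : ∀ t, ∀ c ∈ G t, ∀ w ∈ c.wires, G w = []) (y : W → Bool) :
    run (layer G) y = fun w => xor (y w) (ctlSum (G w) y) := by
  have key : ∀ l : List W, l.Nodup → ∀ y,
      run (l.flatMap fun t => (G t).map (CGate.mk t)) y =
        fun w => if w ∈ l then xor (y w) (ctlSum (G w) y) else y w := by
    intro l hl
    induction l with
    | nil => intro y; simp [run]
    | cons t l ih =>
      intro y
      rw [List.nodup_cons] at hl
      rw [List.flatMap_cons, run_append, run_mk, ih hl.2]
      · funext w
        have hs : ctlSum (G w) (Function.update y t (xor (y t) (ctlSum (G t) y))) =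
            ctlSum (G w) y := by
          apply ctlSum_congr
          intro c hc a ha
          by_cases hat : a = t
          · subst hat
            have := h _ c hc a ha
            simp [this]
          · rw [Function.update_of_ne hat]
        rw [hs]
        by_cases hw : w = t
        · subst hw; simp [hl.1]
        · simp [hw]
      · intro c hc ht
        have := h t c hc t ht
        rw [this] at hc
        simp at hc
  rw [layer, key _ (Finset.nodup_toList _)]
  simp

end Layers

section Sandwich

variable {V N : Type} [Fintype V] [DecidableEq V] [Fintype N] [DecidableEq N]

/-- The bit string with the bits `v` on the wires `V` and zeros on the work wires. -/
def withZeros (v : V → Bool) : V ⊕ N → Bool := Sum.elim v fun _ => false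

/-- Work wires `N`, each of which is to hold the sum of conditions `G` on the input wires and on
work wires of lower rank, can be filled rank by rank. -/
theorem exists_compute (G : N → List (Ctl (V ⊕ N))) (ρ : N → ℕ) (val : (V → Bool) → N → Bool)
    (hρ : ∀ n, ∀ c ∈ G n, ∀ n', Sum.inr n' ∈ c.wires → ρ n' < ρ n)
    (hval : ∀ v n, val v n = ctlSum (G n) (Sum.elim v (val v))) :
    ∃ c : List (CGate (V ⊕ N)), toffoliCount c = ∑ n, ctlCost (G n) ∧
      ∀ v, run c (withZeros v) = Sum.elim v (val v) := by
  have key : ∀ r : ℕ, ∃ c : List (CGate (V ⊕ N)),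
      toffoliCount c = ∑ n, (if ρ n < r then ctlCost (G n) else 0) ∧
      ∀ v, run c (withZeros v) = Sum.elim v fun n => if ρ n < r then val v n else false := by
    intro r
    induction r with
    | zero => exact ⟨[], by simp [toffoliCount], fun v => by simp [run, withZeros]⟩
    | succ r ih =>
      obtain ⟨c, hc, hrun⟩ := ih
      let G' : V ⊕ N → List (Ctl (V ⊕ N)) :=
        Sum.elim (fun _ => []) fun n => if ρ n = r then G n else []
      refine ⟨c ++ layer G', ?_, fun v => ?_⟩
      · rw [toffoliCount_append, toffoliCount_layer, hc, Fintype.sum_sum_type]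
        simp only [G', Sum.elim_inl, Sum.elim_inr, ctlCost, List.map_nil, List.sum_nil,
          Finset.sum_const_zero, zero_add, ← Finset.sum_add_distrib]
        refine Finset.sum_congr rfl fun n _ => ?_
        rcases lt_trichotomy (ρ n) r with h | h | h
        · simp [h, h.ne, Nat.lt_succ_of_lt h]
        · simp [h]
        · simp [h.not_gt, h.ne', show ¬ ρ n < r + 1 by omega]
      · rw [run_append, hrun, run_layer]
        · funext w
          rcases w with w | n
          · simp [G']
          · simp only [Sum.elim_inr, G']
            rcases lt_trichotomy (ρ n) r with h | h | h
            · simp [h, h.ne, Nat.lt_succ_of_lt h]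
            · have : ctlSum (G n) (Sum.elim v fun n => if ρ n < r then val v n else false) =
                  val v n := by
                rw [hval v n]
                apply ctlSum_congr
                rintro c hc (a | n') ha
                · rfl
                · have := hρ n c hc n' ha
                  simp [show ρ n' < r by omega]
              rw [if_pos h, this]
              simp [h]
            · simp [h.not_gt, h.ne', show ¬ ρ n < r + 1 by omega]
        · rintro (t | n) c hc w hw
          · simp [G'] at hc
          · rcases w with w | n'
            · rfl
            · simp only [G', Sum.elim_inr] at hc ⊢
              by_cases h : ρ n = r
              · rw [if_pos h] at hc
                have := hρ n c hc n' hw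
                rw [if_neg (by omega)]
              · rw [if_neg h] at hc; simp at hc
  obtain ⟨c, hc, hrun⟩ := key (Finset.univ.sup ρ + 1)
  have hlt : ∀ n, ρ n < Finset.univ.sup ρ + 1 := fun n =>
    Nat.lt_succ_of_le (Finset.le_sup (Finset.mem_univ n))
  exact ⟨c, by simpa [hlt] using hc, fun v => by simpa [hlt] using hrun v⟩

/-- `f` is computed by a classical circuit with at most `t` Toffoli gates that uses `w` clean work
bits and returns them clean. -/
def Realizes (w t : ℕ) (f : (V → Bool) → (V → Bool)) : Prop :=
  ∃ c : List (CGate (V ⊕ Fin w)), toffoliCount c ≤ t ∧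
    ∀ v, run c (withZeros v) = withZeros (f v)

omit [Fintype V] [Fintype N] in
theorem realizes_of_embedding {w t : ℕ} {f : (V → Bool) → (V → Bool)} (e : N ↪ Fin w)
    (h : ∃ c : List (CGate (V ⊕ N)), toffoliCount c ≤ t ∧
      ∀ v, run c (withZeros v) = withZeros (f v)) : Realizes w t f := by
  obtain ⟨c, hc, hrun⟩ := h
  have he : Function.Injective (Sum.map id e : V ⊕ N → V ⊕ Fin w) :=
    Function.injective_id.sumMap e.injective
  refine ⟨c.map (CGate.map (Sum.map id e)), by rwa [toffoliCount_map], fun v => ?_⟩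
  obtain ⟨h1, h2⟩ := run_map he c (withZeros v)
  have h0 : (fun x => withZeros v (Sum.map id e x)) = (withZeros v : V ⊕ N → Bool) := by
    funext x; cases x <;> rfl
  funext x
  by_cases hx : x ∈ Set.range (Sum.map id e : V ⊕ N → V ⊕ Fin w)
  · obtain ⟨y, rfl⟩ := hx
    rw [h1, h0, hrun]
    cases y <;> rfl
  · rw [h2 x hx]
    rcases x with x | x
    · exact (hx ⟨Sum.inl x, rfl⟩).elim
    · rfl

omit [Fintype V] in
theorem Realizes.mono {w w' t t' : ℕ} {f : (V → Bool) → (V → Bool)} (h : Realizes w t f)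
    (hw : w ≤ w') (ht : t ≤ t') : Realizes w' t' f :=
  realizes_of_embedding (Fin.castLEEmb hw) <| by
    obtain ⟨c, hc, hrun⟩ := h
    exact ⟨c, hc.trans ht, hrun⟩

omit [Fintype V] in
theorem Realizes.comp {w w' t t' : ℕ} {f g : (V → Bool) → (V → Bool)} (hf : Realizes w t f)
    (hg : Realizes w' t' g) : Realizes (max w w') (t + t') fun v => g (f v) := by
  obtain ⟨c, hc, hrun⟩ := hf.mono (le_max_left w w') le_rfl
  obtain ⟨c', hc', hrun'⟩ := hg.mono (le_max_right w w') le_rfl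
  refine ⟨c ++ c', ?_, fun v => ?_⟩
  · rw [toffoliCount_append]; omega
  · rw [run_append, hrun, hrun']

/-- Compute the work bits, add conditions on them to the output wires, and uncompute the work bits.
This works if the outputs are not read, and if the values of the work bits do not depend on the
wires that are changed. -/
theorem realizes_sandwich (G : N → List (Ctl (V ⊕ N))) (ρ : N → ℕ) (val : (V → Bool) → N → Bool)
    (hρ : ∀ n, ∀ c ∈ G n, ∀ n', Sum.inr n' ∈ c.wires → ρ n' < ρ n)
    (hval : ∀ v n, val v n = ctlSum (G n) (Sum.elim v (val v)))
    (out : V → List (Ctl (V ⊕ N)))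
    (hout : ∀ t, ∀ c ∈ out t, ∀ w, Sum.inl w ∈ c.wires → out w = [])
    (f : (V → Bool) → (V → Bool))
    (hf : ∀ v w, f v w = xor (v w) (ctlSum (out w) (Sum.elim v (val v))))
    (hinv : ∀ v, val (f v) = val v) :
    Realizes (Fintype.card N) (2 * ∑ n, ctlCost (G n) + ∑ w, ctlCost (out w)) f := by
  apply realizes_of_embedding (Fintype.equivFin N).toEmbedding
  obtain ⟨c, hc, hrun⟩ := exists_compute G ρ val hρ hval
  let G' : V ⊕ N → List (Ctl (V ⊕ N)) := Sum.elim out fun _ => []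
  refine ⟨c ++ layer G' ++ c.reverse, ?_, fun v => ?_⟩
  · rw [toffoliCount_append, toffoliCount_append, toffoliCount_layer, toffoliCount_reverse, hc,
      Fintype.sum_sum_type]
    simp only [G', Sum.elim_inl, Sum.elim_inr, ctlCost, List.map_nil, List.sum_nil,
          Finset.sum_const_zero, add_zero]
    omega
  · rw [run_append, run_append, hrun, run_layer]
    · have : (fun w => xor (Sum.elim v (val v) w) (ctlSum (G' w) (Sum.elim v (val v)))) =
          run c (withZeros (f v)) := by
        rw [hrun, hinv]
        funext w
        rcases w with w | n
        · simp [G', hf]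
        · simp [G']
      rw [this, run_reverse_run]
    · rintro (t | n) c hc w hw
      · rcases w with w | n'
        · exact hout t c hc w hw
        · rfl
      · simp [G'] at hc

/-- A single layer needs no work bits. -/
theorem realizes_layer (out : V → List (Ctl V))
    (hout : ∀ t, ∀ c ∈ out t, ∀ w ∈ c.wires, out w = [])
    (f : (V → Bool) → (V → Bool)) (hf : ∀ v w, f v w = xor (v w) (ctlSum (out w) v)) :
    Realizes 0 (∑ w, ctlCost (out w)) f := by
  have hs : ∀ v w (y : Empty → Bool),
      ctlSum ((out w).map (Ctl.map Sum.inl)) (Sum.elim v y) = ctlSum (out w) v := by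
    intro v w y
    simp only [ctlSum, List.map_map]
    congr 1
    refine List.map_congr_left fun c _ => ?_
    simp [Ctl.eval_map]
  have := realizes_sandwich (N := Empty) (fun n => n.elim) (fun n => n.elim) (fun _ n => n.elim)
    (fun n => n.elim) (fun _ n => n.elim) (fun w => (out w).map (Ctl.map Sum.inl))
    (by
      intro t c hc w hw
      obtain ⟨c', hc', rfl⟩ := List.mem_map.1 hc
      rw [Ctl.wires_map, List.mem_map] at hw
      obtain ⟨a, ha, e⟩ := hw
      cases e
      simp [hout t c' hc' w ha]) f (fun v w => by rw [hf, hs]) (fun _ => funext fun n => n.elim)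
  refine this.mono (by simp) ?_
  simp [ctlCost, Function.comp_def, Ctl.cost_map]

end Sandwich

/-! ### Parity sums -/

section Parity

variable {W ι : Type}

theorem xorAll_map_eq_false {l : List ι} {g : ι → Bool} (h : ∀ i ∈ l, g i = false) :
    xorAll (l.map g) = false := by
  induction l with
  | nil => rfl
  | cons a l ih => simp [h a (by simp), ih fun i hi => h i (by simp [hi])]

theorem xorAll_map_eq_of_unique {l : List ι} (hl : l.Nodup) {g : ι → Bool} {i : ι} (hi : i ∈ l)
    (h : ∀ j ∈ l, j ≠ i → g j = false) : xorAll (l.map g) = g i := by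
  induction l with
  | nil => simp at hi
  | cons a l ih =>
    rw [List.nodup_cons] at hl
    by_cases ha : a = i
    · subst ha
      rw [List.map_cons, xorAll_cons, xorAll_map_eq_false, Bool.xor_false]
      intro j hj
      exact h j (by simp [hj]) (by rintro rfl; exact hl.1 hj)
    · rw [List.map_cons, xorAll_cons, h a (by simp) ha, Bool.false_xor]
      exact ih hl.2 (by simpa [Ne.symm ha] using hi) fun j hj => h j (by simp [hj])

theorem xorAll_map_filter (l : List ι) (p g : ι → Bool) :
    xorAll ((l.filter p).map g) = xorAll (l.map fun i => p i && g i) := by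
  induction l with
  | nil => rfl
  | cons a l ih => cases h : p a <;> simp [h, ih]

theorem xorAll_finRange_eq_of_unique {n : ℕ} {g : Fin n → Bool} (i : Fin n)
    (h : ∀ j, j ≠ i → g j = false) : xorAll ((List.finRange n).map g) = g i :=
  xorAll_map_eq_of_unique (List.nodup_finRange n) (List.mem_finRange i) fun j _ => h j

/-- The sign `(-1)^b`. -/
def sgn (b : Bool) : ℂ := if b then -1 else 1

theorem sgn_xor (a b : Bool) : sgn (xor a b) = sgn a * sgn b := by
  cases a <;> cases b <;> simp [sgn]

theorem sgn_xorAll_finRange {n : ℕ} (g : Fin n → Bool) :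
    sgn (xorAll ((List.finRange n).map g)) =
      (-1) ^ (Finset.univ.filter fun i => g i = true).card := by
  have : ∀ l : List (Fin n), sgn (xorAll (l.map g)) = (l.map fun i => sgn (g i)).prod := by
    intro l
    induction l with
    | nil => simp [sgn]
    | cons a l ih => simp [sgn_xor, ih]
  rw [this, ← Fin.prod_univ_def]
  simp [sgn, Finset.prod_ite]

theorem ctlSum_map (l : List ι) (c : ι → Ctl W) (y : W → Bool) :
    ctlSum (l.map c) y = xorAll (l.map fun i => (c i).eval y) := by
  simp [ctlSum, Function.comp_def]

theorem ctlSum_filter_map (l : List ι) (p : ι → Bool) (c : ι → Ctl W) (y : W → Bool) :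
    ctlSum ((l.filter p).map c) y = xorAll (l.map fun i => p i && (c i).eval y) := by
  rw [ctlSum_map, xorAll_map_filter]

theorem ctlCost_map_lit (l : List ι) (a : ι → W) : ctlCost (l.map fun i => .lit (a i)) = 0 := by
  simp [ctlCost, Function.comp_def, Ctl.cost]

end Parity

/-! ### The one-hot encoding of a register -/

section Tree

variable {W : Type} {κ : ℕ}

/-- The nodes of the complete binary tree of depth `κ`: a level `i ≤ κ` and a number below
`2 ^ i`. -/
abbrev Tree (κ : ℕ) : Type := (i : Fin (κ + 1)) × Fin (2 ^ (i : ℕ))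

/-- The node `v` of level `i` holds whether the lowest `i` bits of the register are those of `v`. -/
def treeVal (b : Fin κ → Bool) (t : Tree κ) : Bool :=
  decide (∀ j : Fin κ, (j : ℕ) < t.1 → b j = (t.2 : ℕ).testBit j)

/-- Each node is computed from its parent by one Toffoli gate. -/
def treeG (bit : Fin κ → W) (node : Tree κ → W) : Tree κ → List (Ctl W)
  | ⟨⟨0, _⟩, _⟩ => [.one]
  | ⟨⟨i + 1, h⟩, v⟩ =>
    let p := node ⟨⟨i, by omega⟩, ⟨v % 2 ^ i, Nat.mod_lt _ (by positivity)⟩⟩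
    let b := bit ⟨i, by omega⟩
    (if (v : ℕ).testBit i then [] else [.lit p]) ++ [.and p b]

theorem treeG_eval (bit : Fin κ → W) (node : Tree κ → W) (y : W → Bool)
    (hy : ∀ t, y (node t) = treeVal (fun j => y (bit j)) t) (t : Tree κ) :
    treeVal (fun j => y (bit j)) t = ctlSum (treeG bit node t) y := by
  obtain ⟨⟨i, hi⟩, v, hv⟩ := t
  cases i with
  | zero => simp [treeG, treeVal, Ctl.eval]
  | succ i =>
    have hsplit : treeVal (fun j => y (bit j)) ⟨⟨i + 1, hi⟩, v, hv⟩ =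
        (treeVal (fun j => y (bit j))
          ⟨⟨i, by omega⟩, ⟨v % 2 ^ i, Nat.mod_lt _ (by positivity)⟩⟩ &&
          (y (bit ⟨i, by omega⟩) == v.testBit i)) := by
      rw [Bool.eq_iff_iff]
      simp only [treeVal, decide_eq_true_eq, Bool.and_eq_true, beq_iff_eq]
      constructor
      · intro h
        refine ⟨fun j hj => ?_, h ⟨i, by omega⟩ (by simp)⟩
        have hj : (j : ℕ) < i := hj
        rw [h j (Nat.lt_succ_of_lt hj), Nat.testBit_mod_two_pow]
        simp [hj]
      · rintro ⟨h, h'⟩ j hj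
        rcases Nat.lt_succ_iff_lt_or_eq.1 hj with hj | hj
        · rw [h j hj, Nat.testBit_mod_two_pow]
          simp [hj]
        · have : j = ⟨i, by omega⟩ := Fin.ext hj
          rw [this]; exact h'
    rw [hsplit, ← hy]
    simp only [treeG]
    cases hb : v.testBit i <;> simp [Ctl.eval]
    cases y (node ⟨⟨i, by omega⟩, ⟨v % 2 ^ i, Nat.mod_lt _ (by positivity)⟩⟩) <;> simp

theorem treeG_wires {bit : Fin κ → W} {node : Tree κ → W} {t : Tree κ} {c : Ctl W}
    (hc : c ∈ treeG bit node t) {w : W} (hw : w ∈ c.wires) :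
    (∃ j, w = bit j) ∨ ∃ t', w = node t' ∧ (t'.1 : ℕ) < t.1 := by
  obtain ⟨⟨i, hi⟩, v, hv⟩ := t
  cases i with
  | zero =>
    simp only [treeG, List.mem_singleton] at hc
    subst hc
    simp [Ctl.wires] at hw
  | succ i =>
    simp only [treeG, List.mem_append, List.mem_singleton] at hc
    have h1 : ∀ p : W, p = node ⟨⟨i, by omega⟩, ⟨v % 2 ^ i, Nat.mod_lt _ (by positivity)⟩⟩ →
        ∃ t', p = node t' ∧ (t'.1 : ℕ) < i + 1 := fun p hp => ⟨_, hp, by simp⟩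
    rcases hc with hc | rfl
    · split_ifs at hc
      · simp at hc
      · simp only [List.mem_singleton] at hc
        subst hc
        simp only [Ctl.wires, List.mem_singleton] at hw
        exact Or.inr (h1 w hw)
    · simp only [Ctl.wires, List.mem_cons, List.not_mem_nil, or_false] at hw
      rcases hw with hw | hw
      · exact Or.inr (h1 w hw)
      · exact Or.inl ⟨_, hw⟩

theorem treeG_cost (bit : Fin κ → W) (node : Tree κ → W) :
    ∑ t, ctlCost (treeG bit node t) ≤ 2 ^ (κ + 1) := by
  have h1 : ∀ t : Tree κ, ctlCost (treeG bit node t) ≤ 1 := by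
    rintro ⟨⟨i, hi⟩, v, hv⟩
    cases i with
    | zero => simp [treeG, ctlCost, Ctl.cost]
    | succ i =>
      simp only [treeG]
      split_ifs <;> simp [ctlCost, Ctl.cost]
  calc ∑ t, ctlCost (treeG bit node t) ≤ ∑ _t : Tree κ, 1 := Finset.sum_le_sum fun t _ => h1 t
    _ = ∑ i : Fin (κ + 1), 2 ^ (i : ℕ) := by simp
    _ ≤ 2 ^ (κ + 1) := by
      rw [Fin.sum_univ_eq_sum_range fun i => 2 ^ i, Nat.geomSum_eq (le_refl 2)]
      simp

/-- The leaf of the number `v`. -/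
def leaf (κ v : ℕ) (h : v < 2 ^ κ) : Tree κ := ⟨Fin.last κ, ⟨v, by simpa using h⟩⟩

theorem eq_testBit_iff {b : Fin κ → Bool} {v : ℕ} (h : v < 2 ^ κ) :
    (∀ j : Fin κ, b j = v.testBit j) ↔ Nat.ofBits b = v := by
  constructor
  · intro hb
    have : b = fun i : Fin κ => v.testBit i := funext hb
    rw [this, Nat.ofBits_testBit, Nat.mod_eq_of_lt h]
  · rintro rfl j
    rw [Nat.testBit_ofBits_lt _ _ j.2]

theorem treeVal_leaf (b : Fin κ → Bool) (v : ℕ) (h : v < 2 ^ κ) :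
    treeVal b (leaf κ v h) = decide (Nat.ofBits b = v) := by
  rw [Bool.eq_iff_iff, decide_eq_true_iff, ← eq_testBit_iff h]
  simp [treeVal, leaf]

theorem ofBits_injective : Function.Injective (Nat.ofBits : (Fin κ → Bool) → ℕ) := by
  intro a b h
  funext i
  rw [← Nat.testBit_ofBits_lt a i i.2, h, Nat.testBit_ofBits_lt]

/-- The lowest `κ` bits of a number. -/
def bits (κ v : ℕ) : Fin κ → Bool := fun i => v.testBit i

theorem ofBits_bits {v : ℕ} (h : v < 2 ^ κ) : Nat.ofBits (bits κ v) = v := by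
  change Nat.ofBits (fun i : Fin κ => v.testBit i) = v
  rw [Nat.ofBits_testBit, Nat.mod_eq_of_lt h]

theorem bits_ofBits (b : Fin κ → Bool) : bits κ (Nat.ofBits b) = b :=
  ofBits_injective (ofBits_bits (Nat.ofBits_lt_two_pow b))

theorem bits_inj {v v' : ℕ} (h : v < 2 ^ κ) (h' : v' < 2 ^ κ) (e : bits κ v = bits κ v') :
    v = v' := by
  rw [← ofBits_bits h, e, ofBits_bits h']

end Tree

/-! ### Ripple carries -/

section Carry

variable {W : Type} {k : ℕ}

/-- The carry into position `i` in the addition of two registers of `k` bits; it is read as zero for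
`i > k`. -/
def carryVal (a b : Fin k → Bool) : ℕ → Bool
  | 0 => false
  | i + 1 => if h : i < k then Bool.atLeastTwo (a ⟨i, h⟩) (b ⟨i, h⟩) (carryVal a b i) else false

/-- The carries of the sum of the registers `a` (complemented if `neg` holds) and `b`. -/
def carryG (neg : Bool) (a b : Fin k → W) (node : Fin (k + 1) → W) : Fin (k + 1) → List (Ctl W)
  | ⟨0, _⟩ => []
  | ⟨i + 1, h⟩ =>
    let A := a ⟨i, by omega⟩
    let B := b ⟨i, by omega⟩
    let C := node ⟨i, by omega⟩
    (if neg then [.lit B, .lit C] else []) ++ [.and A B, .and A C, .and B C]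

theorem carryG_eval (neg : Bool) (a b : Fin k → W) (node : Fin (k + 1) → W) (y : W → Bool)
    (hy : ∀ t : Fin (k + 1),
      y (node t) = carryVal (fun j => xor neg (y (a j))) (fun j => y (b j)) t) (t : Fin (k + 1)) :
    carryVal (fun j => xor neg (y (a j))) (fun j => y (b j)) t =
      ctlSum (carryG neg a b node t) y := by
  obtain ⟨i, hi⟩ := t
  cases i with
  | zero => rfl
  | succ i =>
    have h := hy ⟨i, by omega⟩
    simp only at h
    simp only [carryVal, show i < k by omega, dite_true, carryG]
    rw [← h]
    generalize hA : a ⟨i, _⟩ = A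
    generalize hB : b ⟨i, _⟩ = B
    generalize hC : node ⟨i, _⟩ = C
    cases neg <;> simp [Ctl.eval, Bool.atLeastTwo] <;> cases y A <;> cases y B <;> cases y C <;>
      rfl

theorem carryG_wires {neg : Bool} {a b : Fin k → W} {node : Fin (k + 1) → W} {t : Fin (k + 1)}
    {c : Ctl W} (hc : c ∈ carryG neg a b node t) {w : W} (hw : w ∈ c.wires) :
    (∃ j, w = a j) ∨ (∃ j, w = b j) ∨ ∃ t' : Fin (k + 1), w = node t' ∧ (t' : ℕ) < t := by
  obtain ⟨i, hi⟩ := t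
  cases i with
  | zero => simp [carryG] at hc
  | succ i =>
    have h1 : w = a ⟨i, by omega⟩ ∨ w = b ⟨i, by omega⟩ ∨ w = node ⟨i, by omega⟩ := by
      cases neg <;> simp [carryG] at hc
      · rcases hc with rfl | rfl | rfl <;> simp [Ctl.wires] at hw <;> tauto
      · rcases hc with rfl | rfl | rfl | rfl | rfl <;> simp [Ctl.wires] at hw <;> tauto
    rcases h1 with h1 | h1 | h1
    · exact Or.inl ⟨_, h1⟩
    · exact Or.inr (Or.inl ⟨_, h1⟩)
    · exact Or.inr (Or.inr ⟨_, h1, by simp⟩)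

theorem carryG_cost (neg : Bool) (a b : Fin k → W) (node : Fin (k + 1) → W) :
    ∑ t, ctlCost (carryG neg a b node t) = 3 * k := by
  rw [Fin.sum_univ_succ]
  have h0 : carryG neg a b node 0 = [] := rfl
  have : ∀ i : Fin k, ctlCost (carryG neg a b node i.succ) = 3 := by
    intro i
    cases neg <;> simp [carryG, Fin.succ, ctlCost, Ctl.cost]
  simp only [this, h0]
  simp [ctlCost, mul_comm]

theorem carryVal_eq_bitVec (x y : BitVec k) {i : ℕ} (hi : i ≤ k) :
    carryVal (fun j : Fin k => x.getLsbD j) (fun j : Fin k => y.getLsbD j) i =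
      BitVec.carry i x y false := by
  induction i with
  | zero => simp [carryVal]
  | succ i ih =>
    rw [BitVec.carry_succ, ← ih (by omega), carryVal, dif_pos (by omega : i < k)]

theorem getLsbD_ofNat_eq_bits (v : ℕ) :
    (fun j : Fin k => (BitVec.ofNat k v).getLsbD j) = bits k v := by
  funext j; rw [BitVec.getLsbD_ofNat]; simp [bits]

theorem bits_add (x y : ℕ) (i : Fin k) :
    bits k (x + y) i = xor (bits k x i) (xor (bits k y i) (carryVal (bits k x) (bits k y) i)) := by
  rw [← getLsbD_ofNat_eq_bits, ← getLsbD_ofNat_eq_bits, ← getLsbD_ofNat_eq_bits,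
    carryVal_eq_bitVec _ _ i.2.le, BitVec.ofNat_add]
  exact BitVec.getLsbD_add i.2 _ _

/-- The carries of a sum can be recovered from the complement of the sum and one summand. -/
theorem carryVal_not_add (x y : ℕ) {i : ℕ} (hi : i ≤ k) :
    carryVal (fun j => !(bits k (x + y) j)) (bits k y) i = carryVal (bits k x) (bits k y) i := by
  induction i with
  | zero => rfl
  | succ i ih =>
    have hi' : i < k := by omega
    simp only [carryVal, dif_pos hi', bits_add x y ⟨i, hi'⟩]
    rw [ih (by omega)]
    cases bits k x ⟨i, hi'⟩ <;> cases bits k y ⟨i, hi'⟩ <;>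
      cases carryVal (bits k x) (bits k y) i <;> rfl

/-- A word `b` is compared with all words `u`: the carry out of `¬u + b` occurs for as many `u` as
the value of `b`. -/
theorem card_carryVal (b : Fin k → Bool) :
    (Finset.univ.filter fun u : Fin k → Bool => carryVal (fun j => !(u j)) b k = true).card =
      Nat.ofBits b := by
  have h1 : ∀ a : Fin k → Bool, carryVal a b k = true ↔ 2 ^ k ≤ Nat.ofBits a + Nat.ofBits b := by
    intro a
    have ha := Nat.ofBits_lt_two_pow a
    have hb := Nat.ofBits_lt_two_pow b
    conv_lhs => rw [← bits_ofBits a, ← bits_ofBits b, ← getLsbD_ofNat_eq_bits,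
      ← getLsbD_ofNat_eq_bits]
    rw [carryVal_eq_bitVec _ _ le_rfl]
    simp [BitVec.carry, Nat.mod_eq_of_lt ha, Nat.mod_eq_of_lt hb]
  have hb := Nat.ofBits_lt_two_pow b
  have h2 : (Finset.univ.filter fun u : Fin k → Bool =>
      carryVal (fun j => !(u j)) b k = true).card =
      (Finset.Ico (2 ^ k - Nat.ofBits b) (2 ^ k)).card := by
    refine Finset.card_bij (fun u _ => Nat.ofBits fun j => !(u j)) ?_ ?_ ?_
    · intro u hu
      rw [Finset.mem_filter, h1] at hu
      have := Nat.ofBits_lt_two_pow fun j => !(u j)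
      rw [Finset.mem_Ico]; omega
    · intro u _ u' _ h
      have := ofBits_injective h
      funext j
      simpa using congrFun this j
    · intro v hv
      rw [Finset.mem_Ico] at hv
      refine ⟨fun j => !(bits k v j), ?_, ?_⟩
      · rw [Finset.mem_filter, h1]
        simp only [Bool.not_not, Finset.mem_univ, true_and]
        rw [show (fun j => bits k v j) = bits k v from rfl, ofBits_bits hv.2]
        omega
      · simp only [Bool.not_not]
        exact ofBits_bits hv.2
  rw [h2, Nat.card_Ico]
  omega

end Carry

/-! ### Counting particles -/

section Counter

variable {W : Type} {n κ : ℕ}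

/-- The number of particles in the modes before `p`. -/
def rank (y : Fin n → Bool) (p : ℕ) : ℕ :=
  (Finset.univ.filter fun k : Fin n => (k : ℕ) < p ∧ y k = true).card

theorem rank_zero (y : Fin n → Bool) : rank y 0 = 0 := by simp [rank]

theorem rank_succ (y : Fin n → Bool) (p : Fin n) :
    rank y (p + 1) = rank y p + (y p).toNat := by
  unfold rank
  have : (Finset.univ.filter fun k : Fin n => (k : ℕ) < p + 1 ∧ y k = true) =
      (Finset.univ.filter fun k : Fin n => (k : ℕ) < p ∧ y k = true) ∪
        (if y p = true then {p} else ∅) := by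
    ext k
    rw [Finset.mem_union, Finset.mem_filter, Finset.mem_filter]
    have hk : k ∈ (if y p = true then {p} else ∅ : Finset (Fin n)) ↔ (k : ℕ) = p ∧ y k = true := by
      rw [← Fin.ext_iff]
      split_ifs with hy
      · rw [Finset.mem_singleton]
        exact ⟨fun e => ⟨e, e ▸ hy⟩, fun e => e.1⟩
      · simp only [Finset.notMem_empty, false_iff]
        rintro ⟨rfl, h⟩
        exact hy h
    rw [hk, Nat.lt_succ_iff_lt_or_eq]
    simp only [Finset.mem_univ, true_and]
    tauto
  rw [this, Finset.card_union_of_disjoint]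
  · cases y p <;> simp
  · cases y p <;> simp

theorem rank_mono (y : Fin n → Bool) {p q : ℕ} (h : p ≤ q) : rank y p ≤ rank y q :=
  Finset.card_le_card fun k hk => by
    simp only [Finset.mem_filter] at hk ⊢
    exact ⟨hk.1, by omega, hk.2.2⟩

theorem rank_lt_rank (y : Fin n → Bool) {p q : Fin n} (h : p < q) (hp : y p = true) :
    rank y p < rank y q := by
  have h1 := rank_succ y p
  have h2 := rank_mono y (show (p : ℕ) + 1 ≤ q from h)
  rw [hp] at h1
  simp only [Bool.toNat_true] at h1
  omega

theorem rank_lt_particles (y : Fin n → Bool) {p : Fin n} (hp : y p = true) :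
    rank y p < particles y := by
  have h1 := rank_succ y p
  rw [hp] at h1
  have : rank y (p + 1) ≤ particles y :=
    Finset.card_le_card fun k hk => by
      simp only [Finset.mem_filter] at hk ⊢
      exact ⟨hk.1, hk.2.2⟩
  simp only [Bool.toNat_true] at h1
  omega

/-- The number of particles in the modes before `p`, counted up to at most `2 ^ κ`. Stopping the
counter keeps the ranks of distinct particles distinct, as far as they are below `2 ^ κ`. -/
def count (κ : ℕ) (y : Fin n → Bool) (p : ℕ) : ℕ := min (rank y p) (2 ^ κ)

theorem testBit_add_one_eq (c i : ℕ) :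
    (c + 1).testBit i = xor (c.testBit i) (decide (∀ j < i, c.testBit j = true)) := by
  induction i generalizing c with
  | zero =>
    rw [Nat.testBit_zero, Nat.testBit_zero]
    rcases Nat.mod_two_eq_zero_or_one c with h | h <;> simp [Nat.add_mod, h]
  | succ i ih =>
    rw [Nat.testBit_succ, Nat.testBit_succ]
    have hall : (∀ j < i + 1, c.testBit j = true) ↔
        c.testBit 0 = true ∧ ∀ j < i, (c / 2).testBit j = true := by
      constructor
      · intro h
        exact ⟨h 0 (by omega), fun j hj => by rw [← Nat.testBit_succ]; exact h _ (by omega)⟩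
      · rintro ⟨h0, h⟩ j hj
        cases j with
        | zero => exact h0
        | succ j => rw [Nat.testBit_succ]; exact h j (by omega)
    simp only [hall, Nat.testBit_zero]
    rcases Nat.mod_two_eq_zero_or_one c with h | h
    · rw [show (c + 1) / 2 = c / 2 by omega]
      simp [h]
    · rw [show (c + 1) / 2 = c / 2 + 1 by omega, ih]
      simp [h]

theorem count_le (κ : ℕ) (y : Fin n → Bool) (p : ℕ) : count κ y p ≤ 2 ^ κ := min_le_right _ _

theorem testBit_count_top (κ : ℕ) (y : Fin n → Bool) (p : ℕ) :
    (count κ y p).testBit κ = decide (2 ^ κ ≤ rank y p) := by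
  by_cases h : 2 ^ κ ≤ rank y p
  · rw [count, min_eq_right h]; simp [h, Nat.testBit_two_pow_self]
  · rw [count, min_eq_left (by omega), Nat.testBit_lt_two_pow (by omega)]; simp [h]

theorem count_succ (κ : ℕ) (y : Fin n → Bool) (p : Fin n) :
    count κ y (p + 1) = count κ y p + (y p && !(count κ y p).testBit κ).toNat := by
  rw [testBit_count_top, count, count, rank_succ]
  cases y p
  · simp
  · by_cases h : 2 ^ κ ≤ rank y p
    · simp only [Bool.toNat_true, Bool.true_and, h, decide_true, Bool.not_true, Bool.toNat_false]
      omega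
    · simp only [Bool.toNat_true, Bool.true_and, h, decide_false, Bool.not_false]
      omega

/-- The bits of the counter (`false`) and the carries of its increments (`true`), for each mode. -/
abbrev CountNode (n κ : ℕ) : Type := Fin n × Fin (κ + 1) × Bool

/-- The values of the counter bits and of the carries. A carry starts with the occupation of the mode,
unless the counter has reached `2 ^ κ`, and passes the bits that are one. -/
def countVal (y : Fin n → Bool) : CountNode n κ → Bool
  | (p, i, false) => (count κ y p).testBit i
  | (p, i, true) => y p && !(count κ y p).testBit κ &&
      decide (∀ j < (i : ℕ), (count κ y p).testBit j = true)

/-- The conditions that compute the counter bits from those of the previous mode, and the carries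
from the counter bits, with one Toffoli gate for each carry. -/
def countG (sys : Fin n → W) (node : CountNode n κ → W) : CountNode n κ → List (Ctl W)
  | (⟨0, _⟩, _, false) => []
  | (⟨p + 1, h⟩, i, false) =>
    [.lit (node (⟨p, by omega⟩, i, false)), .lit (node (⟨p, by omega⟩, i, true))]
  | (p, ⟨0, _⟩, true) => [.lit (sys p), .and (sys p) (node (p, Fin.last κ, false))]
  | (p, ⟨i + 1, h⟩, true) =>
    [.and (node (p, ⟨i, by omega⟩, true)) (node (p, ⟨i, by omega⟩, false))]

/-- An order in which the counter bits and the carries can be computed. -/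
def countRank : CountNode n κ → ℕ
  | (p, _, false) => p * (κ + 2)
  | (p, i, true) => p * (κ + 2) + 1 + i

theorem countG_eval (sys : Fin n → W) (node : CountNode n κ → W) (y : W → Bool)
    (hy : ∀ t, y (node t) = countVal (fun p => y (sys p)) t) (t : CountNode n κ) :
    countVal (fun p => y (sys p)) t = ctlSum (countG sys node t) y := by
  obtain ⟨⟨p, hp⟩, ⟨i, hi⟩, b⟩ := t
  cases b
  · cases p with
    | zero => simp [countVal, countG, count, rank_zero]
    | succ p =>
      simp only [countG, ctlSum_cons, ctlSum_nil, Ctl.eval, hy, countVal, Bool.xor_false]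
      have := count_succ κ (fun p => y (sys p)) ⟨p, by omega⟩
      simp only at this
      rw [this]
      cases h : (y (sys ⟨p, by omega⟩) && !(count κ (fun p => y (sys p)) p).testBit κ)
      · simp
      · rw [Bool.toNat_true, testBit_add_one_eq, Bool.true_and]
  · cases i with
    | zero =>
      simp only [countG, ctlSum_cons, ctlSum_nil, Ctl.eval, hy, countVal, Bool.xor_false]
      cases y (sys ⟨p, hp⟩) <;> simp
    | succ i =>
      simp only [countG, ctlSum_cons, ctlSum_nil, Ctl.eval, hy, countVal, Bool.xor_false]
      have : (∀ j < i + 1, (count κ (fun p => y (sys p)) p).testBit j = true) ↔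
          (∀ j < i, (count κ (fun p => y (sys p)) p).testBit j = true) ∧
            (count κ (fun p => y (sys p)) p).testBit i = true := by
        constructor
        · exact fun h => ⟨fun j hj => h j (by omega), h i (by omega)⟩
        · rintro ⟨h, h'⟩ j hj
          rcases Nat.lt_succ_iff_lt_or_eq.1 hj with hj | rfl
          · exact h j hj
          · exact h'
      simp only [this, Bool.decide_and, Bool.decide_eq_true, Bool.and_assoc]

theorem countG_wires {sys : Fin n → W} {node : CountNode n κ → W} {t : CountNode n κ} {c : Ctl W}
    (hc : c ∈ countG sys node t) {w : W} (hw : w ∈ c.wires) :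
    (∃ p, w = sys p) ∨ ∃ t', w = node t' ∧ countRank t' < countRank t := by
  obtain ⟨⟨p, hp⟩, ⟨i, hi⟩, b⟩ := t
  cases b
  · cases p with
    | zero => simp [countG] at hc
    | succ p =>
      simp only [countG, List.mem_cons, List.not_mem_nil, or_false] at hc
      rcases hc with rfl | rfl <;> simp only [Ctl.wires, List.mem_singleton] at hw <;>
        refine Or.inr ⟨_, hw, ?_⟩ <;> simp only [countRank, add_mul, one_mul] <;> omega
  · cases i with
    | zero =>
      simp only [countG, List.mem_cons, List.not_mem_nil, or_false] at hc
      rcases hc with rfl | rfl <;>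
        simp only [Ctl.wires, List.mem_cons, List.not_mem_nil, or_false] at hw
      · exact Or.inl ⟨_, hw⟩
      · rcases hw with hw | hw
        · exact Or.inl ⟨_, hw⟩
        · exact Or.inr ⟨_, hw, by simp [countRank]⟩
    | succ i =>
      simp only [countG, List.mem_singleton] at hc
      subst hc
      simp only [Ctl.wires, List.mem_cons, List.not_mem_nil, or_false] at hw
      rcases hw with hw | hw <;> exact Or.inr ⟨_, hw, by simp only [countRank]; omega⟩

theorem countG_cost (sys : Fin n → W) (node : CountNode n κ → W) :
    ∑ t, ctlCost (countG sys node t) ≤ n * (κ + 1) := by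
  have h : ∀ t : CountNode n κ, ctlCost (countG sys node t) ≤ if t.2.2 then 1 else 0 := by
    rintro ⟨⟨p, hp⟩, ⟨i, hi⟩, b⟩
    cases b
    · cases p <;> simp [countG, ctlCost, Ctl.cost]
    · cases i
      · cases p <;> simp [countG, ctlCost, Ctl.cost]
      · simp [countG, ctlCost, Ctl.cost]
  refine (Finset.sum_le_sum fun t _ => h t).trans ?_
  simp_rw [Fintype.sum_prod_type, Fintype.sum_bool]
  simp

/-- For each mode, the comparisons of the counter with a register on the lowest bits. -/
abbrev EqNode (n κ : ℕ) : Type := Fin n × Fin (κ + 1)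

/-- Whether the mode is occupied and the lowest bits of the register agree with the counter. -/
def eqVal (y : Fin n → Bool) (j : Fin κ → Bool) (t : EqNode n κ) : Bool :=
  y t.1 && decide (∀ i : Fin κ, (i : ℕ) < t.2 → j i = (count κ y t.1).testBit i)

/-- The conditions that compute each comparison from the one with fewer bits, by two Toffoli gates. -/
def eqG (sys : Fin n → W) (reg : Fin κ → W) (cnt : CountNode n κ → W) (node : EqNode n κ → W) :
    EqNode n κ → List (Ctl W)
  | (p, ⟨0, _⟩) => [.lit (sys p)]
  | (p, ⟨i + 1, h⟩) =>
    [.lit (node (p, ⟨i, by omega⟩)), .and (node (p, ⟨i, by omega⟩)) (reg ⟨i, by omega⟩),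
      .and (node (p, ⟨i, by omega⟩)) (cnt (p, ⟨i, by omega⟩, false))]

theorem eqG_eval (sys : Fin n → W) (reg : Fin κ → W) (cnt : CountNode n κ → W)
    (node : EqNode n κ → W) (y : W → Bool)
    (hc : ∀ t, y (cnt t) = countVal (fun p => y (sys p)) t)
    (hy : ∀ t, y (node t) = eqVal (fun p => y (sys p)) (fun i => y (reg i)) t) (t : EqNode n κ) :
    eqVal (fun p => y (sys p)) (fun i => y (reg i)) t = ctlSum (eqG sys reg cnt node t) y := by
  obtain ⟨⟨p, hp⟩, ⟨i, hi⟩⟩ := t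
  cases i with
  | zero => simp [eqVal, eqG, Ctl.eval]
  | succ i =>
    simp only [eqG, ctlSum_cons, ctlSum_nil, Ctl.eval, hy, hc, countVal, eqVal, Bool.xor_false]
    have : (∀ j : Fin κ, (j : ℕ) < i + 1 →
          y (reg j) = (count κ (fun p => y (sys p)) p).testBit j) ↔
        (∀ j : Fin κ, (j : ℕ) < i → y (reg j) = (count κ (fun p => y (sys p)) p).testBit j) ∧
          y (reg ⟨i, by omega⟩) = (count κ (fun p => y (sys p)) p).testBit i := by
      constructor
      · exact fun h => ⟨fun j hj => h j (by omega), h ⟨i, by omega⟩ (by simp)⟩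
      · rintro ⟨h, h'⟩ j hj
        rcases Nat.lt_succ_iff_lt_or_eq.1 hj with hj | hj
        · exact h j hj
        · have : j = ⟨i, by omega⟩ := Fin.ext hj
          rw [this]; exact h'
    simp only [this, Bool.decide_and]
    cases y (sys ⟨p, hp⟩) <;> cases y (reg ⟨i, by omega⟩) <;>
      cases (count κ (fun p => y (sys p)) p).testBit i <;> simp

theorem eqG_wires {sys : Fin n → W} {reg : Fin κ → W} {cnt : CountNode n κ → W}
    {node : EqNode n κ → W} {t : EqNode n κ} {c : Ctl W}
    (hc : c ∈ eqG sys reg cnt node t) {w : W} (hw : w ∈ c.wires) :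
    (∃ p, w = sys p) ∨ (∃ i, w = reg i) ∨ (∃ t', w = cnt t') ∨
      ∃ t', w = node t' ∧ (t'.2 : ℕ) < t.2 := by
  obtain ⟨⟨p, hp⟩, ⟨i, hi⟩⟩ := t
  cases i with
  | zero =>
    simp only [eqG, List.mem_singleton] at hc
    subst hc
    simp only [Ctl.wires, List.mem_singleton] at hw
    exact Or.inl ⟨_, hw⟩
  | succ i =>
    have h1 : w = node (⟨p, hp⟩, ⟨i, by omega⟩) ∨ w = reg ⟨i, by omega⟩ ∨
        w = cnt (⟨p, hp⟩, ⟨i, by omega⟩, false) := by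
      simp only [eqG, List.mem_cons, List.not_mem_nil, or_false] at hc
      rcases hc with rfl | rfl | rfl <;> simp [Ctl.wires] at hw <;> tauto
    rcases h1 with h1 | h1 | h1
    · exact Or.inr (Or.inr (Or.inr ⟨_, h1, by simp⟩))
    · exact Or.inr (Or.inl ⟨_, h1⟩)
    · exact Or.inr (Or.inr (Or.inl ⟨_, h1⟩))

theorem eqG_cost (sys : Fin n → W) (reg : Fin κ → W) (cnt : CountNode n κ → W)
    (node : EqNode n κ → W) : ∑ t, ctlCost (eqG sys reg cnt node t) ≤ 2 * (n * (κ + 1)) := by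
  have h : ∀ t : EqNode n κ, ctlCost (eqG sys reg cnt node t) ≤ 2 := by
    rintro ⟨⟨p, hp⟩, ⟨i, hi⟩⟩
    cases i <;> simp [eqG, ctlCost, Ctl.cost]
  refine (Finset.sum_le_sum fun t _ => h t).trans ?_
  simp [mul_comm]

end Counter

section Registers

/-! ### Registers and the steps of the circuit -/

/-- The ancilla qubits other than work bits: the register `j` that selects a particle, the one-hot
register `E` of its mode, the binary mode register `q`, a spare register `s` for additions, the
displacement `d`, the comparison register `u`, the word `w`, two flags for invalid selections, the
phase qubit `ph` and a qubit `zero` that stays in the state zero. -/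
inductive Reg (n κ k l m : ℕ) : Type
  | j (i : Fin κ) | E (p : Fin n) | q (i : Fin k) | s (i : Fin k) | d (i : Fin l) | u (i : Fin m)
  | w (i : Fin m) | flag | flag2 | ph | zero
  deriving DecidableEq, Fintype

/-- The ancilla registers together with the system qubits. -/
abbrev Wire (n κ k l m : ℕ) : Type := Reg n κ k l m ⊕ Fin n

/-- A bit string on the registers and on the system, sorted by registers; `y` is the system. -/
@[ext] structure RegState (n κ k l m : ℕ) : Type where
  y : Fin n → Bool
  j : Fin κ → Bool
  E : Fin n → Bool
  q : Fin k → Bool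
  s : Fin k → Bool
  d : Fin l → Bool
  u : Fin m → Bool
  w : Fin m → Bool
  flag : Bool
  flag2 : Bool
  ph : Bool
  zero : Bool
  deriving DecidableEq

variable {n κ k l m : ℕ}

namespace RegState

/-- The underlying bit string. -/
def toFun (S : RegState n κ k l m) : Wire n κ k l m → Bool
  | .inl (.j i) => S.j i
  | .inl (.E i) => S.E i
  | .inl (.q i) => S.q i
  | .inl (.s i) => S.s i
  | .inl (.d i) => S.d i
  | .inl (.u i) => S.u i
  | .inl (.w i) => S.w i
  | .inl .flag => S.flag
  | .inl .flag2 => S.flag2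
  | .inl .ph => S.ph
  | .inl .zero => S.zero
  | .inr p => S.y p

/-- The registers of a bit string. -/
def ofFun (v : Wire n κ k l m → Bool) : RegState n κ k l m where
  y p := v (.inr p)
  j i := v (.inl (.j i))
  E i := v (.inl (.E i))
  q i := v (.inl (.q i))
  s i := v (.inl (.s i))
  d i := v (.inl (.d i))
  u i := v (.inl (.u i))
  w i := v (.inl (.w i))
  flag := v (.inl .flag)
  flag2 := v (.inl .flag2)
  ph := v (.inl .ph)
  zero := v (.inl .zero)

@[simp] theorem ofFun_toFun (S : RegState n κ k l m) : ofFun S.toFun = S := rfl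

@[simp] theorem toFun_ofFun (v : Wire n κ k l m → Bool) : (ofFun v).toFun = v := by
  funext w
  rcases w with r | p
  · cases r <;> rfl
  · rfl

theorem toFun_injective : Function.Injective (toFun : RegState n κ k l m → _) :=
  Function.LeftInverse.injective ofFun_toFun

end RegState

/-- `F` is computed on the registers by a classical circuit with at most `t` Toffoli gates and `w`
clean work bits. -/
def RegRealizes (w t : ℕ) (F : RegState n κ k l m → RegState n κ k l m) : Prop :=
  Realizes w t fun v => (F (.ofFun v)).toFun

theorem RegRealizes.mono {w w' t t' : ℕ} {F : RegState n κ k l m → RegState n κ k l m}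
    (h : RegRealizes w t F) (hw : w ≤ w') (ht : t ≤ t') : RegRealizes w' t' F :=
  Realizes.mono h hw ht

theorem RegRealizes.comp {w w' t t' : ℕ} {F F' : RegState n κ k l m → RegState n κ k l m}
    (h : RegRealizes w t F) (h' : RegRealizes w' t' F') :
    RegRealizes (max w w') (t + t') fun S => F' (F S) := by
  have := Realizes.comp h h'
  simpa [RegRealizes] using this

theorem regRealizes_sandwich {N : Type} [Fintype N] [DecidableEq N]
    (G : N → List (Ctl (Wire n κ k l m ⊕ N))) (ρ : N → ℕ) (val : RegState n κ k l m → N → Bool)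
    (hρ : ∀ n, ∀ c ∈ G n, ∀ n', Sum.inr n' ∈ c.wires → ρ n' < ρ n)
    (hval : ∀ S n, val S n = ctlSum (G n) (Sum.elim S.toFun (val S)))
    (out : Wire n κ k l m → List (Ctl (Wire n κ k l m ⊕ N)))
    (hout : ∀ t, ∀ c ∈ out t, ∀ w, Sum.inl w ∈ c.wires → out w = [])
    (F : RegState n κ k l m → RegState n κ k l m)
    (hF : ∀ S w, (F S).toFun w = xor (S.toFun w) (ctlSum (out w) (Sum.elim S.toFun (val S))))
    (hinv : ∀ S, val (F S) = val S) :
    RegRealizes (Fintype.card N) (2 * ∑ n, ctlCost (G n) + ∑ w, ctlCost (out w)) F := by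
  refine realizes_sandwich G ρ (fun v => val (.ofFun v)) hρ (fun v n => ?_) out hout _
    (fun v w => ?_) fun v => ?_
  · simpa using hval (.ofFun v) n
  · simpa using hF (.ofFun v) w
  · simpa using hinv (.ofFun v)

theorem regRealizes_layer (out : Wire n κ k l m → List (Ctl (Wire n κ k l m)))
    (hout : ∀ t, ∀ c ∈ out t, ∀ w ∈ c.wires, out w = [])
    (F : RegState n κ k l m → RegState n κ k l m)
    (hF : ∀ S w, (F S).toFun w = xor (S.toFun w) (ctlSum (out w) S.toFun)) :
    RegRealizes 0 (∑ w, ctlCost (out w)) F := by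
  refine realizes_layer out hout _ fun v w => ?_
  simpa using hF (.ofFun v) w

theorem sum_wire (g : Wire n κ k l m → ℕ) : ∑ w, g w =
    ∑ i, g (.inl (.j i)) + ∑ i, g (.inl (.E i)) + ∑ i, g (.inl (.q i)) + ∑ i, g (.inl (.s i)) +
    ∑ i, g (.inl (.d i)) + ∑ i, g (.inl (.u i)) + ∑ i, g (.inl (.w i)) + g (.inl .flag) +
    g (.inl .flag2) + g (.inl .ph) + g (.inl .zero) + ∑ p, g (.inr p) := by
  let e : Fin κ ⊕ Fin n ⊕ Fin k ⊕ Fin k ⊕ Fin l ⊕ Fin m ⊕ Fin m ⊕ Fin 4 ≃ Reg n κ k l m :=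
    { toFun := fun x => match x with
        | .inl i => .j i
        | .inr (.inl i) => .E i
        | .inr (.inr (.inl i)) => .q i
        | .inr (.inr (.inr (.inl i))) => .s i
        | .inr (.inr (.inr (.inr (.inl i)))) => .d i
        | .inr (.inr (.inr (.inr (.inr (.inl i))))) => .u i
        | .inr (.inr (.inr (.inr (.inr (.inr (.inl i)))))) => .w i
        | .inr (.inr (.inr (.inr (.inr (.inr (.inr 0)))))) => .flag
        | .inr (.inr (.inr (.inr (.inr (.inr (.inr 1)))))) => .flag2
        | .inr (.inr (.inr (.inr (.inr (.inr (.inr 2)))))) => .ph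
        | .inr (.inr (.inr (.inr (.inr (.inr (.inr 3)))))) => .zero
      invFun := fun x => match x with
        | .j i => .inl i
        | .E i => .inr (.inl i)
        | .q i => .inr (.inr (.inl i))
        | .s i => .inr (.inr (.inr (.inl i)))
        | .d i => .inr (.inr (.inr (.inr (.inl i))))
        | .u i => .inr (.inr (.inr (.inr (.inr (.inl i)))))
        | .w i => .inr (.inr (.inr (.inr (.inr (.inr (.inl i))))))
        | .flag => .inr (.inr (.inr (.inr (.inr (.inr (.inr 0))))))
        | .flag2 => .inr (.inr (.inr (.inr (.inr (.inr (.inr 1))))))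
        | .ph => .inr (.inr (.inr (.inr (.inr (.inr (.inr 2))))))
        | .zero => .inr (.inr (.inr (.inr (.inr (.inr (.inr 3))))))
      left_inv := by
        rintro (i | i | i | i | i | i | i | i)
        · rfl
        · rfl
        · rfl
        · rfl
        · rfl
        · rfl
        · rfl
        · fin_cases i <;> rfl
      right_inv := by rintro (_ | _ | _ | _ | _ | _ | _ | _ | _ | _ | _) <;> rfl }
  rw [Fintype.sum_sum_type, ← e.sum_comp]
  simp only [Fintype.sum_sum_type, Fin.sum_univ_four]
  simp only [e, Equiv.coe_fn_mk]
  ring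

/-! ### Selecting a particle -/

section Steps

/-- Adds to the one-hot register the occupied modes whose code is the value of `j`. -/
def findMode (c : (Fin n → Bool) → Fin n → ℕ) (S : RegState n κ k l m) : RegState n κ k l m :=
  { S with E := fun p => xor (S.E p) (S.y p && decide (c S.y p = Nat.ofBits S.j)) }

/-- Adds the code of the mode in the one-hot register to `j`. If the mode was found by its code in `j`,
this resets `j` to zero. -/
def clearCode (c : (Fin n → Bool) → Fin n → ℕ) (S : RegState n κ k l m) : RegState n κ k l m :=
  { S with
    j := fun i => xor (S.j i)
      (xorAll ((List.finRange n).map fun p => (c S.y p).testBit i && S.E p)) }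

/-- The one-hot encoding of `j` is compared with the occupied modes. -/
theorem findMode_binary (hn : n ≤ 2 ^ κ) : ∃ w, RegRealizes w (2 * 2 ^ (κ + 1) + n)
    (findMode fun _ p => p : RegState n κ k l m → _) := by
  let out : Wire n κ k l m → List (Ctl (Wire n κ k l m ⊕ Tree κ)) := fun w => match w with
    | .inl (.E p) => [.and (.inr (leaf κ p (p.2.trans_le hn))) (.inl (.inr p))]
    | _ => []
  have h := regRealizes_sandwich (N := Tree κ) (treeG (fun i => .inl (.inl (.j i))) .inr)
    (fun t => t.1) (fun S => treeVal S.j) ?_ ?_ out ?_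
    (findMode fun _ p => p : RegState n κ k l m → _) ?_ ?_
  · refine ⟨_, h.mono le_rfl ?_⟩
    have h1 := treeG_cost (fun i => .inl (.inl (.j i)) : Fin κ → Wire n κ k l m ⊕ Tree κ) .inr
    have h2 : ∑ w, ctlCost (out w) = n := by
      rw [sum_wire]
      simp [out, ctlCost, Ctl.cost]
    omega
  · intro t c hc t' ht'
    rcases treeG_wires hc ht' with ⟨i, h⟩ | ⟨t'', h, h'⟩
    · cases h
    · cases h; exact h'
  · intro S t
    exact treeG_eval (fun i => .inl (.inl (.j i))) .inr (Sum.elim S.toFun (treeVal S.j))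
      (fun _ => rfl) t
  · rintro (r | p) c hc w hw
    · cases r <;> simp only [out, List.not_mem_nil, List.mem_singleton] at hc
      subst hc
      simp [Ctl.wires] at hw
      subst hw
      rfl
    · simp [out] at hc
  · rintro S (r | p)
    · cases r <;> simp [out, RegState.toFun, findMode, Ctl.eval, treeVal_leaf, Bool.and_comm, eq_comm]
    · simp [out, RegState.toFun, findMode]
  · intro S; rfl

theorem clearCode_binary : RegRealizes 0 0 (clearCode fun _ p => p : RegState n κ k l m → _) := by
  let out : Wire n κ k l m → List (Ctl (Wire n κ k l m)) := fun w => match w with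
    | .inl (.j i) => ((List.finRange n).filter fun p : Fin n => (p : ℕ).testBit i).map fun p =>
        .lit (.inl (.E p))
    | _ => []
  have h := regRealizes_layer out ?_ (clearCode fun _ p => p : RegState n κ k l m → _) ?_
  · refine h.mono le_rfl ?_
    rw [sum_wire]
    simp only [out, ctlCost_map_lit]
    simp [ctlCost]
  · rintro (r | p) c hc w hw
    · cases r <;> simp only [out, List.not_mem_nil, List.mem_map] at hc
      obtain ⟨p, -, rfl⟩ := hc
      simp [Ctl.wires] at hw
      subst hw
      rfl
    · simp [out] at hc
  · rintro S (r | p)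
    · cases r <;> simp [out, RegState.toFun, clearCode, Ctl.eval, ctlSum_map, xorAll_map_filter]
    · simp [out, RegState.toFun, clearCode]

/-- A counter that runs over the modes is compared, at each occupied mode, with `j`. The comparison
with the lowest `κ` bits also succeeds for `j = 0` when the counter has stopped at `2 ^ κ`; the top
bit of the counter excludes this case. -/
theorem findMode_count : ∃ w, RegRealizes w (7 * (n * (κ + 1)))
    (findMode (fun y p => count κ y p) : RegState n κ k l m → _) := by
  let N := CountNode n κ ⊕ EqNode n κ
  let sys : Fin n → Wire n κ k l m ⊕ N := fun p => .inl (.inr p)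
  let G : N → List (Ctl (Wire n κ k l m ⊕ N)) :=
    Sum.elim (countG sys fun t => .inr (.inl t))
      (eqG sys (fun i => .inl (.inl (.j i))) (fun t => .inr (.inl t)) fun t => .inr (.inr t))
  let out : Wire n κ k l m → List (Ctl (Wire n κ k l m ⊕ N)) := fun w => match w with
    | .inl (.E p) => [.lit (.inr (.inr (p, Fin.last κ))),
        .and (.inr (.inr (p, Fin.last κ))) (.inr (.inl (p, Fin.last κ, false)))]
    | _ => []
  let val : RegState n κ k l m → N → Bool := fun S => Sum.elim (countVal S.y) (eqVal S.y S.j)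
  have hcr : ∀ t : CountNode n κ, countRank t < n * (κ + 2) := by
    rintro ⟨⟨p, hp⟩, ⟨i, hi⟩, b⟩
    have h1 : (p + 1) * (κ + 2) ≤ n * (κ + 2) := Nat.mul_le_mul_right _ hp
    rw [add_mul] at h1
    cases b <;> simp only [countRank] <;> omega
  have h := regRealizes_sandwich G
    (Sum.elim countRank fun t => n * (κ + 2) + t.2) val ?_ ?_ out ?_
    (findMode (fun y p => count κ y p) : RegState n κ k l m → _) ?_ ?_
  · refine ⟨_, h.mono le_rfl ?_⟩
    have h1 := countG_cost (κ := κ) sys fun t => .inr (.inl t)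
    have h2 := eqG_cost (κ := κ) sys (fun i => .inl (.inl (.j i))) (fun t => .inr (.inl t))
      fun t => .inr (.inr t)
    have h3 : ∑ w, ctlCost (out w) = n := by
      rw [sum_wire]
      simp [out, ctlCost, Ctl.cost]
    have h4 : n ≤ n * (κ + 1) := Nat.le_mul_of_pos_right _ (by omega)
    rw [Fintype.sum_sum_type]
    simp only [G, Sum.elim_inl, Sum.elim_inr]
    omega
  · rintro (t | t) c hc t' ht'
    · change c ∈ countG sys (fun t => .inr (.inl t)) t at hc
      rcases countG_wires hc ht' with ⟨p, h⟩ | ⟨t'', h, h'⟩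
      · cases h
      · cases h; exact h'
    · change c ∈ eqG sys (fun i => .inl (.inl (.j i))) (fun t => .inr (.inl t))
        (fun t => .inr (.inr t)) t at hc
      rcases eqG_wires hc ht' with ⟨p, h⟩ | ⟨i, h⟩ | ⟨t'', h⟩ | ⟨t'', h, h'⟩
      · cases h
      · cases h
      · cases h
        exact (hcr _).trans_le (by simp)
      · cases h
        simpa using h'
  · rintro S (t | t)
    · exact countG_eval sys (fun t => .inr (.inl t)) (Sum.elim S.toFun (val S)) (fun _ => rfl) t
    · exact eqG_eval sys (fun i => .inl (.inl (.j i))) (fun t => .inr (.inl t))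
        (fun t => .inr (.inr t)) (Sum.elim S.toFun (val S)) (fun _ => rfl) (fun _ => rfl) t
  · rintro (r | p) c hc w hw
    · cases r <;> simp only [out, List.not_mem_nil, List.mem_cons, or_false] at hc
      rcases hc with rfl | rfl <;> simp [Ctl.wires] at hw
    · simp [out] at hc
  · have key : ∀ (S : RegState n κ k l m) p,
        (S.y p && decide (count κ S.y p = Nat.ofBits S.j)) =
          xor (eqVal S.y S.j (p, Fin.last κ))
            (eqVal S.y S.j (p, Fin.last κ) && (count κ S.y p).testBit κ) := by
      intro S p
      have hj := Nat.ofBits_lt_two_pow S.j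
      have hle := count_le κ S.y p
      simp only [eqVal]
      rcases Nat.lt_or_ge (count κ S.y p) (2 ^ κ) with hlt | hge
      · have h1 := eq_testBit_iff (b := S.j) hlt
        have h2 : (∀ i : Fin κ, (i : ℕ) < (Fin.last κ : Fin (κ + 1)) →
            S.j i = (count κ S.y p).testBit i) ↔ count κ S.y p = Nat.ofBits S.j := by
          rw [eq_comm (a := count κ S.y p), ← h1]
          simp
        rw [Nat.testBit_lt_two_pow hlt]
        simp only [h2, Bool.and_false, Bool.xor_false]
      · have : count κ S.y p = 2 ^ κ := le_antisymm hle hge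
        rw [this, Nat.testBit_two_pow_self]
        simp [hj.ne']
    rintro S (r | p)
    · cases r <;> simp [out, RegState.toFun, findMode]
      simp [Ctl.eval, val, countVal, key]
    · simp [out, RegState.toFun, findMode]
  · intro S; rfl

theorem clearCode_count : ∃ w, RegRealizes w (3 * (n * (κ + 1)))
    (clearCode (fun y p => count κ y p) : RegState n κ k l m → _) := by
  let N := CountNode n κ
  let sys : Fin n → Wire n κ k l m ⊕ N := fun p => .inl (.inr p)
  let out : Wire n κ k l m → List (Ctl (Wire n κ k l m ⊕ N)) := fun w => match w with
    | .inl (.j i) => (List.finRange n).map fun p =>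
        .and (.inr (p, i.castSucc, false)) (.inl (.inl (.E p)))
    | _ => []
  have h := regRealizes_sandwich (countG sys .inr) countRank (fun S => countVal S.y) ?_ ?_ out ?_
    (clearCode (fun y p => count κ y p) : RegState n κ k l m → _) ?_ ?_
  · refine ⟨_, h.mono le_rfl ?_⟩
    have h1 := countG_cost (κ := κ) sys .inr
    have h3 : ∑ w, ctlCost (out w) = κ * n := by
      rw [sum_wire]
      simp [out, ctlCost, Ctl.cost, Function.comp_def]
    have h4 : κ * n ≤ n * (κ + 1) := by nlinarith
    omega
  · rintro t c hc t' ht'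
    rcases countG_wires hc ht' with ⟨p, h⟩ | ⟨t'', h, h'⟩
    · cases h
    · cases h; exact h'
  · rintro S t
    exact countG_eval sys .inr (Sum.elim S.toFun (countVal S.y)) (fun _ => rfl) t
  · rintro (r | p) c hc w hw
    · cases r <;> simp only [out, List.not_mem_nil, List.mem_map] at hc
      obtain ⟨p, -, rfl⟩ := hc
      simp [Ctl.wires] at hw
      subst hw
      rfl
    · simp [out] at hc
  · rintro S (r | p)
    · cases r <;> simp [out, RegState.toFun, clearCode, Ctl.eval, ctlSum_map, countVal]
    · simp [out, RegState.toFun, clearCode]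
  · intro S; rfl

/-! ### Removing the selected particle -/

/-- Adds to the phase qubit the parity of the number of particles before the selected mode. -/
def addSign (S : RegState n κ k l m) : RegState n κ k l m :=
  { S with ph := xor S.ph (xorAll ((List.finRange n).map fun p =>
      xorAll ((List.finRange n).map fun q => decide (p < q) && S.E q) && S.y p)) }

theorem addSign_realizes : ∃ w, RegRealizes w n (addSign : RegState n κ k l m → _) := by
  let G : Fin n → List (Ctl (Wire n κ k l m ⊕ Fin n)) := fun p =>
    ((List.finRange n).filter fun q => decide (p < q)).map fun q => .lit (.inl (.inl (.E q)))
  let out : Wire n κ k l m → List (Ctl (Wire n κ k l m ⊕ Fin n)) := fun w => match w with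
    | .inl .ph => (List.finRange n).map fun p => .and (.inr p) (.inl (.inr p))
    | _ => []
  have h := regRealizes_sandwich G (fun _ => 0)
    (fun S p => xorAll ((List.finRange n).map fun q => decide (p < q) && S.E q)) ?_ ?_ out ?_
    (addSign : RegState n κ k l m → _) ?_ ?_
  · refine ⟨_, h.mono le_rfl ?_⟩
    rw [sum_wire]
    simp [out, G, ctlCost_map_lit]
    simp [ctlCost, Ctl.cost, Function.comp_def]
  · intro p c hc p' hp'
    simp only [G, List.mem_map] at hc
    obtain ⟨q, -, rfl⟩ := hc
    simp [Ctl.wires] at hp'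
  · intro S p
    simp [G, ctlSum_filter_map, Ctl.eval, RegState.toFun]
  · rintro (r | p) c hc w hw
    · cases r <;> simp only [out, List.not_mem_nil, List.mem_map] at hc
      obtain ⟨p, -, rfl⟩ := hc
      simp [Ctl.wires] at hw
      subst hw
      rfl
    · simp [out] at hc
  · rintro S (r | p)
    · cases r <;> simp [out, RegState.toFun, addSign, Ctl.eval, ctlSum_map]
    · simp [out, RegState.toFun, addSign]
  · intro S; rfl

/-- Empties the selected mode, adds its number plus `off` to the register `q`, and sets the flag if
no mode is selected. -/
def moveMode (off : ℕ) (S : RegState n κ k l m) : RegState n κ k l m :=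
  { S with
    y := fun p => xor (S.y p) (S.E p)
    flag := xor S.flag (!(xorAll ((List.finRange n).map S.E)))
    q := fun i => xor (S.q i)
      (xorAll ((List.finRange n).map fun p : Fin n => ((p : ℕ) + off).testBit i && S.E p)) }

theorem moveMode_realizes (off : ℕ) :
    RegRealizes 0 0 (moveMode off : RegState n κ k l m → _) := by
  let out : Wire n κ k l m → List (Ctl (Wire n κ k l m)) := fun w => match w with
    | .inr p => [.lit (.inl (.E p))]
    | .inl .flag => .one :: (List.finRange n).map fun p => .lit (.inl (.E p))
    | .inl (.q i) => ((List.finRange n).filter fun p : Fin n => ((p : ℕ) + off).testBit i).map fun p =>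
        .lit (.inl (.E p))
    | _ => []
  have h := regRealizes_layer out ?_ (moveMode off : RegState n κ k l m → _) ?_
  · refine h.mono le_rfl ?_
    rw [sum_wire]
    simp [out, ctlCost, Function.comp_def, Ctl.cost]
  · rintro (r | p) c hc w hw
    · cases r <;> simp only [out, List.not_mem_nil, List.mem_map, List.mem_cons] at hc
      · obtain ⟨p, -, rfl⟩ := hc
        simp [Ctl.wires] at hw
        subst hw
        rfl
      · rcases hc with rfl | ⟨p, -, rfl⟩
        · simp [Ctl.wires] at hw
        · simp [Ctl.wires] at hw
          subst hw
          rfl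
    · simp only [out, List.mem_singleton] at hc
      subst hc
      simp [Ctl.wires] at hw
      subst hw
      rfl
  · rintro S (r | p)
    · cases r <;> simp [out, RegState.toFun, moveMode, Ctl.eval, ctlSum_map, xorAll_map_filter]
    · simp [out, RegState.toFun, moveMode, Ctl.eval]

/-- Adds to the one-hot register the mode whose number plus `off` is in the register `q`. After the
mode has been moved to `q`, this resets the one-hot register to zero. -/
def clearMode (off : ℕ) (S : RegState n κ k l m) : RegState n κ k l m :=
  { S with E := fun p => xor (S.E p) (decide (Nat.ofBits S.q = p + off)) }

theorem clearMode_realizes (off : ℕ) (hoff : n + off ≤ 2 ^ k) :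
    ∃ w, RegRealizes w (2 * 2 ^ (k + 1)) (clearMode off : RegState n κ k l m → _) := by
  let out : Wire n κ k l m → List (Ctl (Wire n κ k l m ⊕ Tree k)) := fun w => match w with
    | .inl (.E p) => [.lit (.inr (leaf k (p + off) (by omega)))]
    | _ => []
  have h := regRealizes_sandwich (N := Tree k) (treeG (fun i => .inl (.inl (.q i))) .inr)
    (fun t => t.1) (fun S => treeVal S.q) ?_ ?_ out ?_
    (clearMode off : RegState n κ k l m → _) ?_ ?_
  · refine ⟨_, h.mono le_rfl ?_⟩
    have h1 := treeG_cost (fun i => .inl (.inl (.q i)) : Fin k → Wire n κ k l m ⊕ Tree k) .inr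
    have h2 : ∑ w, ctlCost (out w) = 0 := by
      rw [sum_wire]
      simp [out, ctlCost, Ctl.cost]
    omega
  · intro t c hc t' ht'
    rcases treeG_wires hc ht' with ⟨i, h⟩ | ⟨t'', h, h'⟩
    · cases h
    · cases h; exact h'
  · intro S t
    exact treeG_eval (fun i => .inl (.inl (.q i))) .inr (Sum.elim S.toFun (treeVal S.q))
      (fun _ => rfl) t
  · rintro (r | p) c hc w hw
    · cases r <;> simp only [out, List.not_mem_nil, List.mem_singleton] at hc
      subst hc
      simp [Ctl.wires] at hw
    · simp [out] at hc
  · rintro S (r | p)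
    · cases r <;> simp [out, RegState.toFun, clearMode, Ctl.eval, treeVal_leaf]
    · simp [out, RegState.toFun, clearMode]
  · intro S; rfl

end Steps

section Annihilate

/-- Selects the particle whose code is the value of `j`, removes it, and replaces the code by the
number of its mode plus `off` in the register `q`. -/
def annihilate (c : (Fin n → Bool) → Fin n → ℕ) (off : ℕ) (S : RegState n κ k l m) :
    RegState n κ k l m :=
  clearMode off (moveMode off (addSign (clearCode c (findMode c S))))

/-- The state in which only the system, the registers in uniform superposition and the phase qubit
may be nonzero. -/
def RegState.start (y : Fin n → Bool) (j : Fin κ → Bool) (d : Fin l → Bool) (u : Fin m → Bool)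
    (ph : Bool) : RegState n κ k l m where
  y := y
  j := j
  E := fun _ => false
  q := fun _ => false
  s := fun _ => false
  d := d
  u := u
  w := fun _ => false
  flag := false
  flag2 := false
  ph := ph
  zero := false

/-- The parity of the number of particles before the mode `p`. -/
def parityBefore (y : Fin n → Bool) (p : Fin n) : Bool :=
  xorAll ((List.finRange n).map fun k => decide (k < p) && y k)

theorem sgn_parityBefore (y : Fin n → Bool) (p : Fin n) : sgn (parityBefore y p) =
    (-1) ^ (Finset.univ.filter fun k : Fin n => k < p ∧ y k = true).card := by
  rw [parityBefore, sgn_xorAll_finRange]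
  simp

/-- The state after a particle has been removed; the register `q` holds the number `x`. -/
def RegState.removed (y : Fin n → Bool) (x : ℕ) (d : Fin l → Bool) (u : Fin m → Bool)
    (ph : Bool) : RegState n κ k l m where
  y := y
  j := fun _ => false
  E := fun _ => false
  q := bits k x
  s := fun _ => false
  d := d
  u := u
  w := fun _ => false
  flag := false
  flag2 := false
  ph := ph
  zero := false

/-- The code `c` separates the particles of a basis state, as far as it is below `2 ^ κ`. -/
def Separates (κ : ℕ) (c : (Fin n → Bool) → Fin n → ℕ) : Prop :=
  ∀ y p p', y p = true → y p' = true → c y p < 2 ^ κ → c y p = c y p' → p = p'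

theorem separates_binary (κ : ℕ) : Separates κ (fun _ p => p : (Fin n → Bool) → Fin n → ℕ) :=
  fun _ _ _ _ _ _ h => Fin.ext h

theorem separates_count (κ : ℕ) :
    Separates κ (fun y p => count κ y p : (Fin n → Bool) → Fin n → ℕ) := by
  intro y p p' hp hp' hlt h
  simp only [count] at h hlt
  have h1 : rank y p = rank y p' := by omega
  rcases lt_trichotomy p p' with h2 | h2 | h2
  · have := rank_lt_rank y h2 hp; omega
  · exact h2
  · have := rank_lt_rank y h2 hp'; omega

/-- The registers `j` and `E` are clean again after the particle has been removed: the pair of the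
remaining state and the mode number replaces the pair of the state and the code. -/
theorem annihilate_start {c : (Fin n → Bool) → Fin n → ℕ} (hc : Separates κ c) {off : ℕ}
    (hoff : n + off ≤ 2 ^ k) {y : Fin n → Bool} {p : Fin n} (hp : y p = true)
    {j : Fin κ → Bool} (hj : c y p = Nat.ofBits j) (d : Fin l → Bool) (u : Fin m → Bool)
    (ph : Bool) :
    annihilate c off (.start y j d u ph : RegState n κ k l m) =
      .removed (Function.update y p false) (p + off) d u (xor ph (parityBefore y p)) := by
  have hE : ∀ p', (y p' && decide (c y p' = Nat.ofBits j)) = decide (p' = p) := by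
    intro p'
    rw [Bool.eq_iff_iff]
    simp only [Bool.and_eq_true, decide_eq_true_eq]
    constructor
    · rintro ⟨h1, h2⟩
      exact (hc y p p' hp h1 (hj ▸ Nat.ofBits_lt_two_pow j) (hj.trans h2.symm)).symm
    · rintro rfl
      exact ⟨hp, hj⟩
  have hsum : ∀ g : Fin n → Bool,
      xorAll ((List.finRange n).map fun p' => g p' && decide (p' = p)) = g p := by
    intro g
    rw [xorAll_finRange_eq_of_unique p fun q hq => by simp [hq]]
    simp
  have hsum1 : xorAll ((List.finRange n).map fun p' => decide (p' = p)) = true := by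
    simpa using hsum fun _ => true
  have hjp : ∀ i : Fin κ, (c y p).testBit i = j i := fun i => by
    rw [hj, Nat.testBit_ofBits_lt _ _ i.2]
  have hq : ∀ p' : Fin n, Nat.ofBits (fun i : Fin k => ((p : ℕ) + off).testBit i) = p' + off ↔
      p' = p := by
    intro p'
    have := p.2
    rw [show Nat.ofBits (fun i : Fin k => ((p : ℕ) + off).testBit i) = p + off from
      ofBits_bits (by omega), Fin.ext_iff]
    omega
  have h1 : findMode c (.start y j d u ph : RegState n κ k l m) =
      { RegState.start y j d u ph with E := fun p' => decide (p' = p) } := by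
    unfold findMode
    congr 1
    funext p'
    exact (Bool.false_xor _).trans (hE p')
  unfold annihilate
  rw [h1]
  ext i
  · by_cases h : i = p
    · subst h; simp [clearMode, moveMode, addSign, clearCode, RegState.start, RegState.removed, hp]
    · simp [clearMode, moveMode, addSign, clearCode, RegState.start, RegState.removed, h]
  all_goals simp [clearMode, moveMode, addSign, clearCode, RegState.start, RegState.removed, hsum,
    hsum1, hjp, hq, bits, parityBefore]

/-- The flag marks the values of `j` that select no particle. -/
theorem annihilate_start_flag {c : (Fin n → Bool) → Fin n → ℕ} {off : ℕ}
    {y : Fin n → Bool} {j : Fin κ → Bool} (h : ∀ p, y p = true → c y p ≠ Nat.ofBits j)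
    (d : Fin l → Bool) (u : Fin m → Bool) (ph : Bool) :
    (annihilate c off (.start y j d u ph : RegState n κ k l m)).flag = true := by
  have hE : ∀ p', (y p' && decide (c y p' = Nat.ofBits j)) = false := by
    intro p'
    have := h p'
    cases hy : y p' <;> simp_all
  have h1 : findMode c (.start y j d u ph : RegState n κ k l m) = .start y j d u ph := by
    unfold findMode
    have : (fun p' => xor false (y p' && decide (c y p' = Nat.ofBits j))) = fun _ => false := by
      funext p'
      rw [hE, Bool.false_xor]
    exact congrArg (fun E => { RegState.start y j d u ph with E := E }) this
  have : xorAll ((List.finRange n).map fun _ => false) = false :=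
    xorAll_map_eq_false fun _ _ => rfl
  unfold annihilate
  rw [h1]
  simp only [clearMode, moveMode, addSign, clearCode, RegState.start, this]
  rfl

theorem annihilate_flag2 (c : (Fin n → Bool) → Fin n → ℕ) (off : ℕ) (S : RegState n κ k l m) :
    (annihilate c off S).flag2 = S.flag2 := rfl

theorem annihilate_realizes {c : (Fin n → Bool) → Fin n → ℕ} {t t' off : ℕ}
    (h : ∃ w, RegRealizes w t (findMode c : RegState n κ k l m → _))
    (h' : ∃ w, RegRealizes w t' (clearCode c : RegState n κ k l m → _))
    (hoff : n + off ≤ 2 ^ k) :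
    ∃ w, RegRealizes w (t + t' + n + 2 * 2 ^ (k + 1))
      (annihilate c off : RegState n κ k l m → _) := by
  obtain ⟨w1, h1⟩ := h
  obtain ⟨w2, h2⟩ := h'
  obtain ⟨w3, h3⟩ := addSign_realizes (n := n) (κ := κ) (k := k) (l := l) (m := m)
  obtain ⟨w4, h4⟩ := clearMode_realizes (n := n) (κ := κ) (k := k) (l := l) (m := m) off hoff
  exact ⟨_, ((((h1.comp h2).comp h3).comp (moveMode_realizes off)).comp h4).mono le_rfl le_rfl⟩

end Annihilate

/-! ### The data lookup -/

section Lookup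

variable {h o : ℕ}

/-- Adds to the word register the entry of the table `tbl` addressed by the registers `hi` and
`lo`. -/
def lookupStep (hi : Fin h → Wire n κ k l m) (lo : Fin o → Wire n κ k l m)
    (tbl : ℕ → ℕ → Fin m → Bool) (S : RegState n κ k l m) : RegState n κ k l m :=
  { S with
    w := fun i => xor (S.w i)
      (tbl (Nat.ofBits fun a => S.toFun (hi a)) (Nat.ofBits fun a => S.toFun (lo a)) i) }

/-- The one-hot encoding of `hi` loads, without Toffoli gates, the `2 ^ o` words that agree with the
address in `hi`; the one-hot encoding of `lo` then selects one of them with `2 ^ o * m` Toffoli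
gates. This is the trade-off between the two parts of the address. -/
theorem lookupStep_realizes (hi : Fin h → Wire n κ k l m) (lo : Fin o → Wire n κ k l m)
    (hhi : ∀ a i, hi a ≠ .inl (.w i)) (hlo : ∀ a i, lo a ≠ .inl (.w i)) :
    ∃ w, ∀ tbl : ℕ → ℕ → Fin m → Bool,
      RegRealizes w (2 * (2 ^ (h + 1) + 2 ^ (o + 1)) + 2 ^ o * m) (lookupStep hi lo tbl) := by
  let N := Tree h ⊕ Tree o ⊕ (Fin (2 ^ o) × Fin m)
  refine ⟨Fintype.card N, fun tbl => ?_⟩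
  let nhi : Tree h → Wire n κ k l m ⊕ N := fun t => .inr (.inl t)
  let nlo : Tree o → Wire n κ k l m ⊕ N := fun t => .inr (.inr (.inl t))
  let loads : Fin (2 ^ o) × Fin m → List (Ctl (Wire n κ k l m ⊕ N)) := fun vi =>
    ((List.finRange (2 ^ h)).filter fun x : Fin (2 ^ h) => tbl x vi.1 vi.2).map fun x : Fin (2 ^ h) =>
      .lit (nhi (leaf h x x.2))
  let G : N → List (Ctl (Wire n κ k l m ⊕ N)) :=
    Sum.elim (treeG (fun a => .inl (hi a)) nhi) (Sum.elim (treeG (fun a => .inl (lo a)) nlo) loads)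
  let out : Wire n κ k l m → List (Ctl (Wire n κ k l m ⊕ N)) := fun w => match w with
    | .inl (.w i) => (List.finRange (2 ^ o)).map fun v : Fin (2 ^ o) =>
        .and (nlo (leaf o v v.2)) (.inr (.inr (.inr (v, i))))
    | _ => []
  let val : RegState n κ k l m → N → Bool := fun S =>
    Sum.elim (treeVal fun a => S.toFun (hi a)) (Sum.elim (treeVal fun a => S.toFun (lo a))
      fun vi => tbl (Nat.ofBits fun a => S.toFun (hi a)) vi.1 vi.2)
  have hne : ∀ (S : RegState n κ k l m) w, (∀ i, w ≠ .inl (.w i)) →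
      (lookupStep hi lo tbl S).toFun w = S.toFun w := by
    rintro S (r | p) hw
    · cases r <;> first | rfl | exact (hw _ rfl).elim
    · rfl
  have hmain := regRealizes_sandwich G
    (Sum.elim (fun t => t.1) (Sum.elim (fun t => t.1) fun _ => h + 1)) val ?_ ?_ out ?_
    (lookupStep hi lo tbl) ?_ ?_
  · refine hmain.mono le_rfl ?_
    have h1 := treeG_cost (fun a => .inl (hi a)) nhi
    have h2 := treeG_cost (fun a => .inl (lo a)) nlo
    have h3 : ∑ w, ctlCost (out w) = m * 2 ^ o := by
      rw [sum_wire]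
      simp [out, ctlCost, Ctl.cost, Function.comp_def]
    have h4 : ∀ vi, ctlCost (loads vi) = 0 := fun vi => ctlCost_map_lit _ _
    rw [Fintype.sum_sum_type, Fintype.sum_sum_type]
    simp only [G, Sum.elim_inl, Sum.elim_inr, h4, h3, Finset.sum_const_zero, mul_comm m]
    omega
  · rintro (t | t | vi) c hc t' ht'
    · change c ∈ treeG (fun a => .inl (hi a)) nhi t at hc
      rcases treeG_wires hc ht' with ⟨i, h⟩ | ⟨t'', h, h'⟩
      · cases h
      · cases h; exact h'
    · change c ∈ treeG (fun a => .inl (lo a)) nlo t at hc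
      rcases treeG_wires hc ht' with ⟨i, h⟩ | ⟨t'', h, h'⟩
      · cases h
      · cases h; exact h'
    · change c ∈ loads vi at hc
      obtain ⟨x, -, rfl⟩ := List.mem_map.1 hc
      simp only [Ctl.wires, List.mem_singleton] at ht'
      cases ht'
      simp [leaf]
  · rintro S (t | t | vi)
    · exact treeG_eval (fun a => .inl (hi a)) nhi (Sum.elim S.toFun (val S)) (fun _ => rfl) t
    · exact treeG_eval (fun a => .inl (lo a)) nlo (Sum.elim S.toFun (val S)) (fun _ => rfl) t
    · simp only [G, loads, Sum.elim_inr, ctlSum_map, xorAll_map_filter, Ctl.eval, val, nhi,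
        Sum.elim_inl, treeVal_leaf]
      rw [xorAll_finRange_eq_of_unique ⟨_, Nat.ofBits_lt_two_pow fun a => S.toFun (hi a)⟩]
      · simp
      · intro x hx
        have : ¬ Nat.ofBits (fun a => S.toFun (hi a)) = x := fun e => hx (Fin.ext e.symm)
        simp [this]
  · rintro (r | p) c hc w hw
    · cases r <;> simp only [out, List.not_mem_nil, List.mem_map] at hc
      obtain ⟨p, -, rfl⟩ := hc
      simp [Ctl.wires, nlo] at hw
    · simp [out] at hc
  · have key : ∀ (S : RegState n κ k l m) i,
        ctlSum (out (.inl (.w i))) (Sum.elim S.toFun (val S)) =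
          tbl (Nat.ofBits fun a => S.toFun (hi a)) (Nat.ofBits fun a => S.toFun (lo a)) i := by
      intro S i
      simp only [out, ctlSum_map, Ctl.eval, val, nlo, Sum.elim_inr, Sum.elim_inl, treeVal_leaf]
      rw [xorAll_finRange_eq_of_unique ⟨_, Nat.ofBits_lt_two_pow fun a => S.toFun (lo a)⟩]
      · simp
      · intro x hx
        have : ¬ Nat.ofBits (fun a => S.toFun (lo a)) = x := fun e => hx (Fin.ext e.symm)
        simp [this]
    rintro S (r | p)
    · cases r
      case w i => rw [key]; rfl
      all_goals simp [out, lookupStep, RegState.toFun]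
    · simp [out, lookupStep, RegState.toFun]
  · intro S
    simp only [val, hne S _ (hhi _), hne S _ (hlo _)]

end Lookup

/-! ### Comparison and addition -/

section Arithmetic

/-- Flips the phase qubit if the comparison register is less than the word. -/
def compareStep (S : RegState n κ k l m) : RegState n κ k l m :=
  { S with ph := xor S.ph (carryVal (fun i => !(S.u i)) S.w m) }

theorem compareStep_realizes :
    ∃ w, RegRealizes w (6 * m) (compareStep : RegState n κ k l m → _) := by
  let a : Fin m → Wire n κ k l m ⊕ Fin (m + 1) := fun i => .inl (.inl (.u i))
  let b : Fin m → Wire n κ k l m ⊕ Fin (m + 1) := fun i => .inl (.inl (.w i))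
  let out : Wire n κ k l m → List (Ctl (Wire n κ k l m ⊕ Fin (m + 1))) := fun w => match w with
    | .inl .ph => [.lit (.inr (Fin.last m))]
    | _ => []
  let val : RegState n κ k l m → Fin (m + 1) → Bool := fun S t =>
    carryVal (fun i => xor true (S.u i)) S.w t
  have h := regRealizes_sandwich (carryG true a b .inr) (fun t => t) val ?_ ?_ out ?_
    (compareStep : RegState n κ k l m → _) ?_ ?_
  · refine ⟨_, h.mono le_rfl ?_⟩
    have h2 : ∑ w, ctlCost (out w) = 0 := by
      rw [sum_wire]
      simp [out, ctlCost, Ctl.cost]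
    rw [carryG_cost, h2]
    omega
  · intro t c hc t' ht'
    rcases carryG_wires hc ht' with ⟨i, h⟩ | ⟨i, h⟩ | ⟨t'', h, h'⟩
    · cases h
    · cases h
    · cases h; exact h'
  · intro S t
    exact carryG_eval true a b .inr (Sum.elim S.toFun (val S)) (fun _ => rfl) t
  · rintro (r | p) c hc w hw
    · cases r <;> simp only [out, List.not_mem_nil, List.mem_singleton] at hc
      subst hc
      simp [Ctl.wires] at hw
    · simp [out] at hc
  · rintro S (r | p)
    · cases r <;> simp [out, RegState.toFun, compareStep, Ctl.eval, val]
    · simp [out, RegState.toFun, compareStep]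
  · intro S; rfl

/-- The displacement register, padded by zeros to the length of the mode register. -/
def dWire (i : Fin k) : Wire n κ k l m := if h : (i : ℕ) < l then .inl (.d ⟨i, h⟩) else .inl .zero

/-- Adds to the spare register the sum of the mode register and the displacement. -/
def addStep (S : RegState n κ k l m) : RegState n κ k l m :=
  { S with
    s := fun i => xor (S.s i)
      (xor (S.q i) (xor (S.toFun (dWire i)) (carryVal S.q (fun i => S.toFun (dWire i)) i))) }

/-- Adds to the mode register the difference of the spare register and the displacement. -/
def subStep (S : RegState n κ k l m) : RegState n κ k l m :=
  { S with
    q := fun i => xor (S.q i)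
      (xor (S.s i) (xor (S.toFun (dWire i))
        (carryVal (fun i => !(S.s i)) (fun i => S.toFun (dWire i)) i))) }

theorem dWire_cases (i : Fin k) : (∃ h : (i : ℕ) < l, (dWire i : Wire n κ k l m) =
    .inl (.d ⟨i, h⟩)) ∨ (dWire i : Wire n κ k l m) = .inl .zero := by
  unfold dWire
  by_cases h : (i : ℕ) < l <;> simp [h]

theorem addStep_realizes : ∃ w, RegRealizes w (6 * k) (addStep : RegState n κ k l m → _) := by
  let a : Fin k → Wire n κ k l m ⊕ Fin (k + 1) := fun i => .inl (.inl (.q i))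
  let b : Fin k → Wire n κ k l m ⊕ Fin (k + 1) := fun i => .inl (dWire i)
  let out : Wire n κ k l m → List (Ctl (Wire n κ k l m ⊕ Fin (k + 1))) := fun w => match w with
    | .inl (.s i) => [.lit (a i), .lit (b i), .lit (.inr i.castSucc)]
    | _ => []
  let val : RegState n κ k l m → Fin (k + 1) → Bool := fun S t =>
    carryVal (fun i => xor false (S.q i)) (fun i => S.toFun (dWire i)) t
  have hne : ∀ (S : RegState n κ k l m) i,
      (addStep S).toFun (dWire i) = S.toFun (dWire i) := by
    intro S i
    rcases dWire_cases (n := n) (κ := κ) (l := l) (m := m) i with ⟨h, e⟩ | e <;> rw [e] <;> rfl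
  have h := regRealizes_sandwich (carryG false a b .inr) (fun t => t) val ?_ ?_ out ?_
    (addStep : RegState n κ k l m → _) ?_ ?_
  · refine ⟨_, h.mono le_rfl ?_⟩
    have h2 : ∑ w, ctlCost (out w) = 0 := by
      rw [sum_wire]
      simp [out, ctlCost, Ctl.cost]
    rw [carryG_cost, h2]
    omega
  · intro t c hc t' ht'
    rcases carryG_wires hc ht' with ⟨i, h⟩ | ⟨i, h⟩ | ⟨t'', h, h'⟩
    · cases h
    · cases h
    · cases h; exact h'
  · intro S t
    exact carryG_eval false a b .inr (Sum.elim S.toFun (val S)) (fun _ => rfl) t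
  · rintro (r | p) c hc w hw
    · cases r <;> simp only [out, List.not_mem_nil, List.mem_cons, or_false] at hc
      rename_i i
      rcases hc with rfl | rfl | rfl <;> simp [Ctl.wires, a, b] at hw <;> subst hw
      · rfl
      · rcases dWire_cases (n := n) (κ := κ) (l := l) (m := m) i with ⟨h, e⟩ | e <;> rw [e]
    · simp [out] at hc
  · rintro S (r | p)
    · cases r <;> simp [out, RegState.toFun, addStep, Ctl.eval, val, a, b]
    · simp [out, RegState.toFun, addStep]
  · intro S
    simp only [val, hne]
    rfl

theorem subStep_realizes : ∃ w, RegRealizes w (6 * k) (subStep : RegState n κ k l m → _) := by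
  let a : Fin k → Wire n κ k l m ⊕ Fin (k + 1) := fun i => .inl (.inl (.s i))
  let b : Fin k → Wire n κ k l m ⊕ Fin (k + 1) := fun i => .inl (dWire i)
  let out : Wire n κ k l m → List (Ctl (Wire n κ k l m ⊕ Fin (k + 1))) := fun w => match w with
    | .inl (.q i) => [.lit (a i), .lit (b i), .lit (.inr i.castSucc)]
    | _ => []
  let val : RegState n κ k l m → Fin (k + 1) → Bool := fun S t =>
    carryVal (fun i => xor true (S.s i)) (fun i => S.toFun (dWire i)) t
  have hne : ∀ (S : RegState n κ k l m) i,
      (subStep S).toFun (dWire i) = S.toFun (dWire i) := by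
    intro S i
    rcases dWire_cases (n := n) (κ := κ) (l := l) (m := m) i with ⟨h, e⟩ | e <;> rw [e] <;> rfl
  have h := regRealizes_sandwich (carryG true a b .inr) (fun t => t) val ?_ ?_ out ?_
    (subStep : RegState n κ k l m → _) ?_ ?_
  · refine ⟨_, h.mono le_rfl ?_⟩
    have h2 : ∑ w, ctlCost (out w) = 0 := by
      rw [sum_wire]
      simp [out, ctlCost, Ctl.cost]
    rw [carryG_cost, h2]
    omega
  · intro t c hc t' ht'
    rcases carryG_wires hc ht' with ⟨i, h⟩ | ⟨i, h⟩ | ⟨t'', h, h'⟩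
    · cases h
    · cases h
    · cases h; exact h'
  · intro S t
    exact carryG_eval true a b .inr (Sum.elim S.toFun (val S)) (fun _ => rfl) t
  · rintro (r | p) c hc w hw
    · cases r <;> simp only [out, List.not_mem_nil, List.mem_cons, or_false] at hc
      rename_i i
      rcases hc with rfl | rfl | rfl <;> simp [Ctl.wires, a, b] at hw <;> subst hw
      · rfl
      · rcases dWire_cases (n := n) (κ := κ) (l := l) (m := m) i with ⟨h, e⟩ | e <;> rw [e]
    · simp [out] at hc
  · rintro S (r | p)
    · cases r <;> simp [out, RegState.toFun, subStep, Ctl.eval, val, a, b]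
    · simp [out, RegState.toFun, subStep]
  · intro S
    simp only [val, hne]
    rfl

/-- Copies the spare register to the mode register, and the first flag to the second. -/
def copyStep (S : RegState n κ k l m) : RegState n κ k l m :=
  { S with q := fun i => xor (S.q i) (S.s i), flag2 := xor S.flag2 S.flag }

/-- Adds the mode register to the spare register. -/
def clearSpare (S : RegState n κ k l m) : RegState n κ k l m :=
  { S with s := fun i => xor (S.s i) (S.q i) }

theorem copyStep_realizes : RegRealizes 0 0 (copyStep : RegState n κ k l m → _) := by
  let out : Wire n κ k l m → List (Ctl (Wire n κ k l m)) := fun w => match w with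
    | .inl (.q i) => [.lit (.inl (.s i))]
    | .inl .flag2 => [.lit (.inl .flag)]
    | _ => []
  have h := regRealizes_layer out ?_ (copyStep : RegState n κ k l m → _) ?_
  · refine h.mono le_rfl ?_
    rw [sum_wire]
    simp [out, ctlCost, Ctl.cost]
  · rintro (r | p) c hc w hw
    · cases r <;> simp only [out, List.not_mem_nil, List.mem_singleton] at hc
      all_goals
        subst hc
        simp [Ctl.wires] at hw
        subst hw
        rfl
    · simp [out] at hc
  · rintro S (r | p)
    · cases r <;> simp [out, RegState.toFun, copyStep, Ctl.eval]
    · simp [out, RegState.toFun, copyStep]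

theorem clearSpare_realizes : RegRealizes 0 0 (clearSpare : RegState n κ k l m → _) := by
  let out : Wire n κ k l m → List (Ctl (Wire n κ k l m)) := fun w => match w with
    | .inl (.s i) => [.lit (.inl (.q i))]
    | _ => []
  have h := regRealizes_layer out ?_ (clearSpare : RegState n κ k l m → _) ?_
  · refine h.mono le_rfl ?_
    rw [sum_wire]
    simp [out, ctlCost, Ctl.cost]
  · rintro (r | p) c hc w hw
    · cases r <;> simp only [out, List.not_mem_nil, List.mem_singleton] at hc
      all_goals
        subst hc
        simp [Ctl.wires] at hw
        subst hw
        rfl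
    · simp [out] at hc
  · rintro S (r | p)
    · cases r <;> simp [out, RegState.toFun, clearSpare, Ctl.eval]
    · simp [out, RegState.toFun, clearSpare]

/-- Adds the displacement to the mode register in place, and copies the flag. From clean flags,
`annihilate` never produces a state whose second flag is set, so the copy discards the invalid
selections. -/
def displace (S : RegState n κ k l m) : RegState n κ k l m :=
  clearSpare (copyStep (subStep (addStep S)))

theorem displace_realizes : ∃ w, RegRealizes w (12 * k) (displace : RegState n κ k l m → _) := by
  obtain ⟨w1, h1⟩ := addStep_realizes (n := n) (κ := κ) (k := k) (l := l) (m := m)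
  obtain ⟨w2, h2⟩ := subStep_realizes (n := n) (κ := κ) (k := k) (l := l) (m := m)
  exact ⟨_, (((h1.comp h2).comp copyStep_realizes).comp clearSpare_realizes).mono le_rfl
    (by omega)⟩

/-- Since `q + d - d = q`, the subtraction resets the mode register before the sum is copied to it. -/
theorem displace_removed (y : Fin n → Bool) (x : ℕ) (d : Fin l → Bool)
    (u : Fin m → Bool) (ph : Bool) :
    displace (.removed y x d u ph : RegState n κ k l m) =
      .removed y (x + Nat.ofBits d) d u ph := by
  have hd : ∀ S : RegState n κ k l m, S.d = d → S.zero = false →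
      (fun i : Fin k => S.toFun (dWire i)) = bits k (Nat.ofBits d) := by
    intro S h1 h2
    funext i
    unfold dWire bits
    by_cases h : (i : ℕ) < l
    · simp [h, RegState.toFun, h1]
    · simp [h, RegState.toFun, h2, Nat.testBit_ofBits_ge _ _ (not_lt.1 h)]
  set S0 : RegState n κ k l m := .removed y x d u ph with hS0
  have h1 : addStep S0 = { S0 with s := bits k (x + Nat.ofBits d) } := by
    have hd0 := hd S0 rfl rfl
    unfold addStep
    congr 1
    funext i
    rw [hd0, congrFun hd0 i, bits_add]
    exact Bool.false_xor _
  have h2 : subStep (addStep S0) =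
      { S0 with s := bits k (x + Nat.ofBits d), q := fun _ => false } := by
    rw [h1]
    set S1 : RegState n κ k l m := { S0 with s := bits k (x + Nat.ofBits d) } with hS1
    have hd1 := hd S1 rfl rfl
    unfold subStep
    rw [hd1]
    congr 1
    funext i
    rw [congrFun hd1 i]
    change xor (bits k x i) (xor (bits k (x + Nat.ofBits d) i) (xor (bits k (Nat.ofBits d) i)
      (carryVal (fun i => !(bits k (x + Nat.ofBits d) i)) (bits k (Nat.ofBits d)) i))) = false
    rw [carryVal_not_add x _ i.2.le, bits_add]
    cases bits k x i <;> cases bits k (Nat.ofBits d) i <;>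
      cases carryVal (bits k x) (bits k (Nat.ofBits d)) i <;> rfl
  rw [displace, h2]
  ext i <;> simp [clearSpare, copyStep, hS0, RegState.removed]

end Arithmetic

end Registers

/-! ### Uniform superpositions -/

section Hadamard

variable {W : Type} [Fintype W] [DecidableEq W]

/-- A Hadamard gate on each wire of a list. -/
def hadamards (R : List W) : Circuit W := R.map Gate.H

omit [Fintype W] [DecidableEq W] in
theorem tCount_hadamards (R : List W) : tCount (hadamards R) = 0 := by
  induction R with
  | nil => rfl
  | cons a R ih => exact ih

theorem mat_hadamards_cons (i : W) (R : List W) :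
    Circuit.mat (hadamards (i :: R)) = Circuit.mat (hadamards R) * (Gate.H i).mat := rfl

theorem mat_hadamards_col {R : List W} (hR : R.Nodup) (x y : W → Bool)
    (hy : ∀ w ∈ R, y w = false) : Circuit.mat (hadamards R) x y =
      if ∀ w, w ∉ R → x w = y w then (1 / (Real.sqrt 2 : ℂ)) ^ R.length else 0 := by
  induction R generalizing y with
  | nil =>
    simp only [hadamards, List.map_nil, Circuit.mat, Matrix.one_apply, List.not_mem_nil,
      not_false_eq_true, forall_const, List.length_nil, pow_zero, funext_iff]
  | cons i R ih =>
    rw [List.nodup_cons] at hR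
    have hyi : y i = false := hy i (by simp)
    rw [mat_hadamards_cons, Matrix.mul_apply]
    have hb : ∀ b, ∀ w ∈ R, Function.update y i b w = false := by
      intro b w hw
      rw [Function.update_of_ne (by rintro rfl; exact hR.1 hw)]
      exact hy w (by simp [hw])
    rw [← Finset.sum_subset
      (Finset.subset_univ {Function.update y i false, Function.update y i true}),
      Finset.sum_pair, ih hR.2 _ (hb _), ih hR.2 _ (hb _)]
    · have hH : ∀ b, (Gate.H i).mat (Function.update y i b) y = 1 / (Real.sqrt 2 : ℂ) := by
        intro b
        simp only [Gate.mat]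
        rw [if_pos fun k hk => Function.update_of_ne hk _ _]
        simp [hyi]
      rw [hH, hH]
      have hiff : ∀ b, (∀ w, w ∉ R → x w = Function.update y i b w) ↔
          (∀ w, w ∉ i :: R → x w = y w) ∧ x i = b := by
        intro b
        constructor
        · intro h
          refine ⟨fun w hw => ?_, by simpa using h i hR.1⟩
          rw [List.mem_cons, not_or] at hw
          rw [h w hw.2, Function.update_of_ne hw.1]
        · rintro ⟨h, h'⟩ w hw
          by_cases hwi : w = i
          · subst hwi; simp [h']
          · rw [Function.update_of_ne hwi]
            exact h w (by simp [hwi, hw])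
      simp only [hiff]
      by_cases h : ∀ w, w ∉ i :: R → x w = y w
      · rw [if_pos h]
        have hl : (i :: R).length = R.length + 1 := rfl
        cases x i <;> simp [pow_succ] <;> simpa using h
      · rw [if_neg h, if_neg (fun h' => h h'.1), if_neg (fun h' => h h'.1)]
        simp
    · intro h
      have := congrFun h i
      simp at this
    · intro z _ hz
      have : (Gate.H i).mat z y = 0 := by
        simp only [Gate.mat]
        rw [if_neg]
        intro h
        have hz' : z = Function.update y i (z i) := by
          funext k
          by_cases hk : k = i
          · subst hk; simp
          · rw [Function.update_of_ne hk, h k hk]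
        simp only [Finset.mem_insert, Finset.mem_singleton, not_or] at hz
        cases hzi : z i
        · rw [hzi] at hz'; exact hz.1 hz'
        · rw [hzi] at hz'; exact hz.2 hz'
      rw [this, mul_zero]

theorem mat_hadamards_row {R : List W} (hR : R.Nodup) (x y : W → Bool)
    (hx : ∀ w ∈ R, x w = false) : Circuit.mat (hadamards R) x y =
      if ∀ w, w ∉ R → y w = x w then (1 / (Real.sqrt 2 : ℂ)) ^ R.length else 0 := by
  induction R generalizing y with
  | nil =>
    simp only [hadamards, List.map_nil, Circuit.mat, Matrix.one_apply, List.not_mem_nil,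
      not_false_eq_true, forall_const, List.length_nil, pow_zero, funext_iff, eq_comm]
  | cons i R ih =>
    rw [List.nodup_cons] at hR
    have hxi : x i = false := hx i (by simp)
    rw [mat_hadamards_cons, Matrix.mul_apply, Finset.sum_eq_single (Function.update y i false)]
    · rw [ih hR.2 _ (fun w hw => hx w (by simp [hw]))]
      have hH : (Gate.H i).mat (Function.update y i false) y = 1 / (Real.sqrt 2 : ℂ) := by
        simp only [Gate.mat]
        rw [if_pos fun k hk => Function.update_of_ne hk _ _]
        simp
      have hiff : (∀ w, w ∉ R → Function.update y i false w = x w) ↔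
          ∀ w, w ∉ i :: R → y w = x w := by
        constructor
        · intro h w hw
          rw [List.mem_cons, not_or] at hw
          rw [← h w hw.2, Function.update_of_ne hw.1]
        · intro h w hw
          by_cases hwi : w = i
          · subst hwi; simp [hxi]
          · rw [Function.update_of_ne hwi]
            exact h w (by simp [hwi, hw])
      simp only [hiff, hH]
      split_ifs
      · rw [List.length_cons, pow_succ]
      · simp
    · intro z _ hz
      by_cases h : ∀ k, k ≠ i → z k = y k
      · rw [ih hR.2 _ (fun w hw => hx w (by simp [hw])), if_neg, zero_mul]
        intro h'
        apply hz
        funext k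
        by_cases hk : k = i
        · subst hk; simp [h' k hR.1, hxi]
        · rw [Function.update_of_ne hk, h k hk]
      · have : (Gate.H i).mat z y = 0 := by
          simp only [Gate.mat]
          rw [if_neg h]
        rw [this, mul_zero]
    · simp

/-- Two bit strings agree off the wires of a list. -/
def AgreeOff {W : Type} (R : List W) (v y : W → Bool) : Prop := ∀ w, w ∉ R → v w = y w

open Classical in
/-- A monomial circuit between two layers of Hadamard gates: the matrix elements are averages of
the phases over the transitions between the strings that extend the input and the output. -/
theorem mat_hadamard_sandwich {R : List W} (hR : R.Nodup) {D : Circuit W}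
    {f : (W → Bool) → (W → Bool)} {φ : (W → Bool) → ℂ} (hD : Circuit.mat D = monoMat f φ)
    {x y : W → Bool} (hx : ∀ w ∈ R, x w = false) (hy : ∀ w ∈ R, y w = false) :
    Circuit.mat (hadamards R ++ D ++ hadamards R) x y =
      (1 / 2) ^ R.length * ∑ v, if AgreeOff R v y then
        (∑ v', if AgreeOff R v' x then (if v' = f v then φ v else 0) else 0) else 0 := by
  have h2 : (1 / (Real.sqrt 2 : ℂ)) * (1 / (Real.sqrt 2 : ℂ)) = 1 / 2 := by
    rw [div_mul_div_comm, one_mul, ← Complex.ofReal_mul, Real.mul_self_sqrt (by norm_num)]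
    norm_num
  rw [Circuit.mat_append, Circuit.mat_append, hD, ← Matrix.mul_assoc, Matrix.mul_apply,
    Finset.mul_sum]
  refine Finset.sum_congr rfl fun v _ => ?_
  rw [mat_hadamards_col hR _ _ hy, Matrix.mul_apply]
  simp only [mat_hadamards_row hR _ _ hx]
  by_cases h : ∀ w, w ∉ R → v w = y w
  · rw [if_pos h, if_pos (show AgreeOff R v y from h), Finset.mul_sum, Finset.sum_mul]
    refine Finset.sum_congr rfl fun v' _ => ?_
    by_cases h' : ∀ w, w ∉ R → v' w = x w
    · rw [if_pos h', if_pos (show AgreeOff R v' x from h'), mul_right_comm, ← mul_pow, h2]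
      rfl
    · rw [if_neg h', if_neg (show ¬ AgreeOff R v' x from h')]
      simp
  · rw [if_neg h, if_neg (show ¬ AgreeOff R v y from h)]
    simp

end Hadamard

/-! ### The matrix elements of the block -/

section Block

variable {n κ k l m w : ℕ}

/-- All qubits: the ancilla registers, the work bits and the system. -/
abbrev Qubit (n κ k l m w : ℕ) : Type := (Reg n κ k l m ⊕ Fin w) ⊕ Fin n

/-- The bit string on all qubits with clean work bits. -/
def RegState.total (w : ℕ) (S : RegState n κ k l m) : Qubit n κ k l m w → Bool
  | .inl (.inl r) => S.toFun (.inl r)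
  | .inl (.inr _) => false
  | .inr p => S.y p

theorem RegState.total_injective :
    Function.Injective (RegState.total w : RegState n κ k l m → _) := by
  intro S S' h
  apply RegState.toFun_injective
  funext a
  rcases a with r | p
  · exact congrFun h (.inl (.inl r))
  · exact congrFun h (.inr p)

theorem RegRealizes.exists_total {w t : ℕ} {F : RegState n κ k l m → RegState n κ k l m}
    (h : RegRealizes w t F) : ∃ c : List (CGate (Qubit n κ k l m w)), toffoliCount c ≤ t ∧
      ∀ S : RegState n κ k l m, run c (S.total w) = (F S).total w := by
  obtain ⟨c, hc, hrun⟩ := h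
  let e : Wire n κ k l m ⊕ Fin w → Qubit n κ k l m w := fun a => match a with
    | .inl (.inl r) => .inl (.inl r)
    | .inl (.inr p) => .inr p
    | .inr i => .inl (.inr i)
  have he : Function.Injective e := by
    rintro ((r | p) | i) ((r' | p') | i') h <;> simp [e] at h <;> rw [h]
  have hs : ∀ S : RegState n κ k l m, (fun a => S.total w (e a)) = withZeros S.toFun := by
    intro S
    funext a
    rcases a with (r | p) | i <;> rfl
  refine ⟨c.map (CGate.map e), by rwa [toffoliCount_map], fun S => ?_⟩
  have h1 : ∀ a, run (c.map (CGate.map e)) (S.total w) (e a) = (F S).total w (e a) := by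
    intro a
    rw [(run_map he c _).1, hs, hrun]
    have := congrFun (hs (F S)) a
    simpa using this.symm
  funext b
  rcases b with (r | i) | p
  · exact h1 (.inl (.inl r))
  · exact h1 (.inr i)
  · exact h1 (.inl (.inr p))

/-- The qubits that are put into uniform superposition. -/
def isSuperposed : Qubit n κ k l m w → Bool
  | .inl (.inl (.j _)) => true
  | .inl (.inl (.d _)) => true
  | .inl (.inl (.u _)) => true
  | .inl (.inl .ph) => true
  | _ => false

/-- The list of the qubits in uniform superposition. -/
def superposed (n κ k l m w : ℕ) : List (Qubit n κ k l m w) :=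
  (Finset.univ.filter fun a => isSuperposed a = true).toList

theorem mem_superposed {a : Qubit n κ k l m w} :
    a ∈ superposed n κ k l m w ↔ isSuperposed a = true := by
  simp [superposed]

theorem length_superposed : (superposed n κ k l m w).length = κ + l + m + 1 := by
  rw [superposed, Finset.length_toList, Finset.card_filter, Fintype.sum_sum_type,
    Fintype.sum_sum_type]
  have h := sum_wire (n := n) (κ := κ) (k := k) (l := l) (m := m)
    (Sum.elim (fun r => if isSuperposed (.inl (.inl r) : Qubit n κ k l m w) = true then 1 else 0)
      fun _ => 0)
  rw [Fintype.sum_sum_type] at h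
  simp only [Sum.elim_inl, Sum.elim_inr, Finset.sum_const_zero, add_zero] at h
  rw [h]
  simp [isSuperposed]

/-- The registers in superposition. -/
abbrev Choice (κ l m : ℕ) : Type := (Fin κ → Bool) × (Fin l → Bool) × (Fin m → Bool) × Bool

/-- The state with system `y`, the given values of the registers in superposition, and zeros
elsewhere. -/
abbrev RegState.ofChoice (y : Fin n → Bool) (t : Choice κ l m) : RegState n κ k l m :=
  .start y t.1 t.2.1 t.2.2.1 t.2.2.2

/-- The all-zero ancilla state with the system state `y`. -/
def zeroAnc (y : Fin n → Bool) : Qubit n κ k l m w → Bool := Sum.elim (fun _ => false) y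

open Classical in
/-- The bit strings that agree with a basis state of the system off the qubits in superposition are
parametrized by the values of the registers in superposition. -/
theorem sum_extensions (y : Fin n → Bool) (g : (Qubit n κ k l m w → Bool) → ℂ) :
    (∑ v : Qubit n κ k l m w → Bool, if AgreeOff (superposed n κ k l m w) v (zeroAnc y) then
        g v else 0) =
      ∑ t : Choice κ l m, g ((RegState.ofChoice (k := k) y t).total w) := by
  symm
  refine Fintype.sum_of_injective
    (fun t : Choice κ l m => (RegState.ofChoice (k := k) y t).total w) ?_ _ _ ?_ ?_
  · rintro ⟨j, d, u, ph⟩ ⟨j', d', u', ph'⟩ h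
    have h := RegState.total_injective h
    simp only [RegState.ofChoice, RegState.start, RegState.mk.injEq] at h
    simp [h]
  · intro v hv
    rw [if_neg]
    intro h
    refine hv ⟨(fun i => v (.inl (.inl (.j i))), fun i => v (.inl (.inl (.d i))),
      fun i => v (.inl (.inl (.u i))), v (.inl (.inl .ph))), ?_⟩
    have h' : ∀ a, isSuperposed a = false → v a = zeroAnc y a := by
      intro a ha
      refine h a ?_
      rw [mem_superposed, ha]
      simp
    funext a
    rcases a with (r | i) | p
    · cases r
      case E i => exact (h' (.inl (.inl (.E i))) rfl).symm
      case q i => exact (h' (.inl (.inl (.q i))) rfl).symm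
      case s i => exact (h' (.inl (.inl (.s i))) rfl).symm
      case w i => exact (h' (.inl (.inl (.w i))) rfl).symm
      case flag => exact (h' (.inl (.inl .flag)) rfl).symm
      case flag2 => exact (h' (.inl (.inl .flag2)) rfl).symm
      case zero => exact (h' (.inl (.inl .zero)) rfl).symm
      all_goals rfl
    · exact (h' (.inl (.inr i)) rfl).symm
    · exact (h' (.inr p) rfl).symm
  · intro t
    rw [if_pos]
    intro a ha
    rw [mem_superposed] at ha
    rcases a with (r | i) | p
    · cases r <;> first | rfl | exact (ha rfl).elim
    · rfl
    · rfl

/-- The phase flip on the phase qubit. Between Hadamard gates it makes the bit flips of the phase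
qubit act as signs. -/
def phaseFlip : Circuit (Qubit n κ k l m w) := [.S (.inl (.inl .ph)), .S (.inl (.inl .ph))]

theorem mat_phaseFlip : Circuit.mat (phaseFlip : Circuit (Qubit n κ k l m w)) =
    monoMat (fun v => v) fun v => sgn (v (.inl (.inl .ph))) := by
  simp only [phaseFlip, Circuit.mat, Gate.mat_S, one_mul, monoMat_mul]
  congr 1
  funext v
  cases v (.inl (.inl .ph)) <;> simp [sgn]

/-- The matrix elements of a circuit whose classical part maps the states `F S` to the states
`F' S'`: it counts, with signs, the pairs of choices with `F' S' = F S`. -/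
theorem ancBlock_eq_sum {F F' : RegState n κ k l m → RegState n κ k l m}
    {c c' : List (CGate (Qubit n κ k l m w))}
    (hc : ∀ S : RegState n κ k l m, run c (S.total w) = (F S).total w)
    (hc' : ∀ S : RegState n κ k l m, run c' (S.total w) = (F' S).total w)
    {D : Circuit (Qubit n κ k l m w)}
    (hD : Circuit.mat D = Circuit.mat (phaseFlip ++ compile (c ++ c'.reverse) ++ phaseFlip))
    (x y : Fin n → Bool) :
    ancBlock (Circuit.mat (hadamards (superposed n κ k l m w) ++ D ++
      hadamards (superposed n κ k l m w))) x y =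
      (1 / 2) ^ (κ + l + m + 1) * ∑ t : Choice κ l m, ∑ t' : Choice κ l m,
        if F' (.ofChoice x t') = F (.ofChoice y t) then sgn t.2.2.2 * sgn t'.2.2.2 else 0 := by
  have hD' : Circuit.mat D = monoMat (run (c ++ c'.reverse)) fun v =>
      sgn (v (.inl (.inl .ph))) * sgn (run (c ++ c'.reverse) v (.inl (.inl .ph))) := by
    rw [hD, Circuit.mat_append, Circuit.mat_append, mat_phaseFlip, mat_compile, monoMat_mul,
      monoMat_mul]
    congr 1
    funext v
    ring
  have hzero : ∀ y : Fin n → Bool, ∀ a ∈ superposed n κ k l m w, zeroAnc y a = false := by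
    rintro y (a | p) ha
    · rfl
    · rw [mem_superposed] at ha
      simp [isSuperposed] at ha
  have h := mat_hadamard_sandwich (Finset.nodup_toList _) hD' (hzero x) (hzero y)
  unfold ancBlock
  refine h.trans ?_
  rw [← superposed, length_superposed, sum_extensions]
  congr 1
  refine Finset.sum_congr rfl fun t _ => ?_
  rw [sum_extensions]
  refine Finset.sum_congr rfl fun t' _ => ?_
  have hiff : (RegState.ofChoice (k := k) x t').total w =
      run (c ++ c'.reverse) ((RegState.ofChoice (k := k) y t).total w) ↔
      F' (.ofChoice x t') = F (.ofChoice y t) := by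
    rw [run_append, ← RegState.total_injective.eq_iff (a := F' _) (b := F _), ← hc, ← hc']
    constructor
    · intro h
      rw [h, run_run_reverse]
    · intro h
      rw [← h, run_reverse_run]
  by_cases h : F' (RegState.ofChoice x t') = F (RegState.ofChoice y t)
  · rw [if_pos h, if_pos (hiff.2 h), ← hiff.2 h]
    rfl
  · rw [if_neg h, if_neg (fun h' => h (hiff.1 h'))]

end Block

/-! ### Evaluation of the block -/

section Entries

variable {n κ k l m : ℕ}

/-- Adds to the word register a word that depends on the mode register and on the displacement. -/
def lookupAt (g : (Fin k → Bool) → (Fin l → Bool) → Fin m → Bool) (S : RegState n κ k l m) :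
    RegState n κ k l m :=
  { S with w := fun i => xor (S.w i) (g S.q S.d i) }

/-- The classical map up to the point where the circuit turns to undoing the creation of a
particle. -/
def forward (c : (Fin n → Bool) → Fin n → ℕ) (g : (Fin k → Bool) → (Fin l → Bool) → Fin m → Bool)
    (S : RegState n κ k l m) : RegState n κ k l m :=
  displace (lookupAt g (compareStep (lookupAt g (annihilate c 0 S))))

theorem compare_removed (g : (Fin k → Bool) → (Fin l → Bool) → Fin m → Bool) (y : Fin n → Bool)
    (x : ℕ) (d : Fin l → Bool) (u : Fin m → Bool) (ph : Bool) :
    lookupAt g (compareStep (lookupAt g (.removed y x d u ph : RegState n κ k l m))) =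
      .removed y x d u (xor ph (carryVal (fun i => !(u i)) (g (bits k x) d) m)) := by
  ext <;> simp [lookupAt, compareStep, RegState.removed]

theorem forward_start {c : (Fin n → Bool) → Fin n → ℕ} (hc : Separates κ c) (hn : n ≤ 2 ^ k)
    (g : (Fin k → Bool) → (Fin l → Bool) → Fin m → Bool) {y : Fin n → Bool}
    {q : Fin n} (hq : y q = true) {j : Fin κ → Bool} (hj : c y q = Nat.ofBits j)
    (d : Fin l → Bool) (u : Fin m → Bool) (ph : Bool) :
    forward c g (.start y j d u ph : RegState n κ k l m) =
      .removed (Function.update y q false) (q + Nat.ofBits d) d u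
        (xor (xor ph (parityBefore y q)) (carryVal (fun i => !(u i)) (g (bits k q) d) m)) := by
  rw [forward, annihilate_start hc (by simpa using hn) hq hj, Nat.add_zero, compare_removed,
    displace_removed]

theorem removed_inj {x x' : ℕ} (hx : x < 2 ^ k) (hx' : x' < 2 ^ k) {y y' : Fin n → Bool}
    {d d' : Fin l → Bool} {u u' : Fin m → Bool} {ph ph' : Bool} :
    (.removed y x d u ph : RegState n κ k l m) = .removed y' x' d' u' ph' ↔
      y = y' ∧ x = x' ∧ d = d' ∧ u = u' ∧ ph = ph' := by
  simp only [RegState.removed, RegState.mk.injEq, true_and, and_true]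
  have : bits k x = bits k x' ↔ x = x' := ⟨bits_inj hx hx', fun h => h ▸ rfl⟩
  rw [this]

/-- The sum over the values of the register `j` is a sum over the particles whose code fits. -/
theorem sum_codes {c : (Fin n → Bool) → Fin n → ℕ} (hc : Separates κ c) (y : Fin n → Bool)
    (G : (Fin κ → Bool) → ℂ) (hG : ∀ j, (∀ p, y p = true → c y p ≠ Nat.ofBits j) → G j = 0) :
    ∑ j, G j = ∑ q, if y q = true ∧ c y q < 2 ^ κ then G (bits κ (c y q)) else 0 := by
  have h1 : ∀ j, G j = ∑ q, if y q = true ∧ c y q = Nat.ofBits j then G j else 0 := by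
    intro j
    by_cases h : ∃ p, y p = true ∧ c y p = Nat.ofBits j
    · obtain ⟨p, hp, hpj⟩ := h
      rw [Finset.sum_eq_single p]
      · rw [if_pos ⟨hp, hpj⟩]
      · rintro p' - hne
        rw [if_neg]
        rintro ⟨h1, h2⟩
        exact hne (hc y p' p h1 hp (h2 ▸ Nat.ofBits_lt_two_pow j) (h2.trans hpj.symm))
      · simp
    · push Not at h
      rw [hG j h]
      symm
      refine Finset.sum_eq_zero fun p _ => ?_
      simp
  rw [Finset.sum_congr rfl fun j _ => h1 j, Finset.sum_comm]
  refine Finset.sum_congr rfl fun q _ => ?_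
  by_cases hq : y q = true ∧ c y q < 2 ^ κ
  · rw [if_pos hq, Finset.sum_eq_single (bits κ (c y q))]
    · rw [if_pos ⟨hq.1, (ofBits_bits hq.2).symm⟩]
    · rintro j - hj
      rw [if_neg]
      rintro ⟨-, h⟩
      exact hj (by rw [h, bits_ofBits])
    · simp
  · rw [if_neg hq]
    refine Finset.sum_eq_zero fun j _ => ?_
    rw [if_neg]
    rintro ⟨h1, h2⟩
    exact hq ⟨h1, h2 ▸ Nat.ofBits_lt_two_pow j⟩

/-- The comparison with a uniformly random number turns a word into an amplitude. -/
theorem sum_sgn_carryVal (b : Fin m → Bool) :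
    ∑ u : Fin m → Bool, sgn (carryVal (fun i => !(u i)) b m) = 2 ^ m - 2 * (Nat.ofBits b : ℂ) := by
  have h1 : ∀ u : Fin m → Bool, sgn (carryVal (fun i => !(u i)) b m) =
      1 - 2 * (if carryVal (fun i => !(u i)) b m = true then 1 else 0) := by
    intro u
    cases carryVal (fun i => !(u i)) b m
    · simp [sgn]
    · norm_num [sgn]
  simp only [h1, Finset.sum_sub_distrib, ← Finset.mul_sum, Finset.sum_boole]
  simp [card_carryVal]

/-- The coefficients that the circuit realizes: the table value at displacement `d` is the
coefficient of the hop from the mode `q` to the mode `q + d - off`. -/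
def hopCoeff (off : ℕ) (a : ℕ → (Fin l → Bool) → ℝ) (p q : Fin n) : ℝ :=
  ∑ d, if (p : ℕ) + off = q + Nat.ofBits d then a q d else 0

theorem sgn_mul_self (b : Bool) : sgn b * sgn b = 1 := by cases b <;> simp [sgn]

/-- The pairs of choices that lead to the same state are the pairs of particles `q` of `y` and `p` of
`x` such that `x` without `p` is `y` without `q` and the displacement takes `q` to `p`. -/
theorem block_sum {c : (Fin n → Bool) → Fin n → ℕ} (hc : Separates κ c) {off : ℕ}
    (hoff : n + off ≤ 2 ^ k) (hlk : n + 2 ^ l ≤ 2 ^ k)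
    (g : (Fin k → Bool) → (Fin l → Bool) → Fin m → Bool) (x y : Fin n → Bool) :
    (1 / 2) ^ (κ + l + m + 1) * ∑ t : Choice κ l m, ∑ t' : Choice κ l m,
        (if annihilate c off (RegState.ofChoice x t' : RegState n κ k l m) =
          forward c g (.ofChoice y t) then sgn t.2.2.2 * sgn t'.2.2.2 else 0) =
      (1 / 2) ^ (κ + l) * ∑ q, if y q = true ∧ c y q < 2 ^ κ then
        ∑ p, if x p = true ∧ c x p < 2 ^ κ then
          (if Function.update x p false = Function.update y q false then
            sgn (parityBefore x p) * sgn (parityBefore y q) *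
            (hopCoeff off (fun q d => 1 - 2 * (Nat.ofBits (g (bits k q) d) : ℝ) / 2 ^ m) p q : ℂ)
            else 0)
          else 0 else 0 := by
  have hn : n ≤ 2 ^ k := by omega
  have hfl2 : ∀ S : RegState n κ k l m, (forward c g S).flag2 =
      xor (annihilate c 0 S).flag2 (annihilate c 0 S).flag := fun S => rfl
  -- a choice that selects no particle of `y` ends with the second flag set
  have hy : ∀ (j : Fin κ → Bool), (∀ p, y p = true → c y p ≠ Nat.ofBits j) → ∀ d u ph t',
      ¬ annihilate c off (RegState.ofChoice x t' : RegState n κ k l m) =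
        forward c g (.start y j d u ph) := by
    intro j hj d u ph t' h
    have h1 := congrArg RegState.flag2 h
    rw [hfl2, annihilate_flag2, annihilate_flag2, annihilate_start_flag hj] at h1
    exact Bool.false_ne_true h1
  -- a choice that selects no particle of `x` ends with the first flag set
  have hx : ∀ (j' : Fin κ → Bool), (∀ p, x p = true → c x p ≠ Nat.ofBits j') →
      ∀ d' u' ph' {q}, y q = true → c y q < 2 ^ κ → ∀ d u ph,
      ¬ annihilate c off (.start x j' d' u' ph' : RegState n κ k l m) =
        forward c g (.start y (bits κ (c y q)) d u ph) := by
    intro j' hj' d' u' ph' q hq hcq d u ph h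
    have h1 := congrArg RegState.flag h
    rw [annihilate_start_flag hj', forward_start hc hn g hq (ofBits_bits hcq).symm] at h1
    exact Bool.false_ne_true h1.symm
  simp only [Fintype.sum_prod_type]
  rw [sum_codes hc y, pow_succ, pow_add _ _ m, mul_assoc, mul_assoc]
  · congr 1
    rw [Finset.mul_sum, Finset.mul_sum]
    refine Finset.sum_congr rfl fun q _ => ?_
    by_cases hq : y q = true ∧ c y q < 2 ^ κ
    swap
    · simp [hq]
    rw [if_pos hq, if_pos hq]
    have h1 : ∀ d u ph, (∑ j', ∑ d', ∑ u', ∑ ph',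
        if annihilate c off (.start x j' d' u' ph' : RegState n κ k l m) =
          forward c g (.start y (bits κ (c y q)) d u ph) then sgn ph * sgn ph' else 0) =
        ∑ p, if x p = true ∧ c x p < 2 ^ κ then
          (if Function.update x p false = Function.update y q false then
            if (p : ℕ) + off = q + Nat.ofBits d then
              sgn (parityBefore x p) * sgn (parityBefore y q) *
                sgn (carryVal (fun i => !(u i)) (g (bits k q) d) m) else 0 else 0) else 0 := by
      intro d u ph
      rw [sum_codes hc x]
      · refine Finset.sum_congr rfl fun p _ => ?_
        by_cases hp : x p = true ∧ c x p < 2 ^ κ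
        swap
        · simp [hp]
        rw [if_pos hp, if_pos hp]
        have hd := Nat.ofBits_lt_two_pow d
        simp only [annihilate_start hc hoff hp.1 (ofBits_bits hp.2).symm,
          forward_start hc hn g hq.1 (ofBits_bits hq.2).symm]
        have hb1 : (p : ℕ) + off < 2 ^ k := by have := p.2; omega
        have hb2 : (q : ℕ) + Nat.ofBits d < 2 ^ k := by have := q.2; omega
        simp only [removed_inj hb1 hb2]
        by_cases hxy : Function.update x p false = Function.update y q false
        swap
        · simp [hxy]
        by_cases hpq : (p : ℕ) + off = q + Nat.ofBits d
        swap
        · simp [hpq]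
        simp only [hxy, hpq, true_and, if_true]
        rw [Finset.sum_eq_single d, Finset.sum_eq_single u]
        · simp only [true_and]
          rw [Finset.sum_eq_single (xor (parityBefore x p) (xor (xor ph (parityBefore y q))
            (carryVal (fun i => !(u i)) (g (bits k q) d) m)))]
          · rw [if_pos]
            · simp only [sgn_xor]
              linear_combination (sgn (parityBefore x p) * sgn (parityBefore y q) *
                sgn (carryVal (fun i => !(u i)) (g (bits k q) d) m)) * sgn_mul_self ph
            · cases parityBefore x p <;> simp
          · rintro ph' - hne
            rw [if_neg]
            intro h
            apply hne
            rw [← h]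
            cases parityBefore x p <;> simp
          · simp
        · rintro u' - hne
          simp [hne]
        · simp
        · rintro d' - hne
          simp [hne]
        · simp
      · intro j' hj'
        refine Finset.sum_eq_zero fun d' _ => Finset.sum_eq_zero fun u' _ =>
          Finset.sum_eq_zero fun ph' _ => ?_
        rw [if_neg (hx j' hj' d' u' ph' hq.1 hq.2 d u ph)]
    simp only [h1, Finset.sum_const, Finset.card_univ, Fintype.card_bool, nsmul_eq_mul]
    have h5 : ∀ p q : Fin n,
        ((hopCoeff off (fun q d => 1 - 2 * (Nat.ofBits (g (bits k q) d) : ℝ) / 2 ^ m) p q : ℝ) : ℂ) =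
          ∑ d, if (p : ℕ) + off = q + Nat.ofBits d then
            1 - 2 * (Nat.ofBits (g (bits k q) d) : ℂ) / 2 ^ m else 0 := by
      intro p q
      simp only [hopCoeff, Complex.ofReal_sum]
      refine Finset.sum_congr rfl fun d _ => ?_
      split_ifs <;> simp
    simp only [Finset.mul_sum, h5]
    rw [Finset.sum_congr rfl fun d _ => Finset.sum_comm, Finset.sum_comm]
    refine Finset.sum_congr rfl fun p _ => ?_
    by_cases hp : x p = true ∧ c x p < 2 ^ κ
    swap
    · simp [hp]
    by_cases hxy : Function.update x p false = Function.update y q false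
    swap
    · simp [hxy]
    simp only [if_pos hp, if_pos hxy]
    refine Finset.sum_congr rfl fun d _ => ?_
    by_cases hpq : (p : ℕ) + off = q + Nat.ofBits d
    swap
    · simp [hpq]
    simp only [if_pos hpq, Nat.cast_ofNat, ← Finset.mul_sum]
    rw [sum_sgn_carryVal]
    have h2 : (1 / 2 : ℂ) ^ m * 2 ^ m = 1 := by rw [← mul_pow]; norm_num
    have h3 : (2 : ℂ) ^ m ≠ 0 := pow_ne_zero _ (by norm_num)
    field_simp
    linear_combination (sgn (parityBefore x p) * sgn (parityBefore y q) *
      (2 ^ m - 2 * (Nat.ofBits (g (bits k q) d) : ℂ))) * h2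
  · intro j hj
    refine Finset.sum_eq_zero fun d _ => Finset.sum_eq_zero fun u _ =>
      Finset.sum_eq_zero fun ph _ => Finset.sum_eq_zero fun j' _ =>
      Finset.sum_eq_zero fun d' _ => Finset.sum_eq_zero fun u' _ =>
      Finset.sum_eq_zero fun ph' _ => ?_
    exact if_neg (hy j hj d u ph (j', d', u', ph'))

/-- The matrix elements of `∑ h_{pq} a_p† a_q`: a particle of `y` is removed from `q`, a particle of `x`
is removed from `p`, and the remaining states are compared. -/
theorem oneBody_apply (h : Fin n → Fin n → ℝ) (x y : Fin n → Bool) : oneBody h x y =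
    ∑ q, if y q = true then ∑ p, if x p = true then
      (if Function.update x p false = Function.update y q false then
        sgn (parityBefore x p) * sgn (parityBefore y q) * (h p q : ℂ) else 0) else 0 else 0 := by
  have h1 : ∀ p q, ((annih p)ᴴ * annih q : Matrix (Fin n → Bool) (Fin n → Bool) ℂ) x y =
      if y q = true then if x p = true then
        if Function.update x p false = Function.update y q false then
          sgn (parityBefore x p) * sgn (parityBefore y q) else 0 else 0 else 0 := by
    intro p q
    rw [Matrix.mul_apply]
    by_cases hq : y q = true
    swap
    · simp [annih, hq]
    by_cases hp : x p = true
    swap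
    · simp [annih, Matrix.conjTranspose_apply, hp]
    rw [Finset.sum_eq_single (Function.update y q false)]
    · simp only [Matrix.conjTranspose_apply, annih, hp, hq, true_and, if_true,
        ← sgn_parityBefore, eq_comm (a := Function.update y q false)]
      split_ifs
      · congr 1
        cases parityBefore x p <;> simp [sgn]
      · simp
    · intro z _ hz
      simp [annih, hz]
    · simp
  rw [oneBody, Finset.sum_comm, Matrix.sum_apply]
  refine Finset.sum_congr rfl fun q _ => ?_
  simp only [Matrix.sum_apply, Matrix.smul_apply, h1, smul_eq_mul]
  split_ifs with hq
  · refine Finset.sum_congr rfl fun p _ => ?_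
    split_ifs <;> ring
  · simp

theorem particles_update {x : Fin n → Bool} {p : Fin n} (hp : x p = true) :
    particles (Function.update x p false) + 1 = particles x := by
  unfold particles
  rw [← Finset.card_erase_add_one (s := Finset.univ.filter fun k => x k = true) (a := p)
    (by simp [hp])]
  congr 2
  ext k
  by_cases hk : k = p
  · subst hk; simp
  · simp [hk]

/-- If the codes of all particles of the states with at most `N` particles fit into the register
`j`, the block is a multiple of a one-body Hamiltonian on these states. -/
theorem block_sum_eq_oneBody {c : (Fin n → Bool) → Fin n → ℕ} {N : ℕ}
    (hN : ∀ y p, particles y ≤ N → y p = true → c y p < 2 ^ κ) (a : Fin n → Fin n → ℝ)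
    {x y : Fin n → Bool} (hy : particles y ≤ N) :
    (∑ q, if y q = true ∧ c y q < 2 ^ κ then
        ∑ p, if x p = true ∧ c x p < 2 ^ κ then
          (if Function.update x p false = Function.update y q false then
            sgn (parityBefore x p) * sgn (parityBefore y q) * (a p q : ℂ) else 0)
          else 0 else 0) = oneBody a x y := by
  rw [oneBody_apply]
  refine Finset.sum_congr rfl fun q _ => ?_
  by_cases hq : y q = true
  swap
  · simp [hq]
  rw [if_pos ⟨hq, hN y q hy hq⟩, if_pos hq]
  refine Finset.sum_congr rfl fun p _ => ?_
  by_cases hp : x p = true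
  swap
  · simp [hp]
  by_cases hxy : Function.update x p false = Function.update y q false
  swap
  · simp [hxy]
  have hx : particles x ≤ N := by
    rw [← particles_update hp, hxy, particles_update hq]
    exact hy
  rw [if_pos ⟨hp, hN x p hx hp⟩, if_pos hp]

end Entries

/-! ### The lookup scheme -/

section Scheme

variable {n κ k l m o h : ℕ}

/-- The register of an address qubit, which is a qubit of the mode register or of the displacement. -/
def addrReg : Fin k ⊕ Fin l → Reg n κ k l m := Sum.elim .q .d

theorem addrReg_injective : Function.Injective (addrReg : Fin k ⊕ Fin l → Reg n κ k l m) := by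
  rintro (a | a) (b | b) h <;> simp [addrReg] at h <;> rw [h]

theorem addrReg_ne_word (a : Fin k ⊕ Fin l) (i : Fin m) :
    (addrReg a : Reg n κ k l m) ≠ .w i := by
  rcases a with a | a <;> simp [addrReg]

theorem lookupStep_eq_lookupAt (addr : Fin (o + h) → Fin k ⊕ Fin l)
    (word : (Fin (o + h) → Bool) → Fin m → Bool) (S : RegState n κ k l m) :
    lookupStep (fun a => .inl (addrReg (addr (Fin.natAdd o a))))
      (fun a => .inl (addrReg (addr (Fin.castAdd h a))))
      (fun vh vl => word (Fin.append (bits o vl) (bits h vh))) S =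
      lookupAt (fun q d => word fun a => Sum.elim q d (addr a)) S := by
  have hS : ∀ a, S.toFun (.inl (addrReg a)) = Sum.elim S.q S.d a := by
    rintro (a | a) <;> rfl
  simp only [lookupStep, lookupAt, bits_ofBits, hS]
  congr 1
  funext i
  congr 2
  funext a
  refine Fin.addCases (fun a => ?_) (fun a => ?_) a
  · rw [Fin.append_left]
  · rw [Fin.append_right]

theorem total_lookupAt {w : ℕ} (g : (Fin k → Bool) → (Fin l → Bool) → Fin m → Bool)
    (S : RegState n κ k l m) {b : Fin m → Bool} (hb : g S.q S.d = b) (a : Qubit n κ k l m w)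
    [Decidable (∃ j, (.inl (.inl (.w j)) : Qubit n κ k l m w) = a ∧ b j = true)] :
    (lookupAt g S).total w a = xor (S.total w a)
      (decide (∃ j, (.inl (.inl (.w j)) : Qubit n κ k l m w) = a ∧ b j = true)) := by
  subst hb
  rcases a with (a | a) | a
  · cases a
    all_goals simp [RegState.total, RegState.toFun, lookupAt]
  · simp [RegState.total]
  · simp [RegState.total, lookupAt]

/-- The block encoding of a table of coefficients: the circuit annihilates the particle selected by
`j`, adds the displacement `d` to its mode with the amplitude given by the table, and creates the
particle again by undoing an annihilation. -/
theorem exists_lookupScheme {ι : Type} {c : (Fin n → Bool) → Fin n → ℕ} (hc : Separates κ c)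
    {t t' off N : ℕ} (hfind : ∃ w, RegRealizes w t (findMode c : RegState n κ k l m → _))
    (hclear : ∃ w, RegRealizes w t' (clearCode c : RegState n κ k l m → _))
    (hoff : n + off ≤ 2 ^ k) (hlk : n + 2 ^ l ≤ 2 ^ k)
    (hN : ∀ y p, particles y ≤ N → y p = true → c y p < 2 ^ κ)
    (addr : Fin (o + h) ↪ Fin k ⊕ Fin l) {enc : ι → Fin (o + h) → Bool}
    (henc : Function.Injective enc) (round : ℝ → Fin m → Bool) :
    ∃ s : LookupScheme n ι, s.m = m ∧ ∀ r : ι → ℝ, ∃ look : Circuit (s.Anc ⊕ Fin n),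
      s.IsLookup look r ∧
      (∀ x y, particles y ≤ N → ancBlock (Circuit.mat (s.circuit look)) x y =
        (1 / 2) ^ (κ + l) * oneBody (hopCoeff off fun q d => 1 - 2 * (Nat.ofBits (round
          (Function.extend enc r 0 fun a => Sum.elim (bits k q) d (addr a))) : ℝ) / 2 ^ m) x y) ∧
      tCount (s.circuit look) ≤ 7 * (2 * (t + t' + n + 2 * 2 ^ (k + 1)) +
        2 * (2 * (2 ^ (h + 1) + 2 ^ (o + 1)) + 2 ^ o * m) + 6 * m + 12 * k) := by
  obtain ⟨w0, h0⟩ := annihilate_realizes (off := 0) hfind hclear (by omega)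
  obtain ⟨w1, h1⟩ := annihilate_realizes hfind hclear hoff
  obtain ⟨w2, h2⟩ := lookupStep_realizes (n := n) (κ := κ) (k := k) (l := l) (m := m)
    (fun a => .inl (addrReg (addr (Fin.natAdd o a))))
    (fun a => .inl (addrReg (addr (Fin.castAdd h a))))
    (fun a i e => addrReg_ne_word _ i (Sum.inl_injective e))
    (fun a i e => addrReg_ne_word _ i (Sum.inl_injective e))
  obtain ⟨w3, h3⟩ := compareStep_realizes (n := n) (κ := κ) (k := k) (l := l) (m := m)
  obtain ⟨w4, h4⟩ := displace_realizes (n := n) (κ := κ) (k := k) (l := l) (m := m)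
  let w := w0 + w1 + w2 + w3 + w4
  obtain ⟨c0, ht0, hc0⟩ := (h0.mono (w' := w) (by omega) le_rfl).exists_total
  obtain ⟨c1, ht1, hc1⟩ := (h1.mono (w' := w) (by omega) le_rfl).exists_total
  obtain ⟨c3, ht3, hc3⟩ := (h3.mono (w' := w) (by omega) le_rfl).exists_total
  obtain ⟨c4, ht4, hc4⟩ := (h4.mono (w' := w) (by omega) le_rfl).exists_total
  let R := superposed n κ k l m w
  let s : LookupScheme n ι :=
    { Anc := Reg n κ k l m ⊕ Fin w
      pre := hadamards R ++ phaseFlip ++ compile c0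
      mid := compile c3
      post := compile c4 ++ compile c1.reverse ++ phaseFlip ++ hadamards R
      k := o + h
      m := m
      addr := ⟨fun a => .inl (addrReg (addr a)), fun a b hab =>
        addr.injective (addrReg_injective (Sum.inl_injective hab))⟩
      word := ⟨fun i => .inl (.w i), fun a b hab => by simpa using hab⟩
      work := Finset.univ.map Function.Embedding.inr
      addr_ne_word := fun a i e => addrReg_ne_word _ i (Sum.inl_injective e)
      addr_not_work := fun a => by simp
      word_not_work := fun a => by simp
      enc := enc
      enc_injective := henc
      round := round }
  refine ⟨s, rfl, fun r => ?_⟩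
  let word : (Fin (o + h) → Bool) → Fin m → Bool := fun v => round (Function.extend enc r 0 v)
  let g : (Fin k → Bool) → (Fin l → Bool) → Fin m → Bool := fun q d =>
    word fun a => Sum.elim q d (addr a)
  obtain ⟨c2, ht2, hc2⟩ := ((h2 fun vh vl => word (Fin.append (bits o vl) (bits h vh))).mono
    (w' := w) (by omega) le_rfl).exists_total
  have hc2' : ∀ S : RegState n κ k l m, run c2 (S.total w) = (lookupAt g S).total w := by
    intro S
    rw [hc2, lookupStep_eq_lookupAt]
  refine ⟨compile c2, ?_, ?_, ?_⟩
  · intro i y hy hwork x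
    let S : RegState n κ k l m := .ofFun (Sum.elim (fun a => y (.inl (.inl a))) fun p => y (.inr p))
    have hyS : y = S.total w := by
      funext a
      rcases a with (a | a) | a
      · cases a <;> rfl
      · exact hwork (.inr a) (by simp [s])
      · rfl
    have hg : g S.q S.d = round (r i) := by
      have : (fun a => Sum.elim S.q S.d (addr a)) = enc i := by
        funext a
        refine Eq.trans ?_ (hy a)
        change _ = y (.inl (.inl (addrReg (addr a))))
        rcases addr a with b | b <;> rfl
      simp only [g, word, this, henc.extend_apply]
    have hx : s.xorWord (s.round (r i)) y = run c2 y := by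
      rw [hyS, hc2']
      funext a
      exact (total_lookupAt g S hg a).symm
    rw [hx]
    have := mat_compile c2
    exact congrFun (congrFun this x) y
  · intro x y hy
    have hcirc : s.circuit (compile c2) = hadamards R ++ (phaseFlip ++
        compile (c0 ++ c2 ++ c3 ++ c2 ++ c4 ++ c1.reverse) ++ phaseFlip) ++ hadamards R := by
      simp only [LookupScheme.circuit, s, compile_append, List.append_assoc]
    have hF : ∀ S : RegState n κ k l m,
        run (c0 ++ c2 ++ c3 ++ c2 ++ c4) (S.total w) = (forward c g S).total w := by
      intro S
      simp only [run_append, hc0, hc2', hc3, hc4]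
      rfl
    have hmain := ancBlock_eq_sum hF hc1 rfl x y
    rw [block_sum hc hoff hlk g x y, block_sum_eq_oneBody hN _ hy] at hmain
    rw [hcirc]
    exact hmain
  · have hH : tCount (hadamards R) = 0 := tCount_hadamards R
    have hP : tCount (phaseFlip : Circuit (Qubit n κ k l m w)) = 0 := rfl
    have e : tCount (s.circuit (compile c2)) = tCount (compile c0) + tCount (compile c2) +
        tCount (compile c3) + tCount (compile c2) +
        (tCount (compile c4) + tCount (compile c1.reverse)) := by
      simp only [LookupScheme.circuit, s, tCount_append, hH, hP]
      ring
    have e0 := tCount_compile c0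
    have e1 := tCount_compile c1.reverse
    have e2 := tCount_compile c2
    have e3 := tCount_compile c3
    have e4 := tCount_compile c4
    rw [toffoliCount_reverse] at e1
    rw [e]
    omega

end Scheme

/-! ### Norm estimates -/

/-- Schur's test: the spectral norm is at most a common bound of the absolute row and column sums. -/
theorem l2_opNorm_le_of_sum_le {α β : Type} [Fintype α] [DecidableEq α] [Fintype β] [DecidableEq β]
    (A : Matrix α β ℂ) {R : ℝ} (hR : 0 ≤ R) (hrow : ∀ x, ∑ y, ‖A x y‖ ≤ R)
    (hcol : ∀ y, ∑ x, ‖A x y‖ ≤ R) : ‖A‖ ≤ R := by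
  rw [Matrix.l2_opNorm_def]
  refine ContinuousLinearMap.opNorm_le_bound _ hR fun v => ?_
  rw [← abs_of_nonneg (norm_nonneg _), ← abs_of_nonneg (mul_nonneg hR (norm_nonneg v)),
    ← sq_le_sq, mul_pow, EuclideanSpace.norm_sq_eq, EuclideanSpace.norm_sq_eq]
  have h1 : ∀ x, ‖∑ y, A x y * v y‖ ^ 2 ≤ R * ∑ y, ‖A x y‖ * ‖v y‖ ^ 2 := by
    intro x
    have h2 : ‖∑ y, A x y * v y‖ ≤ ∑ y, ‖A x y‖ * ‖v y‖ :=
      (norm_sum_le _ _).trans_eq (Finset.sum_congr rfl fun y _ => norm_mul _ _)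
    have h3 := Finset.sum_mul_sq_le_sq_mul_sq Finset.univ (fun y => √‖A x y‖)
      fun y => √‖A x y‖ * ‖v y‖
    have h4 : ∀ y, √‖A x y‖ ^ 2 = ‖A x y‖ := fun y => Real.sq_sqrt (norm_nonneg _)
    have h5 : ∀ y, √‖A x y‖ * (√‖A x y‖ * ‖v y‖) = ‖A x y‖ * ‖v y‖ := fun y => by
      rw [← mul_assoc, ← sq, h4]
    simp only [h5, mul_pow, h4] at h3
    calc ‖∑ y, A x y * v y‖ ^ 2 ≤ (∑ y, ‖A x y‖ * ‖v y‖) ^ 2 := by gcongr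
      _ ≤ _ := h3
      _ ≤ _ := by
        gcongr
        exact hrow x
  calc ∑ x, ‖∑ y, A x y * v y‖ ^ 2 ≤ ∑ x, R * ∑ y, ‖A x y‖ * ‖v y‖ ^ 2 :=
        Finset.sum_le_sum fun x _ => h1 x
    _ = R * ∑ y, (∑ x, ‖A x y‖) * ‖v y‖ ^ 2 := by
      rw [← Finset.mul_sum, Finset.sum_comm]
      simp only [Finset.sum_mul]
    _ ≤ R * ∑ y, R * ‖v y‖ ^ 2 := by
      gcongr with y
      exact hcol y
    _ = R ^ 2 * ∑ y, ‖v y‖ ^ 2 := by rw [← Finset.mul_sum]; ring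

section OneBody

variable {n : ℕ}

/-- A bound for the matrix elements of a one-body Hamiltonian: each hop of a particle that takes
the state `y` to `x` contributes the absolute value of its coefficient. -/
def hopSum (δ : Fin n → Fin n → ℝ) (x y : Fin n → Bool) : ℝ :=
  ∑ q, ∑ p, if (x p = true ∧ y q = true) ∧
    Function.update x p false = Function.update y q false then |δ p q| else 0

theorem norm_oneBody_apply_le (δ : Fin n → Fin n → ℝ) (x y : Fin n → Bool) :
    ‖oneBody δ x y‖ ≤ hopSum δ x y := by
  rw [oneBody_apply]
  refine (norm_sum_le _ _).trans (Finset.sum_le_sum fun q _ => ?_)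
  by_cases hq : y q = true
  swap
  · simp [hq]
  rw [if_pos hq]
  refine (norm_sum_le _ _).trans (Finset.sum_le_sum fun p _ => ?_)
  have hs : ∀ b, ‖sgn b‖ = 1 := by intro b; cases b <;> simp [sgn]
  by_cases hp : x p = true
  swap
  · simp [hp]
  by_cases hxy : Function.update x p false = Function.update y q false
  · rw [if_pos hp, if_pos hxy, if_pos ⟨⟨hp, hq⟩, hxy⟩, norm_mul, norm_mul, hs, hs, one_mul, one_mul,
      Complex.norm_real, Real.norm_eq_abs]
  · simp [hxy]

theorem hopSum_comm (δ : Fin n → Fin n → ℝ) (x y : Fin n → Bool) :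
    hopSum δ x y = hopSum (fun p q => δ q p) y x := by
  rw [hopSum, Finset.sum_comm]
  refine Finset.sum_congr rfl fun p _ => Finset.sum_congr rfl fun q _ => ?_
  simp only [and_comm (a := x p = true), eq_comm (a := Function.update x p false)]

theorem particles_eq_of_hopSum_ne_zero {δ : Fin n → Fin n → ℝ} {x y : Fin n → Bool}
    (h : hopSum δ x y ≠ 0) : particles x = particles y := by
  obtain ⟨q, -, hq⟩ := Finset.exists_ne_zero_of_sum_ne_zero h
  obtain ⟨p, -, hp⟩ := Finset.exists_ne_zero_of_sum_ne_zero hq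
  rw [ne_eq, ite_eq_right_iff, not_forall] at hp
  obtain ⟨⟨⟨h1, h2⟩, h3⟩, -⟩ := hp
  rw [← particles_update h1, h3, particles_update h2]

theorem hopSum_nonneg (δ : Fin n → Fin n → ℝ) (x y : Fin n → Bool) : 0 ≤ hopSum δ x y :=
  Finset.sum_nonneg fun q _ => Finset.sum_nonneg fun p _ => by split_ifs <;> positivity

theorem sum_hopSum_le {δ : Fin n → Fin n → ℝ} {R : ℝ} (hcol : ∀ q, ∑ p, |δ p q| ≤ R)
    (y : Fin n → Bool) : ∑ x, hopSum δ x y ≤ particles y * R := by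
  have h1 : ∀ p q, (∑ x : Fin n → Bool, if (x p = true ∧ y q = true) ∧
      Function.update x p false = Function.update y q false then |δ p q| else 0) ≤
      if y q = true then |δ p q| else 0 := by
    intro p q
    by_cases hq : y q = true
    swap
    · simp [hq]
    rw [if_pos hq, Finset.sum_eq_single (Function.update (Function.update y q false) p true)]
    · split_ifs
      · exact le_rfl
      · positivity
    · rintro x - hne
      rw [if_neg]
      rintro ⟨⟨hp, -⟩, hx⟩
      apply hne
      rw [← hx]
      funext a
      by_cases ha : a = p
      · subst ha; simp [hp]
      · simp [ha]
    · simp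
  calc ∑ x, hopSum δ x y = ∑ q, ∑ p, ∑ x : Fin n → Bool, if (x p = true ∧ y q = true) ∧
      Function.update x p false = Function.update y q false then |δ p q| else 0 := by
        simp only [hopSum]
        rw [Finset.sum_comm]
        exact Finset.sum_congr rfl fun q _ => Finset.sum_comm
    _ ≤ ∑ q, ∑ p, if y q = true then |δ p q| else 0 :=
      Finset.sum_le_sum fun q _ => Finset.sum_le_sum fun p _ => h1 p q
    _ ≤ ∑ q, if y q = true then R else 0 := by
      refine Finset.sum_le_sum fun q _ => ?_
      split_ifs
      · exact hcol q
      · simp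
    _ = particles y * R := by
      rw [← Finset.sum_filter, Finset.sum_const, nsmul_eq_mul, particles]

/-- On states with at most `N` particles, a one-body Hamiltonian is bounded by `N` times the row
and column sums of its coefficients. -/
theorem norm_oneBody_submatrix_le {β : Type} [Fintype β] [DecidableEq β] {f : β → Fin n → Bool}
    (hf : Function.Injective f) {N : ℕ} (hN : ∀ b, particles (f b) ≤ N)
    {δ : Fin n → Fin n → ℝ} {R : ℝ} (hR : 0 ≤ R) (hrow : ∀ p, ∑ q, |δ p q| ≤ R)
    (hcol : ∀ q, ∑ p, |δ p q| ≤ R) : ‖(oneBody δ).submatrix id f‖ ≤ N * R := by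
  refine l2_opNorm_le_of_sum_le _ (by positivity) (fun x => ?_) fun b => ?_
  · simp only [Matrix.submatrix_apply, id]
    refine (Finset.sum_le_sum fun b _ => norm_oneBody_apply_le δ x (f b)).trans ?_
    by_cases hx : particles x ≤ N
    · calc ∑ b, hopSum δ x (f b) = ∑ y ∈ Finset.univ.map ⟨f, hf⟩, hopSum δ x y := by
            rw [Finset.sum_map]; rfl
        _ ≤ ∑ y, hopSum δ x y := Finset.sum_le_sum_of_subset_of_nonneg (Finset.subset_univ _)
          fun y _ _ => hopSum_nonneg _ _ _
        _ ≤ particles x * R := by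
          simp only [hopSum_comm δ x]
          exact sum_hopSum_le hrow x
        _ ≤ N * R := by gcongr
    · rw [Finset.sum_eq_zero]
      · positivity
      · intro b _
        by_contra h
        exact hx ((particles_eq_of_hopSum_ne_zero h).trans_le (hN b))
  · simp only [Matrix.submatrix_apply, id]
    refine (Finset.sum_le_sum fun x _ => norm_oneBody_apply_le δ x (f b)).trans ?_
    refine (sum_hopSum_le hcol (f b)).trans ?_
    gcongr
    exact hN b

theorem oneBody_sub (a b : Fin n → Fin n → ℝ) :
    oneBody (fun p q => a p q - b p q) = oneBody a - oneBody b := by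
  simp only [oneBody, Complex.ofReal_sub, sub_smul, Finset.sum_sub_distrib]

theorem oneBody_mul (α : ℝ) (a : Fin n → Fin n → ℝ) :
    oneBody (fun p q => α * a p q) = (α : ℂ) • oneBody a := by
  simp only [oneBody, Complex.ofReal_mul, mul_smul, Finset.smul_sum]

end OneBody

/-! ### Rounding -/

section Rounding

variable {m : ℕ}

/-- The word `b` whose amplitude `1 - 2 b / 2 ^ m` approximates `r / B`. The minimum matters for
`r = -B`, for which `b = 2 ^ m` does not fit into `m` bits. -/
def roundWord (B : ℝ) (m : ℕ) (r : ℝ) : Fin m → Bool :=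
  bits m (min ⌊(1 - r / B) / 2 * 2 ^ m⌋₊ (2 ^ m - 1))

theorem abs_sub_roundWord_le {B r : ℝ} (hB : 0 < B) (hr : |r| ≤ B) :
    |r - B * (1 - 2 * (Nat.ofBits (roundWord B m r) : ℝ) / 2 ^ m)| ≤ 2 * B / 2 ^ m := by
  have h2 : (0 : ℝ) < 2 ^ m := by positivity
  have h2' : 1 ≤ 2 ^ m := Nat.one_le_two_pow
  set z : ℝ := (1 - r / B) / 2 * 2 ^ m with hz
  have hrB : |r / B| ≤ 1 := by
    rw [abs_div, abs_of_pos hB]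
    exact (div_le_one hB).2 hr
  rw [abs_le] at hrB
  have hz0 : 0 ≤ z := by
    have : 0 ≤ 1 - r / B := by linarith [hrB.2]
    positivity
  have hz1 : z ≤ 2 ^ m := by
    have : (1 - r / B) / 2 ≤ 1 := by linarith [hrB.1]
    nlinarith
  rw [roundWord, ofBits_bits (by omega)]
  set v := min ⌊z⌋₊ (2 ^ m - 1) with hv
  have hvz : |(v : ℝ) - z| ≤ 1 := by
    have h3 := Nat.floor_le hz0
    have h4 := Nat.lt_floor_add_one z
    have h5 : ((2 ^ m - 1 : ℕ) : ℝ) = 2 ^ m - 1 := by push_cast [h2']; ring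
    rw [hv, Nat.cast_min, h5, abs_le]
    constructor
    · have : z - 1 ≤ min (⌊z⌋₊ : ℝ) (2 ^ m - 1) := le_min (by linarith) (by linarith)
      linarith
    · have := min_le_left (⌊z⌋₊ : ℝ) (2 ^ m - 1)
      linarith
  have h6 : r - B * (1 - 2 * (v : ℝ) / 2 ^ m) = 2 * B / 2 ^ m * ((v : ℝ) - z) := by
    rw [hz]
    field_simp
    ring
  rw [h6, abs_mul, abs_of_pos (by positivity)]
  exact mul_le_of_le_one_right (by positivity) hvz

end Rounding

/-! ### Block encodings from codes -/

section HopCoeff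

variable {n l : ℕ}

theorem hopCoeff_eq {off : ℕ} (a : ℕ → (Fin l → Bool) → ℝ) {p q : Fin n} {v : ℕ} (hv : v < 2 ^ l)
    (h : (p : ℕ) + off = q + v) : hopCoeff off a p q = a q (bits l v) := by
  rw [hopCoeff, Finset.sum_eq_single (bits l v)]
  · rw [if_pos]
    rw [ofBits_bits hv, h]
  · rintro d - hd
    rw [if_neg]
    intro h'
    apply hd
    rw [show v = Nat.ofBits d by omega, bits_ofBits]
  · simp

theorem hopCoeff_eq_zero {off : ℕ} {a : ℕ → (Fin l → Bool) → ℝ} {p q : Fin n}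
    (h : ∀ d, (p : ℕ) + off = q + Nat.ofBits d → a q d = 0) : hopCoeff off a p q = 0 :=
  Finset.sum_eq_zero fun d _ => by
    split_ifs with hd
    · exact h d hd
    · rfl

theorem abs_hopCoeff_le {off : ℕ} {a : ℕ → (Fin l → Bool) → ℝ} {e : ℝ}
    (ha : ∀ q d, |a q d| ≤ e) (p q : Fin n) :
    |hopCoeff off a p q| ≤ ∑ d : Fin l → Bool, if (p : ℕ) + off = q + Nat.ofBits d then e else 0 :=
  (Finset.abs_sum_le_sum_abs _ _).trans (Finset.sum_le_sum fun d _ => by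
    split_ifs
    · exact ha q d
    · simp)

theorem sum_ite_le_of_unique {e : ℝ} (he : 0 ≤ e) {P : Fin n → Prop} [DecidablePred P]
    (hP : ∀ a b, P a → P b → a = b) : (∑ a, if P a then e else 0) ≤ e := by
  by_cases h : ∃ a, P a
  · obtain ⟨a, ha⟩ := h
    rw [Finset.sum_eq_single a (fun b _ hb => if_neg fun hb' => hb (hP _ _ hb' ha)) (by simp),
      if_pos ha]
  · push Not at h
    simpa [h] using he

theorem sum_abs_hopCoeff_le_row {off : ℕ} {a : ℕ → (Fin l → Bool) → ℝ} {e : ℝ} (he : 0 ≤ e)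
    (ha : ∀ q d, |a q d| ≤ e) (p : Fin n) : ∑ q, |hopCoeff off a p q| ≤ 2 ^ l * e := by
  refine (Finset.sum_le_sum fun q _ => abs_hopCoeff_le ha p q).trans ?_
  rw [Finset.sum_comm]
  refine (Finset.sum_le_sum fun d _ => sum_ite_le_of_unique he fun q q' h h' => ?_).trans ?_
  · exact Fin.ext (by omega)
  · simp

theorem sum_abs_hopCoeff_le_col {off : ℕ} {a : ℕ → (Fin l → Bool) → ℝ} {e : ℝ} (he : 0 ≤ e)
    (ha : ∀ q d, |a q d| ≤ e) (q : Fin n) : ∑ p, |hopCoeff off a p q| ≤ 2 ^ l * e := by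
  refine (Finset.sum_le_sum fun p _ => abs_hopCoeff_le ha p q).trans ?_
  rw [Finset.sum_comm]
  refine (Finset.sum_le_sum fun d _ => sum_ite_le_of_unique he fun p p' h h' => ?_).trans ?_
  · exact Fin.ext (by omega)
  · simp

end HopCoeff

/-- A code for the particles of the states with at most `N` particles on `n` modes: it uses at most
`1 + log₂ N` bits, and a particle can be found from its code and the code cleared afterwards with
`τ` Toffoli gates. -/
def HasCode (n N τ : ℕ) : Prop :=
  ∃ (κ : ℕ) (c : (Fin n → Bool) → Fin n → ℕ) (t t' : ℕ), Separates κ c ∧ 2 ^ κ ≤ 2 * N ∧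
    (∀ y p, particles y ≤ N → y p = true → c y p < 2 ^ κ) ∧ t + t' ≤ τ ∧ ∀ k l m,
    (∃ w, RegRealizes w t (findMode c : RegState n κ k l m → _)) ∧
    (∃ w, RegRealizes w t' (clearCode c : RegState n κ k l m → _))

theorem two_pow_clog_le {a : ℕ} (ha : 1 ≤ a) : 2 ^ Nat.clog 2 a ≤ 2 * a := by
  rcases ha.eq_or_lt with rfl | h
  · simp
  · have h1 := Nat.pow_pred_clog_lt_self (b := 2) (by norm_num) h
    have h2 : 0 < Nat.clog 2 a := Nat.clog_pos (by norm_num) h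
    obtain ⟨e, he⟩ := Nat.exists_eq_succ_of_ne_zero h2.ne'
    rw [he] at h1 ⊢
    simp only [Nat.pred_succ] at h1
    rw [pow_succ]
    omega

/-- The modes are a code for all states. -/
theorem hasCode_binary {n : ℕ} (hn : 1 ≤ n) : HasCode n n (9 * n) := by
  have h1 : n ≤ 2 ^ Nat.clog 2 n := Nat.le_pow_clog (by norm_num) n
  have h2 := two_pow_clog_le hn
  refine ⟨Nat.clog 2 n, fun _ p => p, 2 * 2 ^ (Nat.clog 2 n + 1) + n, 0, separates_binary _, h2,
    fun y p _ _ => p.2.trans_le h1, ?_, fun k l m => ⟨findMode_binary h1, _, clearCode_binary⟩⟩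
  rw [pow_succ]
  omega

/-- The numbers of the particles in the order of their modes are a code for the states with at most
`N` particles. -/
theorem hasCode_count {n N : ℕ} (hN : 1 ≤ N) :
    HasCode n N (10 * (n * (Nat.clog 2 N + 1))) := by
  have h1 : N ≤ 2 ^ Nat.clog 2 N := Nat.le_pow_clog (by norm_num) N
  refine ⟨Nat.clog 2 N, fun y p => count (Nat.clog 2 N) y p, 7 * (n * (Nat.clog 2 N + 1)),
    3 * (n * (Nat.clog 2 N + 1)), separates_count _, two_pow_clog_le hN, fun y p hy hp => ?_,
    by omega, fun k l m => ⟨findMode_count, clearCode_count⟩⟩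
  have h2 := rank_lt_particles y hp
  exact (min_le_left _ _).trans_lt (by omega)

/-- The factor in the bound `m ≤ wordConst B * (1 + log (X / ε))` for the word length. -/
def wordConst (B : ℝ) : ℝ := (1 + Real.log (24 * B + 2)) / Real.log 2

/-- A word length for which the rounding errors of the coefficients, `2 * B / 2 ^ m` each, add up to
at most `ε`: the Hamiltonian acts on `N` particles, each with at most `6 * M` hops, and `Y = N * M`. -/
theorem exists_wordLength {B X Y ε : ℝ} (hB : 0 < B) (hX : 1 ≤ X) (hYX : Y ≤ X) (hε : 0 < ε)
    (hε1 : ε < 1) : ∃ m : ℕ, 12 * B * Y / 2 ^ m ≤ ε ∧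
      (m : ℝ) ≤ wordConst B * (1 + Real.log (X / ε)) := by
  set z := 12 * B * X / ε with hz
  have hz0 : 0 < z := by positivity
  refine ⟨Nat.clog 2 ⌈z⌉₊, ?_, ?_⟩
  · have h1 : (⌈z⌉₊ : ℝ) ≤ 2 ^ Nat.clog 2 ⌈z⌉₊ := by
      exact_mod_cast Nat.le_pow_clog (by norm_num) ⌈z⌉₊
    have h2 : z ≤ 2 ^ Nat.clog 2 ⌈z⌉₊ := (Nat.le_ceil z).trans h1
    rw [hz, div_le_iff₀ hε] at h2
    rw [div_le_iff₀ (by positivity), mul_comm ε]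
    exact le_trans (by gcongr) h2
  · have h1 : (2 : ℝ) ^ Nat.clog 2 ⌈z⌉₊ ≤ 2 * ⌈z⌉₊ := by
      exact_mod_cast two_pow_clog_le (Nat.one_le_ceil_iff.2 hz0)
    have h2 := Nat.ceil_lt_add_one hz0.le
    have hXε : 1 ≤ X / ε := by
      rw [one_le_div hε]
      linarith
    have h3 : (2 : ℝ) ^ Nat.clog 2 ⌈z⌉₊ ≤ (24 * B + 2) * (X / ε) := by
      have : z = 12 * B * (X / ε) := by rw [hz]; ring
      nlinarith
    have h4 := Real.log_le_log (by positivity) h3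
    rw [Real.log_pow, Real.log_mul (by positivity) (by positivity)] at h4
    have h5 : 0 ≤ Real.log (24 * B + 2) := Real.log_nonneg (by linarith)
    have h6 : 0 ≤ Real.log (X / ε) := Real.log_nonneg hXε
    rw [wordConst, div_mul_eq_mul_div, le_div_iff₀ (Real.log_pos one_lt_two)]
    nlinarith [mul_nonneg h5 h6]

/-- The number of qubits of the mode register. It has room for the sums of a mode with a displacement of
`hopBits n` bits. -/
def modeBits (n : ℕ) : ℕ := Nat.clog 2 (7 * n)

/-- The number of qubits of the displacement register for displacements of at most `M` modes. -/
def hopBits (M : ℕ) : ℕ := Nat.clog 2 (2 * M + 1)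

theorem le_two_pow_modeBits (n : ℕ) : 7 * n ≤ 2 ^ modeBits n := Nat.le_pow_clog (by norm_num) _

theorem two_pow_modeBits_le {n : ℕ} (hn : 1 ≤ n) : 2 ^ modeBits n ≤ 14 * n :=
  (two_pow_clog_le (by omega)).trans (by omega)

theorem lt_two_pow_hopBits (M : ℕ) : 2 * M < 2 ^ hopBits M :=
  Nat.lt_of_succ_le (Nat.le_pow_clog (by norm_num) _)

theorem two_pow_hopBits_le {M : ℕ} (hM : 1 ≤ M) : 2 ^ hopBits M ≤ 6 * M :=
  (two_pow_clog_le (by omega)).trans (by omega)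

/-- The block encoding with all parameters but the layout of the table fixed; `f` is the inclusion
of the states on which the Hamiltonian is encoded. -/
theorem exists_blockEncoding {ι β : Type} [Fintype β] [DecidableEq β] {n N τ M lam o h : ℕ}
    (hcode : HasCode n N τ) (hN : 1 ≤ N) (hM : 1 ≤ M) (hMn : M ≤ n) {B X ε : ℝ} (hB : 0 < B)
    (hX : (N * M : ℝ) ≤ X) (hε : 0 < ε) (hε1 : ε < 1) (hlam : 1 ≤ lam) (ho : 2 ^ o ≤ lam)
    (addr : Fin (o + h) ↪ Fin (modeBits n) ⊕ Fin (hopBits M)) {enc : ι → Fin (o + h) → Bool}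
    (henc : Function.Injective enc) {f : β → Fin n → Bool} (hf : Function.Injective f)
    (hfN : ∀ b, particles (f b) ≤ N) :
    ∃ (s : LookupScheme n ι) (α : ℝ), 0 < α ∧ α ≤ 12 * B * (N * M) ∧
      (s.m : ℝ) ≤ wordConst B * (1 + Real.log (X / ε)) ∧
      ∀ (r : ι → ℝ) (H : Fin n → Fin n → ℝ), (∀ i, |r i| ≤ B) →
        (∀ p q, H p q = hopCoeff M (fun q d => Function.extend enc r 0 fun a =>
          Sum.elim (bits (modeBits n) q) d (addr a)) p q) →
        ∃ look : Circuit (s.Anc ⊕ Fin n), s.IsLookup look r ∧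
          ‖(oneBody H - (α : ℂ) • ancBlock (Circuit.mat (s.circuit look))).submatrix id f‖ ≤ ε ∧
          (tCount (s.circuit look) : ℝ) ≤ 14 * τ + 1974 * n + 56 * 2 ^ h +
            112 * (lam * (1 + wordConst B * (1 + Real.log (X / ε)))) := by
  obtain ⟨κ, c, t, t', hsep, hκ, hcN, hτ, hreal⟩ := hcode
  have hNM : (1 : ℝ) ≤ N * M := by
    exact_mod_cast Nat.one_le_iff_ne_zero.2 (Nat.mul_ne_zero (by omega) (by omega))
  obtain ⟨m, hm, hmle⟩ := exists_wordLength hB (hNM.trans hX) hX hε hε1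
  have hk := le_two_pow_modeBits n
  have hk' := two_pow_modeBits_le (hM.trans hMn)
  have hl := two_pow_hopBits_le hM
  obtain ⟨s, hsm, hs⟩ := exists_lookupScheme (n := n) (κ := κ) (k := modeBits n) (l := hopBits M) (m := m) hsep
    (off := M) (hreal _ _ m).1 (hreal _ _ m).2 (by omega) (by omega) hcN addr henc
    (roundWord B m)
  -- the amplitudes of `j` and `d`, on both sides, give the factor `2 ^ (-(κ + hopBits M))`
  refine ⟨s, B * 2 ^ (κ + hopBits M), by positivity, ?_, hsm ▸ hmle, fun r H hr hH => ?_⟩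
  · have h1 : (2 : ℝ) ^ κ ≤ 2 * N := by exact_mod_cast hκ
    have h2 : (2 : ℝ) ^ hopBits M ≤ 6 * M := by exact_mod_cast hl
    calc B * 2 ^ (κ + hopBits M) = B * (2 ^ κ * 2 ^ hopBits M) := by rw [pow_add]
      _ ≤ B * (2 * N * (6 * M)) := by gcongr
      _ = _ := by ring
  obtain ⟨look, hlook, hblock, hT⟩ := hs r
  refine ⟨look, hlook, ?_, ?_⟩
  · set a : ℕ → (Fin (hopBits M) → Bool) → ℝ := fun q d => Function.extend enc r 0 fun a =>
      Sum.elim (bits (modeBits n) q) d (addr a) with ha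
    have haB : ∀ q d, |a q d| ≤ B := by
      intro q d
      simp only [ha]
      by_cases hex : ∃ i, enc i = fun a => Sum.elim (bits (modeBits n) q) d (addr a)
      · obtain ⟨i, hi⟩ := hex
        rw [← hi, henc.extend_apply]
        exact hr i
      · rw [Function.extend_apply' _ _ _ hex]
        simpa using hB.le
    set e : ℝ := 2 * B / 2 ^ m with he
    have he0 : 0 ≤ e := by positivity
    set δ : ℕ → (Fin (hopBits M) → Bool) → ℝ := fun q d =>
      a q d - B * (1 - 2 * (Nat.ofBits (roundWord B m (a q d)) : ℝ) / 2 ^ m) with hδ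
    have hδe : ∀ q d, |δ q d| ≤ e := fun q d => abs_sub_roundWord_le hB (haB q d)
    have hsub : (oneBody H - ((B * 2 ^ (κ + hopBits M) : ℝ) : ℂ) •
        ancBlock (Circuit.mat (s.circuit look))).submatrix id f =
        (oneBody (hopCoeff M δ)).submatrix id f := by
      ext x b
      simp only [Matrix.submatrix_apply, Matrix.sub_apply, Matrix.smul_apply, id, smul_eq_mul]
      rw [hblock x (f b) (hfN b)]
      have h1 : (hopCoeff M δ : Fin n → Fin n → ℝ) = fun p q => H p q - B * hopCoeff M (fun q d =>
          1 - 2 * (Nat.ofBits (roundWord B m (a q d)) : ℝ) / 2 ^ m) p q := by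
        funext p q
        rw [hH, hopCoeff, hopCoeff, hopCoeff, Finset.mul_sum, ← Finset.sum_sub_distrib]
        refine Finset.sum_congr rfl fun d _ => ?_
        split_ifs
        · rfl
        · simp
      rw [h1, oneBody_sub, oneBody_mul, Matrix.sub_apply, Matrix.smul_apply, smul_eq_mul]
      have h2 : (2 : ℂ) ^ (κ + hopBits M) * (1 / 2) ^ (κ + hopBits M) = 1 := by rw [← mul_pow]; norm_num
      push_cast
      linear_combination (-(B : ℂ) * oneBody (hopCoeff M fun q (d : Fin (hopBits M) → Bool) =>
        1 - 2 * (Nat.ofBits (roundWord B m (a q d)) : ℝ) / 2 ^ m) x (f b)) * h2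
    rw [hsub]
    refine (norm_oneBody_submatrix_le hf hfN (R := 2 ^ hopBits M * e) (by positivity)
      (sum_abs_hopCoeff_le_row he0 hδe) (sum_abs_hopCoeff_le_col he0 hδe)).trans ?_
    refine le_trans ?_ hm
    have h2 : (2 : ℝ) ^ hopBits M ≤ 6 * M := by exact_mod_cast hl
    calc (N : ℝ) * (2 ^ hopBits M * e) ≤ N * (6 * M * e) := by gcongr
      _ = 12 * B * (N * M) / 2 ^ m := by rw [he]; ring
  · have h1 : modeBits n ≤ 2 ^ modeBits n := Nat.lt_two_pow_self.le
    have h2 : 2 ^ o * m ≤ lam * m := Nat.mul_le_mul_right _ ho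
    have h3 : m ≤ lam * m := Nat.le_mul_of_pos_left _ hlam
    have h4 : tCount (s.circuit look) ≤
        14 * τ + 1974 * n + 56 * 2 ^ h + 112 * (lam + lam * m) := by
      refine hT.trans ?_
      rw [pow_succ, pow_succ, pow_succ]
      omega
    have h5 : (tCount (s.circuit look) : ℝ) ≤
        14 * τ + 1974 * n + 56 * 2 ^ h + 112 * (lam + lam * m) := by exact_mod_cast h4
    refine h5.trans ?_
    have : (lam : ℝ) * m ≤ lam * (wordConst B * (1 + Real.log (X / ε))) := by gcongr
    linarith

/-! ### Layouts of the table -/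

section Layout

variable {n N τ M lam : ℕ} {B X ε : ℝ}

/-- The largest power of two below `lam` splits an address of `K` bits into a part that is looked up
with few and a part that is looked up with many word operations. -/
theorem exists_addressSplit (K : ℕ) (hlam : 1 ≤ lam) : ∃ o h, o + h = K ∧ 2 ^ o ≤ lam ∧
    (2 ^ h : ℝ) ≤ 2 * 2 ^ K / lam + 1 := by
  rcases le_total (Nat.log 2 lam) K with hle | hle
  · obtain ⟨h, hh⟩ := Nat.exists_eq_add_of_le hle
    refine ⟨Nat.log 2 lam, h, hh.symm, Nat.pow_log_le_self 2 (by omega), ?_⟩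
    have h1 : (lam : ℝ) ≤ 2 * 2 ^ Nat.log 2 lam := by
      have := Nat.lt_pow_succ_log_self (b := 2) (by norm_num) lam
      rw [pow_succ] at this
      exact_mod_cast (this.le.trans (by omega))
    have h2 : (0 : ℝ) < lam := by exact_mod_cast hlam
    have h3 : (2 ^ h : ℝ) ≤ 2 * 2 ^ K / lam := by
      rw [le_div_iff₀ h2, hh, pow_add]
      nlinarith [show (0 : ℝ) < 2 ^ h by positivity]
    linarith
  · refine ⟨K, 0, rfl, ?_, ?_⟩
    · exact (Nat.pow_le_pow_right (by norm_num) hle).trans (Nat.pow_log_le_self 2 (by omega))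
    · have : (0 : ℝ) ≤ 2 * 2 ^ K / lam := by positivity
      simpa using this

theorem sum_elim_injective {α β : Type} {q q' : α → Bool} {d d' : β → Bool}
    (h : Sum.elim q d = Sum.elim q' d') : q = q' ∧ d = d' :=
  ⟨funext fun a => congrFun h (.inl a), funext fun a => congrFun h (.inr a)⟩

/-- The displacement of a pair of modes in the band, offset by `M`. -/
theorem exists_hop {n M : ℕ} {p q : Fin n} (h : |(p : ℤ) - (q : ℤ)| ≤ (M : ℤ)) :
    ∃ v, v < 2 ^ hopBits (min M n) ∧ (p : ℕ) + min M n = q + v := by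
  have h1 := lt_two_pow_hopBits (min M n)
  rw [abs_le] at h
  have := p.2
  have := q.2
  exact ⟨p + min M n - q, by omega, by omega⟩

/-- The table of all coefficients in the band, addressed by the mode and the displacement. -/
theorem exists_banded {β : Type} [Fintype β] [DecidableEq β] (hcode : HasCode n N τ) (hN : 1 ≤ N)
    (hn : 1 ≤ n) (hM : 1 ≤ M) (hB : 0 < B) (hε : 0 < ε) (hε1 : ε < 1)
    (hlam : 1 ≤ lam) {f : β → Fin n → Bool} (hf : Function.Injective f)
    (hfN : ∀ b, particles (f b) ≤ N) :
    ∃ (s : LookupScheme n (Band n M)) (α : ℝ), 0 < α ∧ α ≤ 12 * B * (N * M) ∧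
      (s.m : ℝ) ≤ wordConst B * (1 + Real.log (N * M / ε)) ∧
      ∀ h : Fin n → Fin n → ℝ,
        (∀ p q : Fin n, |(p : ℤ) - (q : ℤ)| ≤ (M : ℤ) → |h p q| ≤ B) →
        ∃ look : Circuit (s.Anc ⊕ Fin n), s.IsLookup look (fun i => h i.1.1 i.1.2) ∧
          ‖(oneBody (truncate M h) - (α : ℂ) •
            ancBlock (Circuit.mat (s.circuit look))).submatrix id f‖ ≤ ε ∧
          (tCount (s.circuit look) : ℝ) ≤ 14 * τ + 2400 * n +
            9408 * (n * M / lam) + 112 * (lam * (1 + wordConst B * (1 + Real.log (N * M / ε)))) := by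
  have hMn : min M n ≤ n := min_le_right _ _
  have hM1 : 1 ≤ min M n := le_min hM hn
  have hM' : ((min M n : ℕ) : ℝ) ≤ M := by exact_mod_cast min_le_left M n
  obtain ⟨o, w, how, ho, hw⟩ := exists_addressSplit (modeBits n + hopBits (min M n)) hlam
  let e : Fin (o + w) ≃ Fin (modeBits n) ⊕ Fin (hopBits (min M n)) :=
    (finCongr how).trans finSumFinEquiv.symm
  choose v hv hpv using fun i : Band n M => exists_hop i.2
  let enc : Band n M → Fin (o + w) → Bool := fun i a =>
    Sum.elim (bits (modeBits n) i.1.2) (bits (hopBits (min M n)) (v i)) (e a)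
  have hmode : ∀ q : Fin n, (q : ℕ) < 2 ^ modeBits n := fun q => by
    have := q.2
    have := le_two_pow_modeBits n
    omega
  have henc' : ∀ (i : Band n M) (q : Fin n) (d : Fin (hopBits (min M n)) → Bool),
      (enc i = fun a => Sum.elim (bits (modeBits n) q) d (e a)) →
      i.1.2 = q ∧ v i = Nat.ofBits d := by
    intro i q d h
    have h1 := e.surjective.injective_comp_right h
    obtain ⟨h2, h3⟩ := sum_elim_injective h1
    exact ⟨Fin.ext (bits_inj (hmode _) (hmode _) h2), by rw [← h3, ofBits_bits (hv i)]⟩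
  have henc : Function.Injective enc := by
    intro i i' h
    obtain ⟨h1, h2⟩ := henc' i i'.1.2 (bits _ (v i')) h
    rw [ofBits_bits (hv i')] at h2
    have h3 := hpv i
    have h4 := hpv i'
    rw [h1, h2] at h3
    exact Subtype.ext (Prod.ext (Fin.ext (by omega)) h1)
  obtain ⟨s, α, hα, hα', hm, hs⟩ := exists_blockEncoding hcode hN hM1 hMn (X := N * M) hB
    (by gcongr) hε hε1 hlam ho e.toEmbedding henc hf hfN
  refine ⟨s, α, hα, hα'.trans (by gcongr), hm, fun h hh => ?_⟩
  have hH : ∀ p q : Fin n, truncate M h p q = hopCoeff (min M n) (fun q d =>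
      Function.extend enc (fun i => h i.1.1 i.1.2) 0 fun a =>
        Sum.elim (bits (modeBits n) q) d (e a)) p q := by
    intro p q
    by_cases hpq : |(p : ℤ) - (q : ℤ)| ≤ (M : ℤ)
    · rw [hopCoeff_eq _ (hv ⟨(p, q), hpq⟩) (hpv ⟨(p, q), hpq⟩)]
      refine Eq.trans ?_ (henc.extend_apply _ _ ⟨(p, q), hpq⟩).symm
      rw [truncate, if_pos hpq]
    · rw [hopCoeff_eq_zero, truncate, if_neg hpq]
      intro d hd
      refine Function.extend_apply' _ _ _ ?_
      rintro ⟨i, hi⟩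
      obtain ⟨h1, h2⟩ := henc' i q d hi
      have h3 := hpv i
      rw [h1, h2, ← hd] at h3
      have h4 : i.1.1 = p := Fin.ext (by omega)
      have h5 := i.2
      rw [h1, h4] at h5
      exact hpq h5
  obtain ⟨look, hlook, hblock, hT⟩ := hs (fun i => h i.1.1 i.1.2) (truncate M h)
    (fun i => hh _ _ i.2) hH
  refine ⟨look, hlook, hblock, hT.trans ?_⟩
  have h1 : (2 : ℝ) ^ modeBits n ≤ 14 * n := by exact_mod_cast two_pow_modeBits_le hn
  have h2 : (2 : ℝ) ^ hopBits (min M n) ≤ 6 * (min M n : ℕ) := by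
    exact_mod_cast two_pow_hopBits_le hM1
  have h3 : (2 : ℝ) * 2 ^ (modeBits n + hopBits (min M n)) / lam ≤ 168 * (n * M / lam) := by
    calc (2 : ℝ) * 2 ^ (modeBits n + hopBits (min M n)) / lam ≤ 2 * (14 * n * (6 * M)) / lam := by
          rw [pow_add]
          gcongr
          linarith
      _ = _ := by ring
  have h4 : (1 : ℝ) ≤ n := by exact_mod_cast hn
  linarith

/-- The table of a translation-invariant Hamiltonian, addressed by the displacement alone. -/
theorem exists_translationInvariant {β : Type} [Fintype β] [DecidableEq β]
    (hcode : HasCode n N τ) (hN : 1 ≤ N) (hn : 1 ≤ n) (hB : 0 < B) (hε : 0 < ε) (hε1 : ε < 1)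
    (hlam : 1 ≤ lam) {f : β → Fin n → Bool} (hf : Function.Injective f)
    (hfN : ∀ b, particles (f b) ≤ N) :
    ∃ (s : LookupScheme n (Fin (2 * n - 1))) (α : ℝ), 0 < α ∧ α ≤ 12 * B * (N * n) ∧
      (s.m : ℝ) ≤ wordConst B * (1 + Real.log (N * n / ε)) ∧
      ∀ T : ℤ → ℝ, (∀ d : ℤ, |d| < (n : ℤ) → |T d| ≤ B) →
        ∃ look : Circuit (s.Anc ⊕ Fin n),
          s.IsLookup look (fun i => T ((i : ℤ) - ((n : ℤ) - 1))) ∧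
          ‖(oneBody (fun p q : Fin n => T ((p : ℤ) - (q : ℤ))) - (α : ℂ) •
            ancBlock (Circuit.mat (s.circuit look))).submatrix id f‖ ≤ ε ∧
          (tCount (s.circuit look) : ℝ) ≤ 14 * τ + 2400 * n +
            112 * (lam * (1 + wordConst B * (1 + Real.log (N * n / ε)))) := by
  let e : Fin (0 + hopBits n) ↪ Fin (modeBits n) ⊕ Fin (hopBits n) :=
    (finCongr (zero_add _)).toEmbedding.trans Function.Embedding.inr
  let enc : Fin (2 * n - 1) → Fin (0 + hopBits n) → Bool := fun i a =>
    bits (hopBits n) ((i : ℕ) + 1) (finCongr (zero_add _) a)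
  have hl := lt_two_pow_hopBits n
  have hi : ∀ i : Fin (2 * n - 1), (i : ℕ) + 1 < 2 ^ hopBits n := fun i => by
    have := i.2
    omega
  have henc : Function.Injective enc := by
    intro i i' h
    have h1 : bits (hopBits n) ((i : ℕ) + 1) = bits (hopBits n) (i' + 1) :=
      (finCongr (zero_add (hopBits n))).surjective.injective_comp_right h
    have h2 := bits_inj (hi i) (hi i') h1
    exact Fin.ext (by omega)
  obtain ⟨s, α, hα, hα', hm, hs⟩ := exists_blockEncoding hcode hN hn le_rfl (X := N * n) hB
    le_rfl hε hε1 hlam (o := 0) (by simpa using hlam) e henc hf hfN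
  refine ⟨s, α, hα, hα', hm, fun T hT => ?_⟩
  have hr : ∀ i : Fin (2 * n - 1), |T ((i : ℤ) - ((n : ℤ) - 1))| ≤ B := fun i => hT _ (by
    have := i.2
    rw [abs_lt]
    omega)
  have hH : ∀ p q : Fin n, T ((p : ℤ) - (q : ℤ)) = hopCoeff n (fun q d =>
      Function.extend enc (fun i => T ((i : ℤ) - ((n : ℤ) - 1))) 0 fun a =>
        Sum.elim (bits (modeBits n) q) d (e a)) p q := by
    intro p q
    have hp := p.2
    have hq := q.2
    let i : Fin (2 * n - 1) := ⟨p + n - q - 1, by omega⟩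
    have hv : (p : ℕ) + n = q + ((i : ℕ) + 1) := by
      simp only [i]
      omega
    rw [hopCoeff_eq _ (hi i) hv]
    refine Eq.trans ?_ (henc.extend_apply _ _ i).symm
    congr 1
    omega
  obtain ⟨look, hlook, hblock, hcost⟩ := hs (fun i => T ((i : ℤ) - ((n : ℤ) - 1)))
    (fun p q : Fin n => T ((p : ℤ) - (q : ℤ))) hr hH
  refine ⟨look, hlook, hblock, hcost.trans ?_⟩
  have h2 : (2 : ℝ) ^ hopBits n ≤ 6 * n := by exact_mod_cast two_pow_hopBits_le hn
  have h4 : (1 : ℝ) ≤ n := by exact_mod_cast hn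
  linarith

end Layout

/-! ### The bounds -/

section Bounds

theorem clog_add_one_mul_log_two_le {η : ℕ} (hη : 1 ≤ η) :
    ((Nat.clog 2 η + 1 : ℕ) : ℝ) * Real.log 2 ≤ 2 * Real.log (η + 1) := by
  have h1 : (2 : ℝ) ^ (Nat.clog 2 η + 1) ≤ (η + 1) ^ 2 := by
    have h2 : (2 : ℝ) ^ Nat.clog 2 η ≤ 2 * η := by exact_mod_cast two_pow_clog_le hη
    rw [pow_succ]
    nlinarith [sq_nonneg ((η : ℝ) - 1)]
  have h3 := Real.log_le_log (by positivity) h1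
  rwa [Real.log_pow, Real.log_pow] at h3

/-- The constant of the theorem. -/
def totalConst (B : ℝ) : ℝ := 12 * B + 10000 * (1 + 2 * wordConst B) / Real.log 2

theorem wordConst_nonneg {B : ℝ} (hB : 0 < B) : 0 ≤ wordConst B := by
  have h5 : 0 ≤ Real.log (24 * B + 2) := Real.log_nonneg (by linarith)
  have h2 : 0 < Real.log 2 := Real.log_pos one_lt_two
  unfold wordConst
  positivity

theorem log_two_lt_one : Real.log 2 < 1 := Real.log_two_lt_d9.trans (by norm_num)

theorem twelve_mul_le {B : ℝ} (hB : 0 < B) : 12 * B ≤ totalConst B := by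
  have h2 : 0 < Real.log 2 := Real.log_pos one_lt_two
  have := wordConst_nonneg hB
  unfold totalConst
  have : 0 ≤ 10000 * (1 + 2 * wordConst B) / Real.log 2 := by positivity
  linarith

theorem two_mul_wordConst_le {B : ℝ} (hB : 0 < B) : 2 * wordConst B ≤ totalConst B := by
  have h2 : 0 < Real.log 2 := Real.log_pos one_lt_two
  have h3 := wordConst_nonneg hB
  unfold totalConst
  have : 10000 * (1 + 2 * wordConst B) ≤ 10000 * (1 + 2 * wordConst B) / Real.log 2 :=
    le_div_self (by positivity) h2 log_two_lt_one.le
  linarith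

/-- The sum of the costs. The term `P` is `n` on the full space and `n * log (η + 1)` in the sector, `Y`
is the number of hops divided by `lam`, and `S` collects the costs of order `P`. -/
theorem cost_le {B t P Y S Λ lam : ℝ} (hB : 0 < B) (hP : 0 ≤ P) (hY : 0 ≤ Y) (hΛ : 0 ≤ Λ)
    (hlam0 : 0 ≤ lam) (hS : S * Real.log 2 ≤ 4000 * P) (hlam : lam * Real.log 2 ≤ P + lam * Λ)
    (ht : t ≤ S + 9408 * Y + 112 * (lam * (1 + wordConst B * (1 + 2 * Λ)))) :
    t ≤ totalConst B * (P + Y + lam * Λ) := by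
  have h2 : 0 < Real.log 2 := Real.log_pos one_lt_two
  have h3 := wordConst_nonneg hB
  have h4 : 0 ≤ lam * Λ := mul_nonneg hlam0 hΛ
  have h5 := log_two_lt_one.le
  suffices t ≤ 10000 * (1 + 2 * wordConst B) / Real.log 2 * (P + Y + lam * Λ) by
    unfold totalConst
    rw [add_mul]
    have : 0 ≤ 12 * B * (P + Y + lam * Λ) := by positivity
    linarith
  rw [div_mul_eq_mul_div, le_div_iff₀ h2]
  set K := wordConst B
  have e1 : t * Real.log 2 ≤ S * Real.log 2 + 9408 * Y * Real.log 2 +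
      112 * (1 + K) * (lam * Real.log 2) + 224 * K * (lam * Λ) * Real.log 2 := by
    have := mul_le_mul_of_nonneg_right ht h2.le
    linarith
  have e2 : 9408 * Y * Real.log 2 ≤ 9408 * Y := mul_le_of_le_one_right (by positivity) h5
  have e3 : 224 * K * (lam * Λ) * Real.log 2 ≤ 224 * K * (lam * Λ) :=
    mul_le_of_le_one_right (by positivity) h5
  have e4 : 112 * (1 + K) * (lam * Real.log 2) ≤ 112 * (1 + K) * (P + lam * Λ) := by gcongr
  have e5 : 0 ≤ K * P := mul_nonneg h3 hP
  have e6 : 0 ≤ K * Y := mul_nonneg h3 hY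
  have e7 : 0 ≤ K * (lam * Λ) := mul_nonneg h3 h4
  linarith

/-- The cost `lam` of one bit of the words is at most `lam * log (X / ε)` up to a constant, except for
`X = 1`, where the logarithm may be arbitrarily small. -/
theorem lam_mul_log_two_le {X lam : ℕ} {ε P : ℝ} (hX : 1 ≤ X) (hP : 0 ≤ P) (hε : 0 < ε)
    (hε1 : ε < 1) (h1 : X = 1 → lam * Real.log 2 ≤ P) :
    lam * Real.log 2 ≤ P + lam * Real.log (X / ε) := by
  have hlog : ∀ Z : ℝ, 0 < Z → Z ≤ X → Real.log Z ≤ Real.log (X / ε) := by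
    intro Z hZ hZX
    refine Real.log_le_log hZ (hZX.trans ?_)
    exact le_div_self (by positivity) hε hε1.le
  rcases hX.eq_or_lt with h | h
  · have h2 := hlog 1 one_pos (by exact_mod_cast hX)
    rw [Real.log_one] at h2
    have := mul_nonneg (Nat.cast_nonneg (α := ℝ) lam) h2
    linarith [h1 h.symm]
  · have h2 := hlog 2 two_pos (by exact_mod_cast h)
    have := mul_le_mul_of_nonneg_left h2 (Nat.cast_nonneg (α := ℝ) lam)
    linarith

theorem log_div_nonneg {X : ℕ} {ε : ℝ} (hX : 1 ≤ X) (hε : 0 < ε) (hε1 : ε < 1) :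
    0 ≤ Real.log (X / ε) := by
  refine Real.log_nonneg ?_
  rw [one_le_div hε]
  have : (1 : ℝ) ≤ X := by exact_mod_cast hX
  linarith

theorem particles_le {n : ℕ} (y : Fin n → Bool) : particles y ≤ n :=
  (Finset.card_le_univ _).trans_eq (Fintype.card_fin n)

end Bounds

section Costs

/-- The cost of the sector code in terms of `n log (η + 1)`. -/
theorem sector_cost_le {n η : ℕ} (hη : 1 ≤ η) :
    (14 * ((10 * (n * (Nat.clog 2 η + 1)) : ℕ) : ℝ) + 2400 * n) * Real.log 2 ≤
      4000 * (n * Real.log (η + 1)) := by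
  have h1 := clog_add_one_mul_log_two_le hη
  have h2 : Real.log 2 ≤ Real.log (η + 1) := by
    have : (1 : ℝ) ≤ η := by exact_mod_cast hη
    exact Real.log_le_log two_pos (by linarith)
  have h3 : (0 : ℝ) ≤ n := Nat.cast_nonneg n
  have h4 := mul_le_mul_of_nonneg_left h1 h3
  have h5 := mul_le_mul_of_nonneg_left h2 h3
  have h6 : 0 ≤ n * Real.log 2 := mul_nonneg h3 (Real.log_pos one_lt_two).le
  push_cast at h4 ⊢
  linarith

theorem full_cost_le (n : ℕ) : (14 * ((9 * n : ℕ) : ℝ) + 2400 * n) * Real.log 2 ≤ 4000 * n := by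
  have h3 : (0 : ℝ) ≤ n := Nat.cast_nonneg n
  have h4 := mul_le_of_le_one_right h3 log_two_lt_one.le
  push_cast
  linarith

end Costs

end StructuredBE

end

open StructuredBE in
theorem mainTheorem4 (B : ℝ) (hB : 0 < B) :
    ∃ C : ℝ, 0 < C ∧
    -- banded coefficients, full space
    (∀ (n M lam : ℕ) (ε : ℝ), 1 ≤ n → 1 ≤ M → 1 ≤ lam → lam ≤ n * M → 0 < ε → ε < 1 →
      ∃ (s : StructuredBE.LookupScheme n (StructuredBE.Band n M)) (α : ℝ),
        0 < α ∧ α ≤ C * (n * M) ∧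
        (s.m : ℝ) ≤ C * (1 + Real.log (n * M / ε)) ∧
        ∀ h : Fin n → Fin n → ℝ,
          (∀ p q : Fin n, |(p : ℤ) - (q : ℤ)| ≤ (M : ℤ) → |h p q| ≤ B) →
          ∃ look : StructuredBE.Circuit (s.Anc ⊕ Fin n),
            s.IsLookup look (fun i => h i.1.1 i.1.2) ∧
            StructuredBE.IsBlockEncoding (s.circuit look) α ε
              (StructuredBE.oneBody (StructuredBE.truncate M h)) ∧
            (StructuredBE.tCount (s.circuit look) : ℝ) ≤
              C * (n + (⌈(n * M : ℝ) / lam⌉₊ : ℝ) + lam * Real.log (n * M / ε))) ∧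
    -- banded coefficients, η-particle sector
    (∀ (n M η lam : ℕ) (ε : ℝ), 1 ≤ η → η ≤ n → 1 ≤ M → 1 ≤ lam → lam ≤ n * M →
      0 < ε → ε < 1 →
      ∃ (s : StructuredBE.LookupScheme n (StructuredBE.Band n M)) (α : ℝ),
        0 < α ∧ α ≤ C * (M * η) ∧
        (s.m : ℝ) ≤ C * (1 + Real.log (η * M / ε)) ∧
        ∀ h : Fin n → Fin n → ℝ,
          (∀ p q : Fin n, |(p : ℤ) - (q : ℤ)| ≤ (M : ℤ) → |h p q| ≤ B) →
          ∃ look : StructuredBE.Circuit (s.Anc ⊕ Fin n),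
            s.IsLookup look (fun i => h i.1.1 i.1.2) ∧
            StructuredBE.IsSectorBlockEncoding (s.circuit look) η α ε
              (StructuredBE.oneBody (StructuredBE.truncate M h)) ∧
            (StructuredBE.tCount (s.circuit look) : ℝ) ≤
              C * (n * Real.log (η + 1) + (⌈(n * M : ℝ) / lam⌉₊ : ℝ)
                + lam * Real.log (η * M / ε))) ∧
    -- translation-invariant coefficients, full space
    (∀ (n lam : ℕ) (ε : ℝ), 1 ≤ n → 1 ≤ lam → lam ≤ 2 * n - 1 → 0 < ε → ε < 1 →
      ∃ (s : StructuredBE.LookupScheme n (Fin (2 * n - 1))) (α : ℝ),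
        0 < α ∧ α ≤ C * (n : ℝ) ^ 2 ∧
        (s.m : ℝ) ≤ C * (1 + Real.log (n / ε)) ∧
        ∀ T : ℤ → ℝ, (∀ d : ℤ, |d| < (n : ℤ) → |T d| ≤ B) →
          ∃ look : StructuredBE.Circuit (s.Anc ⊕ Fin n),
            s.IsLookup look (fun i => T ((i : ℤ) - ((n : ℤ) - 1))) ∧
            StructuredBE.IsBlockEncoding (s.circuit look) α ε
              (StructuredBE.oneBody (fun p q : Fin n => T ((p : ℤ) - (q : ℤ)))) ∧
            (StructuredBE.tCount (s.circuit look) : ℝ) ≤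
              C * (n + (⌈(n : ℝ) / lam⌉₊ : ℝ) + lam * Real.log (n / ε))) ∧
    -- translation-invariant coefficients, η-particle sector
    (∀ (n η lam : ℕ) (ε : ℝ), 1 ≤ η → η ≤ n → 1 ≤ lam → lam ≤ n * η → 0 < ε → ε < 1 →
      ∃ (s : StructuredBE.LookupScheme n (Fin (2 * n - 1))) (α : ℝ),
        0 < α ∧ α ≤ C * (n * η) ∧
        (s.m : ℝ) ≤ C * (1 + Real.log (n * η / ε)) ∧
        ∀ T : ℤ → ℝ, (∀ d : ℤ, |d| < (n : ℤ) → |T d| ≤ B) →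
          ∃ look : StructuredBE.Circuit (s.Anc ⊕ Fin n),
            s.IsLookup look (fun i => T ((i : ℤ) - ((n : ℤ) - 1))) ∧
            StructuredBE.IsSectorBlockEncoding (s.circuit look) η α ε
              (StructuredBE.oneBody (fun p q : Fin n => T ((p : ℤ) - (q : ℤ)))) ∧
            (StructuredBE.tCount (s.circuit look) : ℝ) ≤
              C * (n * Real.log (η + 1) + (⌈(n : ℝ) / lam⌉₊ : ℝ)
                + lam * Real.log (n * η / ε))) := by
  refine ⟨totalConst B, ?_, ?_, ?_, ?_, ?_⟩
  · exact (by positivity : 0 < 12 * B).trans_le (twelve_mul_le hB)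
  · intro n M lam ε hn hM hlam hlamn hε hε1
    have hX : 1 ≤ n * M := Nat.mul_pos hn hM
    have hΛ := log_div_nonneg hX hε hε1
    push_cast at hΛ
    obtain ⟨s, α, hα, hα', hm, hs⟩ := exists_banded (hasCode_binary hn) hn hn hM hB hε hε1 hlam
      Function.injective_id (fun y => particles_le y)
    refine ⟨s, α, hα, hα'.trans ?_, hm.trans ?_, fun h hh => ?_⟩
    · gcongr
      exact twelve_mul_le hB
    · gcongr
      linarith [two_mul_wordConst_le hB, wordConst_nonneg hB]
    obtain ⟨look, hlook, hblock, hT⟩ := hs h hh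
    refine ⟨look, hlook, hblock, cost_le hB (Nat.cast_nonneg n) (Nat.cast_nonneg _) hΛ
      (Nat.cast_nonneg lam) (full_cost_le n) ?_ (hT.trans ?_)⟩
    · have := lam_mul_log_two_le (lam := lam) hX (Nat.cast_nonneg n) hε hε1 fun h => ?_
      · exact_mod_cast this
      · have h1 : (lam : ℝ) ≤ n := by
          exact_mod_cast (show lam ≤ n by
            have := Nat.eq_one_of_mul_eq_one_left h
            subst this
            simpa using hlamn)
        exact (mul_le_of_le_one_right (Nat.cast_nonneg _) log_two_lt_one.le).trans h1
    · gcongr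
      · exact Nat.le_ceil _
      · exact wordConst_nonneg hB
      · linarith
  · intro n M η lam ε hη hηn hM hlam hlamn hε hε1
    have hX : 1 ≤ η * M := Nat.mul_pos hη hM
    have hΛ := log_div_nonneg hX hε hε1
    push_cast at hΛ
    have hP : (0 : ℝ) ≤ n * Real.log (η + 1) :=
      mul_nonneg (Nat.cast_nonneg n) (Real.log_nonneg (by linarith [Nat.cast_nonneg (α := ℝ) η]))
    obtain ⟨s, α, hα, hα', hm, hs⟩ := exists_banded (hasCode_count (n := n) hη) hη (hη.trans hηn) hM
      hB hε hε1 hlam (β := {y : Fin n → Bool // particles y = η}) Subtype.val_injective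
      (fun y => y.2.le)
    refine ⟨s, α, hα, hα'.trans ?_, hm.trans ?_, fun h hh => ?_⟩
    · rw [mul_comm (M : ℝ)]
      gcongr
      exact twelve_mul_le hB
    · gcongr
      linarith [two_mul_wordConst_le hB, wordConst_nonneg hB]
    obtain ⟨look, hlook, hblock, hT⟩ := hs h hh
    refine ⟨look, hlook, hblock, cost_le hB hP (Nat.cast_nonneg _) hΛ
      (Nat.cast_nonneg lam) (sector_cost_le hη) ?_ (hT.trans ?_)⟩
    · have := lam_mul_log_two_le (lam := lam) hX hP hε hε1 fun h => ?_
      · exact_mod_cast this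
      · have h1 : (lam : ℝ) ≤ n := by
          exact_mod_cast (show lam ≤ n by
            have := Nat.eq_one_of_mul_eq_one_left h
            subst this
            simpa using hlamn)
        have h2 : Real.log 2 ≤ Real.log (η + 1) := by
          have : (1 : ℝ) ≤ η := by exact_mod_cast hη
          exact Real.log_le_log two_pos (by linarith)
        gcongr
    · gcongr
      · exact Nat.le_ceil _
      · exact wordConst_nonneg hB
      · linarith
  · intro n lam ε hn hlam hlamn hε hε1
    have hΛ := log_div_nonneg hn hε hε1
    have hn1 : (1 : ℝ) ≤ n := by exact_mod_cast hn
    -- `log (n ^ 2 / ε)` is at most twice `log (n / ε)`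
    have hlog : Real.log (n * n / ε) ≤ 2 * Real.log (n / ε) := by
      rw [mul_div_assoc, Real.log_mul (by positivity) (by positivity), two_mul]
      gcongr
      exact le_div_self (by positivity) hε hε1.le
    obtain ⟨s, α, hα, hα', hm, hs⟩ := exists_translationInvariant (hasCode_binary hn) hn hn hB hε
      hε1 hlam Function.injective_id (fun y => particles_le y)
    refine ⟨s, α, hα, hα'.trans ?_, hm.trans ?_, fun T hT => ?_⟩
    · rw [sq]
      gcongr
      exact twelve_mul_le hB
    · have h1 := wordConst_nonneg hB
      calc wordConst B * (1 + Real.log (n * n / ε)) ≤ wordConst B * (2 * (1 + Real.log (n / ε))) := by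
            gcongr
            linarith
        _ = 2 * wordConst B * (1 + Real.log (n / ε)) := by ring
        _ ≤ _ := by
          gcongr
          exact two_mul_wordConst_le hB
    obtain ⟨look, hlook, hblock, hcost⟩ := hs T hT
    refine ⟨look, hlook, hblock, cost_le hB (Nat.cast_nonneg n) (Nat.cast_nonneg _) hΛ
      (Nat.cast_nonneg lam) (full_cost_le n) ?_ (hcost.trans ?_)⟩
    · refine lam_mul_log_two_le hn (Nat.cast_nonneg n) hε hε1 fun h => ?_
      have h1 : (lam : ℝ) ≤ n := by exact_mod_cast (show lam ≤ n by omega)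
      exact (mul_le_of_le_one_right (Nat.cast_nonneg _) log_two_lt_one.le).trans h1
    · have h1 := wordConst_nonneg hB
      have h2 : (0 : ℝ) ≤ 9408 * (⌈(n : ℝ) / lam⌉₊ : ℝ) := by positivity
      have h3 : 112 * (lam * (1 + wordConst B * (1 + Real.log (n * n / ε)))) ≤
          112 * (lam * (1 + wordConst B * (1 + 2 * Real.log (n / ε)))) := by gcongr
      linarith
  · intro n η lam ε hη hηn hlam hlamn hε hε1
    have hX : 1 ≤ n * η := Nat.mul_pos (hη.trans hηn) hη
    have hΛ := log_div_nonneg hX hε hε1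
    push_cast at hΛ
    have hP : (0 : ℝ) ≤ n * Real.log (η + 1) :=
      mul_nonneg (Nat.cast_nonneg n) (Real.log_nonneg (by linarith [Nat.cast_nonneg (α := ℝ) η]))
    obtain ⟨s, α, hα, hα', hm, hs⟩ := exists_translationInvariant (hasCode_count (n := n) hη) hη
      (hη.trans hηn) hB hε hε1 hlam (β := {y : Fin n → Bool // particles y = η})
      Subtype.val_injective (fun y => y.2.le)
    rw [mul_comm (η : ℝ)] at hα' hm hs
    refine ⟨s, α, hα, hα'.trans ?_, hm.trans ?_, fun T hT => ?_⟩
    · gcongr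
      exact twelve_mul_le hB
    · gcongr
      linarith [two_mul_wordConst_le hB, wordConst_nonneg hB]
    obtain ⟨look, hlook, hblock, hcost⟩ := hs T hT
    refine ⟨look, hlook, hblock, cost_le hB hP (Nat.cast_nonneg _) hΛ
      (Nat.cast_nonneg lam) (sector_cost_le hη) ?_ (hcost.trans ?_)⟩
    · have := lam_mul_log_two_le (lam := lam) hX hP hε hε1 fun h => ?_
      · exact_mod_cast this
      · have h1 : (lam : ℝ) ≤ n := by
          exact_mod_cast (show lam ≤ n by
            have := Nat.eq_one_of_mul_eq_one_left h
            subst this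
            simpa using hlamn)
        have h2 : Real.log 2 ≤ Real.log (η + 1) := by
          have : (1 : ℝ) ≤ η := by exact_mod_cast hη
          exact Real.log_le_log two_pos (by linarith)
        gcongr
    · have h1 := wordConst_nonneg hB
      have h2 : (0 : ℝ) ≤ 9408 * (⌈(n : ℝ) / lam⌉₊ : ℝ) := by positivity
      have h3 : 112 * (lam * (1 + wordConst B * (1 + Real.log (n * η / ε)))) ≤
          112 * (lam * (1 + wordConst B * (1 + 2 * Real.log (n * η / ε)))) := by
        gcongr
        linarith
      linarith
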